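/- Let $n\ge 0$ be an integer and let $H,F$ be fixed finite graphs. In the Constructor--Blocker game on the complete graph $K_n$, two players, Constructor and Blocker, alternately claim a previously unclaimed edge of $K_n$, Constructor moving first. Constructor may only claim an edge if the graph $\mathcal C$ formed by her edges stays $F$-free, i.e. contains no (not necessarily induced) subgraph isomorphic to $F$; Blocker may claim any unclaimed edge. The game ends as soon as Constructor cannot claim any more edges or all edges have been claimed. The score is then the number of copies of $H$ in $\mathcal C$, i.e. the number of subgraphs of $\mathcal C$ isomorphic to $H$. Constructor wants to maximize the score and Blocker wants to minimize it; $g(n,H,F)$ denotes the score when both play optimally. Let $K_k$ be the complete graph on $k$ vertices and let $S_5$ be the star with $5$ leaves (so being $S_5$-free means having maximum degree at most $4$). Then, as $n\to\infty$, $$(1+o(1))\,\frac{2n}{3}\;\le\; g(n,K_3,S_5)\;\le\;(1+o(1))\,n .$$ Moreover, $g(n,K_4,S_5)=0$ for all $n\ge 0$. -/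

import Mathlib

open Filter Topology

namespace ConstructorBlocker

/-- The star with `k` leaves, on the vertex set `{0, …, k}` with centre `0`. -/
def starWithLeaves (k : ℕ) : SimpleGraph (Fin (k + 1)) :=
  SimpleGraph.starGraph 0

section Game

variable {W W' : Type} {n : ℕ}

/-- The graph on the vertex set of `K_n` formed by a set of claimed edges. -/
def graphOf (C : Finset (Sym2 (Fin n))) : SimpleGraph (Fin n) :=
  SimpleGraph.fromEdgeSet (C : Set (Sym2 (Fin n)))

/-- The edges of `K_n` claimed neither by Constructor (`C`) nor by Blocker (`B`). -/
def unclaimed (C B : Finset (Sym2 (Fin n))) : Finset (Sym2 (Fin n)) :=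
  (⊤ : SimpleGraph (Fin n)).edgeFinset \ (C ∪ B)

open Classical in
/-- The edges Constructor may claim: the unclaimed ones that keep her graph `F`-free. -/
noncomputable def constructorMoves (F : SimpleGraph W') (C B : Finset (Sym2 (Fin n))) :
    Finset (Sym2 (Fin n)) :=
  (unclaimed C B).filter fun e => F.Free (graphOf (insert e C))

theorem constructorMoves_subset (F : SimpleGraph W') (C B : Finset (Sym2 (Fin n))) :
    constructorMoves F C B ⊆ unclaimed C B := by
  classical
  exact Finset.filter_subset _ _

theorem card_unclaimed_insert_left {C B : Finset (Sym2 (Fin n))} {e : Sym2 (Fin n)}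
    (he : e ∈ unclaimed C B) : (unclaimed (insert e C) B).card < (unclaimed C B).card := by
  apply Finset.card_lt_card
  refine ⟨fun x hx => ?_, fun h => ?_⟩
  · simp only [unclaimed, Finset.mem_sdiff, Finset.mem_union, Finset.mem_insert] at hx ⊢
    tauto
  · have := h he
    simp [unclaimed] at this

theorem card_unclaimed_insert_right {C B : Finset (Sym2 (Fin n))} {e : Sym2 (Fin n)}
    (he : e ∈ unclaimed C B) : (unclaimed C (insert e B)).card < (unclaimed C B).card := by
  apply Finset.card_lt_card
  refine ⟨fun x hx => ?_, fun h => ?_⟩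
  · simp only [unclaimed, Finset.mem_sdiff, Finset.mem_union, Finset.mem_insert] at hx ⊢
    tauto
  · have := h he
    simp [unclaimed] at this

mutual

/-- The final score under optimal play from the position in which Constructor has claimed `C`,
Blocker has claimed `B`, and it is Constructor's turn. The game is over as soon as Constructor
has no legal move; the score is then the number of copies of `H` in her graph. -/
noncomputable def constructorTurn (H : SimpleGraph W) (F : SimpleGraph W')
    (C B : Finset (Sym2 (Fin n))) : ℕ :=
  open Classical in
  if h : (constructorMoves F C B).Nonempty then
    (constructorMoves F C B).attach.sup' (Finset.attach_nonempty_iff.mpr h)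
      fun e => blockerTurn H F (insert e.1 C) B
  else (graphOf C).copyCount H
termination_by (unclaimed C B).card
decreasing_by exact card_unclaimed_insert_left (constructorMoves_subset F C B e.2)

/-- The final score under optimal play from the position in which Constructor has claimed `C`,
Blocker has claimed `B`, and it is Blocker's turn. Blocker may claim any unclaimed edge. -/
noncomputable def blockerTurn (H : SimpleGraph W) (F : SimpleGraph W')
    (C B : Finset (Sym2 (Fin n))) : ℕ :=
  open Classical in
  if h : (constructorMoves F C B).Nonempty then
    (unclaimed C B).attach.inf'
      (Finset.attach_nonempty_iff.mpr (h.mono (constructorMoves_subset F C B)))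
      fun e => constructorTurn H F C (insert e.1 B)
  else (graphOf C).copyCount H
termination_by (unclaimed C B).card
decreasing_by exact card_unclaimed_insert_right e.2

end

end Game

/-- `g n H F`: the score of the Constructor-Blocker game on `K_n` under optimal play, where
Constructor moves first, keeps her graph `F`-free and maximizes the number of copies of `H`. -/
noncomputable def g {W W' : Type} (n : ℕ) (H : SimpleGraph W) (F : SimpleGraph W') : ℕ :=
  constructorTurn (n := n) H F ∅ ∅

end ConstructorBlocker

/-!
Both bounds come from explicit strategies.

*Blocker.* A position is described by two relations: `A x y` if Constructor has claimed `xy`, and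
`L x y` if she may still claim it. After each of his moves Blocker keeps the invariant `Safe`:
Constructor has no `K₄` and no octahedron, neither can be completed by a single legal edge, and
none of six small configurations (`PendantDiamond`, `PendantSquare`, `Bull`, `PolarTheta`,
`MiddleTheta`, `PuncturedBipartite`), out of which two simultaneous threats could grow, is present.
A move of Constructor can violate this only in ways that involve the new edge `uv`, and one
reply repairs everything (`Played.safe_reply`). The reply is chosen in this order: the missing edge
of an octahedron, the missing edge of a `K₄`, a pair of a pendant diamond, polar theta, punctured
bipartite graph, middle theta, pendant square or bull, and otherwise any legal pair that forms
a triangle with `uv` and a present edge. Hence Constructor never gets a `K₄`, so she scores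
`0` for `K₄`. For triangles, a graph of maximum degree four without `K₄` and octahedra has at most
as many triangles as vertices (`Sparse.sum_wedge_le`): a vertex in four triangles has a
four-cycle as neighbourhood, and it can charge its surplus to vertices lying in at most two
triangles. `constructorTurn_le` transfers both facts to the game.

*Constructor.* She uses fresh vertices of small Blocker degree to build units on six vertices with
three triangles each (`Site.of_empty`): a fresh vertex `r` is joined to a vertex `y`, and then to
one of two neighbours of `y`, of which Blocker can spoil only one. Every unit leaves a vertex of
degree at most one, a vertex of degree at most two, and a live edge, that is, an edge whose ends
have degrees at most two and three. Two live edges can be joined so as to gain one more triangle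
(`LiveSet.le_value`), and joining a vertex of degree at most one to a vertex of degree at most two
of another unit creates a further live edge (`Pools.le_value`). So six vertices account for
`3 + 1/2 + 1/2 = 4` triangles, up to the `O(√n)` units for which the required pairs are no longer
available.
-/

namespace ConstructorBlocker

/-! ### Positions and Blocker's invariant -/

section Invariant

variable {V : Type*}

/-- The vertex `a` has at most two neighbours. -/
def AtMostTwo (A : V → V → Prop) (a : V) : Prop :=
  ∀ x y z, A a x → A a y → A a z → x = y ∨ x = z ∨ y = z

/-- The vertex `a` has at most three neighbours. -/
def AtMostThree (A : V → V → Prop) (a : V) : Prop :=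
  ∀ x y z w, A a x → A a y → A a z → A a w → x = y ∨ x = z ∨ y = z ∨ w = x ∨ w = y ∨ w = z

/-- The basic facts about a position of the game with maximum degree four: `A x y` means that
Constructor has claimed the edge `xy`, and `L x y` that she may still claim it (the pair is legal),
which requires that both ends have degree at most three. -/
structure Board (A L : V → V → Prop) : Prop where
  symm : ∀ x y, A x y → A y x
  ne : ∀ x y, A x y → x ≠ y
  lsymm : ∀ x y, L x y → L y x
  lne : ∀ x y, L x y → x ≠ y
  notAdj : ∀ x y, L x y → ¬ A x y
  le_three : ∀ x y, L x y → AtMostThree A x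
  le_four : ∀ x a b c d w, A x a → A x b → A x c → A x d → A x w →
    a ≠ b → a ≠ c → a ≠ d → b ≠ c → b ≠ d → c ≠ d → w = a ∨ w = b ∨ w = c ∨ w = d

/-- A diamond with central edge `pq` whose missing edge `bc` is legal: one move would complete a
`K₄`. -/
def Threat (A L : V → V → Prop) (p q b c : V) : Prop :=
  A p q ∧ A p b ∧ A p c ∧ A q b ∧ A q c ∧ L b c

/-- Some neighbour `z` of one end of `uv` is neither adjacent nor joinable to the other end, so that
no triangle through `uv` and `z` can arise any more. -/
def Guard (A L : V → V → Prop) (u v : V) : Prop :=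
  ∃ z, (A u z ∧ z ≠ v ∧ ¬ A v z ∧ ¬ L v z) ∨ (A v z ∧ z ≠ u ∧ ¬ A u z ∧ ¬ L u z)

/-- A diamond with central edge `pq` and tips `b`, `c`, together with a pendant edge `qa` such that
`a` has degree at most two and may be joined to `p`, `b` and `c`. -/
def PendantDiamond (A L : V → V → Prop) (p q b c a : V) : Prop :=
  A p q ∧ A p b ∧ A p c ∧ A q b ∧ A q c ∧ A q a ∧ b ≠ c ∧ L p a ∧ L a b ∧ L a c ∧ AtMostTwo A a

/-- A four-cycle `p b q c` with both diagonals legal, together with a pendant edge `qa` such that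
`a` may be joined to `p`, `b` and `c`; `p` and `a` have degree at most two. -/
def PendantSquare (A L : V → V → Prop) (p q b c a : V) : Prop :=
  A p b ∧ A p c ∧ A q a ∧ A q b ∧ A q c ∧ L p q ∧ L b c ∧ L p a ∧ L a b ∧ L a c ∧
    AtMostTwo A p ∧ AtMostTwo A a

/-- A triangle `p q c` with horns `pb` and `qa`, in which the pairs `qb`, `pa`, `ab`, `ac` and `bc`
are legal; `a` and `b` have degree at most two. -/
def Bull (A L : V → V → Prop) (p q c b a : V) : Prop :=
  A p q ∧ A p c ∧ A q c ∧ A p b ∧ A q a ∧ L q b ∧ L p a ∧ L a b ∧ L a c ∧ L b c ∧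
    AtMostTwo A a ∧ AtMostTwo A b

/-- A `K₂,₃` with poles `p`, `q` and middle vertices `a`, `b`, `c` in which the poles may be joined
to each other, and `a` may be joined to `b` and `c`. -/
def PolarTheta (A L : V → V → Prop) (p q a b c : V) : Prop :=
  A p a ∧ A p b ∧ A p c ∧ A q a ∧ A q b ∧ A q c ∧ b ≠ c ∧ L p q ∧ L a b ∧ L a c

/-- A `K₂,₃` with poles `p`, `q` of degree at most three and middle vertices `a`, `b`, `c` any two
of which may be joined. -/
def MiddleTheta (A L : V → V → Prop) (p q a b c : V) : Prop :=
  A p a ∧ A p b ∧ A p c ∧ A q a ∧ A q b ∧ A q c ∧ p ≠ q ∧ L a b ∧ L a c ∧ L b c ∧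
    AtMostThree A p ∧ AtMostThree A q

/-- A `K₃,₃` with parts `{p, q, q'}` and `{a, b, c}`, without its edge `pa`, in which `pa`, `pq`,
`pq'`, `ab` and `ac` are legal; `p` and `a` have degree at most two. -/
def PuncturedBipartite (A L : V → V → Prop) (p a q q' b c : V) : Prop :=
  A p b ∧ A p c ∧ A a q ∧ A a q' ∧ A q b ∧ A q c ∧ A q' b ∧ A q' c ∧ b ≠ c ∧ q ≠ q' ∧
    L p a ∧ L p q ∧ L p q' ∧ L a b ∧ L a c ∧ AtMostTwo A p ∧ AtMostTwo A a

/-- The part of Blocker's invariant that concerns `K₄`. Besides `K₄` and threats it excludes six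
configurations from which Constructor could produce two threats at once. In addition, two edges
`uv`, `uw` whose ends `v`, `w` may still be joined are not both unguarded (`cherry`), and a vertex
of degree four has two neighbours that are neither adjacent nor joinable (`full`). -/
structure Inv (A L : V → V → Prop) : Prop where
  k4 : ∀ p q b c, A p q → A p b → A p c → A q b → A q c → ¬ A b c
  threat : ∀ p q b c, ¬ Threat A L p q b c
  cherry : ∀ u v w, A u v → A u w → L v w → Guard A L u v ∨ Guard A L u w
  full : ∀ q a b c d, A q a → A q b → A q c → A q d → a ≠ b → a ≠ c → a ≠ d → b ≠ c → b ≠ d →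
    c ≠ d → ∃ x y, A q x ∧ A q y ∧ x ≠ y ∧ ¬ A x y ∧ ¬ L x y
  pendantDiamond : ∀ p q b c a, ¬ PendantDiamond A L p q b c a
  pendantSquare : ∀ p q b c a, ¬ PendantSquare A L p q b c a
  bull : ∀ p q c b a, ¬ Bull A L p q c b a
  polarTheta : ∀ p q a b c, ¬ PolarTheta A L p q a b c
  middleTheta : ∀ p q a b c, ¬ MiddleTheta A L p q a b c
  punctured : ∀ p a q q' b c, ¬ PuncturedBipartite A L p a q q' b c

/-- Constructor has claimed the legal edge `uv` in a position `A`, `L` that satisfies the invariant,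
which leads to the position `A₁`, `L₁` with Blocker to move. -/
structure Played (A L A₁ L₁ : V → V → Prop) (u v : V) : Prop where
  b : Board A L
  b₁ : Board A₁ L₁
  inv : Inv A L
  huv : L u v
  adj : ∀ x y, A₁ x y ↔ A x y ∨ (x = u ∧ y = v) ∨ (x = v ∧ y = u)
  le : ∀ x y, L₁ x y → L x y

theorem Played.symm {A L A₁ L₁ : V → V → Prop} {u v : V} (h : Played A L A₁ L₁ u v) :
    Played A L A₁ L₁ v u :=
  ⟨h.b, h.b₁, h.inv, h.b.lsymm _ _ h.huv, fun x y => by rw [h.adj]; tauto, h.le⟩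

theorem exact_four {A L : V → V → Prop} (h : Board A L) {x a b c d : V} (ha : A x a) (hb : A x b)
    (hc : A x c) (hd : A x d) (h1 : a ≠ b) (h2 : a ≠ c) (h3 : a ≠ d) (h4 : b ≠ c) (h5 : b ≠ d)
    (h6 : c ≠ d) : ∀ w, A x w → w = a ∨ w = b ∨ w = c ∨ w = d :=
  fun w hw => h.le_four x a b c d w ha hb hc hd hw h1 h2 h3 h4 h5 h6

theorem exact_three {A L : V → V → Prop} (h : Board A L) {x y a b c : V} (hl : L x y) (ha : A x a)
    (hb : A x b) (hc : A x c) (h1 : a ≠ b) (h2 : a ≠ c) (h3 : b ≠ c) :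
    ∀ w, A x w → w = a ∨ w = b ∨ w = c := by
  intro w hw
  have := h.le_three x y hl a b c w ha hb hc hw
  tauto

variable {A L A₁ L₁ L' : V → V → Prop} {u v : V}

/-- The legal pairs after Blocker has claimed `xy`. -/
def Without (L : V → V → Prop) (x y : V) : V → V → Prop :=
  fun a b => L a b ∧ ¬ ((a = x ∧ b = y) ∨ (a = y ∧ b = x))

/-! ### The effect of a move -/

theorem Without.le {x y : V} : ∀ a b, Without L x y a b → L a b := fun _ _ h => h.1

theorem Board.mono (h : Board A L) (hs : ∀ x y, L' x y → L' y x)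
    (hl : ∀ x y, L' x y → L x y) : Board A L' :=
  ⟨h.symm, h.ne, hs, fun x y hxy => h.lne x y (hl x y hxy),
    fun x y hxy => h.notAdj x y (hl x y hxy),
    fun x y hxy => h.le_three x y (hl x y hxy), h.le_four⟩

theorem Board.without (h : Board A L) (x y : V) : Board A (Without L x y) :=
  h.mono (fun a b hab => ⟨h.lsymm _ _ hab.1, fun h' => hab.2 (by tauto)⟩) Without.le

theorem Played.mono_legal (h : Played A L A₁ L₁ u v) (x y : V) :
    Played A L A₁ (Without L₁ x y) u v :=
  ⟨h.b, h.b₁.without x y, h.inv, h.huv, h.adj, fun a b hab => h.le a b hab.1⟩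

theorem Played.of_adj (h : Played A L A₁ L₁ u v) {x y : V} (hxy : A x y) : A₁ x y :=
  (h.adj x y).2 (Or.inl hxy)

theorem Played.atMostTwo (h : Played A L A₁ L₁ u v) {a : V} (ha : AtMostTwo A₁ a) :
    AtMostTwo A a :=
  fun x y z hx hy hz => ha x y z (h.of_adj hx) (h.of_adj hy) (h.of_adj hz)

theorem Played.atMostThree (h : Played A L A₁ L₁ u v) {a : V} (ha : AtMostThree A₁ a) :
    AtMostThree A a :=
  fun x y z w hx hy hz hw => ha x y z w (h.of_adj hx) (h.of_adj hy) (h.of_adj hz) (h.of_adj hw)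

theorem Played.not_adj_of_illegal (h : Played A L A₁ L₁ u v) {x y : V} (h1 : ¬ A x y)
    (h2 : ¬ L x y) : ¬ A₁ x y := by
  have := h.huv
  have := h.b.lsymm _ _ h.huv
  rw [h.adj]
  rintro (h | ⟨rfl, rfl⟩ | ⟨rfl, rfl⟩) <;> contradiction

theorem Guard.mono (h : Played A L A₁ L₁ u v) {a b : V} (hg : Guard A L a b) :
    Guard A₁ L₁ a b := by
  obtain ⟨z, ⟨h1, h2, h3, h4⟩ | ⟨h1, h2, h3, h4⟩⟩ := hg
  · exact ⟨z, Or.inl ⟨h.of_adj h1, h2, h.not_adj_of_illegal h3 h4, fun h5 => h4 (h.le _ _ h5)⟩⟩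
  · exact ⟨z, Or.inr ⟨h.of_adj h1, h2, h.not_adj_of_illegal h3 h4, fun h5 => h4 (h.le _ _ h5)⟩⟩

theorem Guard.symm {a b : V} (hg : Guard A L a b) : Guard A L b a := by
  obtain ⟨z, hz⟩ := hg
  exact ⟨z, hz.symm⟩

/-- The new edge completes no `K₄`, because there was no threat before the move. -/
theorem Played.k4 (h : Played A L A₁ L₁ u v) :
    ∀ p q b c, A₁ p q → A₁ p b → A₁ p c → A₁ q b → A₁ q c → ¬ A₁ b c := by
  have key : ∀ p q b c, A p q → A p b → A p c → A q b → A q c → ¬ L b c :=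
    fun p q b c h1 h2 h3 h4 h5 h6 => h.inv.threat p q b c ⟨h1, h2, h3, h4, h5, h6⟩
  have hk := h.inv.k4
  have hs := h.b.symm
  have hn := h.b₁.ne
  have hl := h.huv
  have hl' := h.b.lsymm _ _ h.huv
  intro p q b c h1 h2 h3 h4 h5 h6
  have n1 := hn _ _ h1
  have n2 := hn _ _ h2
  have n3 := hn _ _ h3
  have n4 := hn _ _ h4
  have n5 := hn _ _ h5
  have n6 := hn _ _ h6
  rw [h.adj] at h1 h2 h3 h4 h5 h6
  clear hn
  have k1 := hk p q b c
  have k2 := key p q b c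
  have k3 := key p b q c
  have k4 := key p c q b
  have k5 := key q b p c
  have k6 := key q c p b
  have k7 := key b c p q
  clear key hk
  grind

/-- Only the new edge can violate the cherry condition; it does not if it is guarded, or if it forms
no triangle with an edge and a legal pair. -/
theorem Played.cherry (h : Played A L A₁ L₁ u v)
    (hg : Guard A₁ L₁ u v ∨
      (∀ z, A₁ u z → z ≠ v → ¬ L₁ v z) ∧ (∀ z, A₁ v z → z ≠ u → ¬ L₁ u z)) :
    ∀ a b c, A₁ a b → A₁ a c → L₁ b c → Guard A₁ L₁ a b ∨ Guard A₁ L₁ a c := by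
  intro a b c hab hac hbc
  by_cases h1 : A a b
  · by_cases h2 : A a c
    · rcases h.inv.cherry a b c h1 h2 (h.le _ _ hbc) with hg | hg
      · exact Or.inl (hg.mono h)
      · exact Or.inr (hg.mono h)
    · have := (h.adj a c).1 hac
      have := h.b₁.lne _ _ hbc
      have := h.b₁.lsymm _ _ hbc
      rcases hg with hg | hg
      · have := hg.symm
        right
        grind
      · grind
  · have := (h.adj a b).1 hab
    have := h.b₁.lne _ _ hbc
    have := h.b₁.lsymm _ _ hbc
    rcases hg with hg | hg
    · have := hg.symm
      left
      grind
    · grind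

/-- If `q` has degree four, then two of its neighbours are neither adjacent nor joinable. -/
def FullSplit (A L : V → V → Prop) (q : V) : Prop :=
  ∀ a b c d, A q a → A q b → A q c → A q d → a ≠ b → a ≠ c → a ≠ d → b ≠ c → b ≠ d →
    c ≠ d → ∃ x y, A q x ∧ A q y ∧ x ≠ y ∧ ¬ A x y ∧ ¬ L x y

theorem Played.full (h : Played A L A₁ L₁ u v) {q : V} (hu : q ≠ u) (hv : q ≠ v) :
    FullSplit A₁ L₁ q := by
  intro a b c d ha hb hc hd h1 h2 h3 h4 h5 h6
  have key : ∀ x, A₁ q x → A q x := by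
    intro x hx
    rw [h.adj] at hx
    tauto
  obtain ⟨x, y, hx, hy, hxy, h7, h8⟩ := h.inv.full q a b c d (key _ ha) (key _ hb) (key _ hc)
    (key _ hd) h1 h2 h3 h4 h5 h6
  exact ⟨x, y, h.of_adj hx, h.of_adj hy, hxy, h.not_adj_of_illegal h7 h8,
    fun h9 => h8 (h.le _ _ h9)⟩

/-- What remains to be verified after Blocker's reply: everything else is inherited from the
position before the move. -/
theorem Played.inv_of (h : Played A L A₁ L₁ u v)
    (hnt : ∀ p q b c, ¬ Threat A₁ L₁ p q b c)
    (hg : Guard A₁ L₁ u v ∨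
      (∀ z, A₁ u z → z ≠ v → ¬ L₁ v z) ∧ (∀ z, A₁ v z → z ≠ u → ¬ L₁ u z))
    (hu : FullSplit A₁ L₁ u) (hv : FullSplit A₁ L₁ v)
    (hdb : ∀ p q b c a, ¬ PendantDiamond A₁ L₁ p q b c a)
    (hcp : ∀ p q b c a, ¬ PendantSquare A₁ L₁ p q b c a)
    (hq2 : ∀ p q c b a, ¬ Bull A₁ L₁ p q c b a)
    (hdk : ∀ p q a b c, ¬ PolarTheta A₁ L₁ p q a b c)
    (ht3 : ∀ p q a b c, ¬ MiddleTheta A₁ L₁ p q a b c)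
    (hx : ∀ p a q q' b c, ¬ PuncturedBipartite A₁ L₁ p a q q' b c) : Inv A₁ L₁ := by
  refine ⟨h.k4, hnt, h.cherry hg, ?_, hdb, hcp, hq2, hdk, ht3, hx⟩
  intro q
  by_cases h1 : q = u
  · subst h1; exact hu
  by_cases h2 : q = v
  · subst h2; exact hv
  exact h.full h1 h2

/-! ### Replies that restore the cherry condition -/

theorem fullSplit_of_atMostThree (h : AtMostThree A v) : FullSplit A L v := by
  intro a b c d ha hb hc hd h1 h2 h3 h4 h5 h6
  have := h a b c d ha hb hc hd
  tauto

/-- A reply at a pair `vz` with `z` a neighbour of `u` guards the new edge `uv` and splits the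
neighbourhood of `u`, so only the configurations and threats have to be checked. -/
theorem Played.inv_of_cherry (h : Played A L A₁ L₁ u v) {z : V}
    (hnt : ∀ p q b c, ¬ Threat A₁ L₁ p q b c)
    (huz : A₁ u z) (hvz : L₁ v z)
    (hdb : ∀ p q b c a, ¬ PendantDiamond A₁ (Without L₁ v z) p q b c a)
    (hcp : ∀ p q b c a, ¬ PendantSquare A₁ (Without L₁ v z) p q b c a)
    (hq2 : ∀ p q c b a, ¬ Bull A₁ (Without L₁ v z) p q c b a)
    (hdk : ∀ p q a b c, ¬ PolarTheta A₁ (Without L₁ v z) p q a b c)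
    (ht3 : ∀ p q a b c, ¬ MiddleTheta A₁ (Without L₁ v z) p q a b c)
    (hx : ∀ p a q q' b c, ¬ PuncturedBipartite A₁ (Without L₁ v z) p a q q' b c) :
    Inv A₁ (Without L₁ v z) := by
  have h1 : A₁ u v := (h.adj u v).2 (Or.inr (Or.inl ⟨rfl, rfl⟩))
  have h2 : z ≠ v := (h.b₁.lne _ _ hvz).symm
  have h3 : ¬ A₁ v z := h.b₁.notAdj _ _ hvz
  have h4 : ¬ Without L₁ v z v z := fun h5 => h5.2 (Or.inl ⟨rfl, rfl⟩)
  refine (h.mono_legal v z).inv_of (fun p q b c ht => hnt p q b c ?_)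
    (Or.inl ⟨z, Or.inl ⟨huz, h2, h3, h4⟩⟩) ?_
    (fullSplit_of_atMostThree (h.b₁.le_three _ _ hvz)) hdb hcp hq2 hdk ht3 hx
  · exact ⟨ht.1, ht.2.1, ht.2.2.1, ht.2.2.2.1, ht.2.2.2.2.1, ht.2.2.2.2.2.1⟩
  · intro _ _ _ _ _ _ _ _ _ _ _ _ _ _
    exact ⟨v, z, h1, huz, h2.symm, h3, h4⟩

theorem Played.full_of_no_cherry (h : Played A L A₁ L₁ u v)
    (hnt : ∀ p q b c, ¬ Threat A₁ L₁ p q b c)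
    (hg : ∀ z, A₁ u z → z ≠ v → ¬ L₁ v z) : FullSplit A₁ L₁ u := by
  intro a b c d ha hb hc hd h1 h2 h3 h4 h5 h6
  have huv : A₁ u v := (h.adj u v).2 (Or.inr (Or.inl ⟨rfl, rfl⟩))
  have key : ∀ z, A₁ u z → z ≠ v → A₁ v z ∨ ∃ x y,
    A₁ u x ∧ A₁ u y ∧ x ≠ y ∧ ¬ A₁ x y ∧ ¬ L₁ x y := by
    intro z hz hzv
    by_cases h7 : A₁ v z
    · exact Or.inl h7
    · exact Or.inr ⟨v, z, huv, hz, hzv.symm, h7, hg z hz hzv⟩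
  have key2 : ∀ x y, A₁ u x → A₁ u y → x ≠ v → y ≠ v → x ≠ y →
      ∃ x y, A₁ u x ∧ A₁ u y ∧ x ≠ y ∧ ¬ A₁ x y ∧ ¬ L₁ x y := by
    intro x y hx hy hxv hyv hxy
    rcases key x hx hxv with h7 | h7
    · rcases key y hy hyv with h8 | h8
      · exact ⟨x, y, hx, hy, hxy, h.k4 u v x y huv hx hy h7 h8,
          fun h9 => hnt u v x y ⟨huv, hx, hy, h7, h8, h9⟩⟩
      · exact h8
    · exact h7
  by_cases h7 : a = v
  · exact key2 b c hb hc (h7 ▸ h1.symm) (h7 ▸ h2.symm) h4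
  · by_cases h8 : b = v
    · exact key2 a c ha hc h7 (h8 ▸ h4.symm) h2
    · exact key2 a b ha hb h7 h8 h1

/-- If the new edge forms no triangle with an edge and a legal pair, then the cherry condition and
the condition on full vertices hold without a reply. -/
theorem Played.inv_of_no_cherry (h : Played A L A₁ L₁ u v)
    (hnt : ∀ p q b c, ¬ Threat A₁ L₁ p q b c)
    (hg : ∀ z, A₁ u z → z ≠ v → ¬ L₁ v z) (hg' : ∀ z, A₁ v z → z ≠ u → ¬ L₁ u z)
    (hdb : ∀ p q b c a, ¬ PendantDiamond A₁ L₁ p q b c a)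
    (hcp : ∀ p q b c a, ¬ PendantSquare A₁ L₁ p q b c a)
    (hq2 : ∀ p q c b a, ¬ Bull A₁ L₁ p q c b a)
    (hdk : ∀ p q a b c, ¬ PolarTheta A₁ L₁ p q a b c)
    (ht3 : ∀ p q a b c, ¬ MiddleTheta A₁ L₁ p q a b c)
    (hx : ∀ p a q q' b c, ¬ PuncturedBipartite A₁ L₁ p a q q' b c) : Inv A₁ L₁ :=
  h.inv_of hnt (Or.inr ⟨hg, hg'⟩) (h.full_of_no_cherry hnt hg) (h.symm.full_of_no_cherry hnt hg')
    hdb hcp hq2 hdk ht3 hx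

/-! ### How a move creates a polar theta -/

/-- The shape of a polar theta that arises from claiming `uv`: `u` becomes a pole and `v` a middle
vertex, `q` is the other pole, and `b`, `c` are the other middle vertices. The pairs of middle
vertices that are legal are exactly two, since with three of them there was a pendant square before
the move. The two alternatives say which middle vertex is the one that may be joined to both others.
-/
def NewPolarTheta (A L₁ : V → V → Prop) (u v q b c : V) : Prop :=
  A u b ∧ A u c ∧ A v q ∧ A q b ∧ A q c ∧ b ≠ c ∧ L₁ u q ∧
    ((L₁ v b ∧ L₁ v c ∧ ¬ L₁ b c) ∨ (¬ L₁ v b ∧ L₁ v c ∧ L₁ b c))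

theorem Played.old_of_ne (h : Played A L A₁ L₁ u v) {x y : V} (hxy : A₁ x y)
    (h1 : x ≠ u ∨ y ≠ v) (h2 : x ≠ v ∨ y ≠ u) : A x y := by
  rw [h.adj] at hxy
  tauto

theorem Played.atMostTwo_of_new (h : Played A L A₁ L₁ u v) {y : V} (hl : L₁ u y) :
    AtMostTwo A u := by
  intro x y z hx hy hz
  have h1 := h.b₁.le_three _ _ hl x y z v (h.of_adj hx) (h.of_adj hy) (h.of_adj hz)
    ((h.adj u v).2 (Or.inr (Or.inl ⟨rfl, rfl⟩)))
  have h2 := h.b.notAdj _ _ h.huv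
  grind

theorem Played.new (h : Played A L A₁ L₁ u v) : A₁ u v :=
  (h.adj u v).2 (Or.inr (Or.inl ⟨rfl, rfl⟩))

/-- If the three middle vertices were pairwise joinable, then `u q b c v` would have been a pendant
square before the move; hence exactly two of the pairs are legal. -/
theorem newPolarTheta_of_edge (h : Played A L A₁ L₁ u v) {q b c : V} (h2 : A₁ u b) (h3 : A₁ u c)
    (h4 : A₁ q v) (h5 : A₁ q b) (h6 : A₁ q c) (hbc : b ≠ c) (hvb : b ≠ v) (hvc : c ≠ v)
    (huq : L₁ u q)
    (hl : (L₁ v b ∧ L₁ v c) ∨ (L₁ v b ∧ L₁ b c) ∨ (L₁ v c ∧ L₁ b c)) :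
    NewPolarTheta A L₁ u v q b c ∨ NewPolarTheta A L₁ u v q c b := by
  have hs := h.b.symm
  have n1 := h.b₁.ne _ _ h.new
  have n2 := h.b₁.ne _ _ h4
  have n3 := h.b₁.lne _ _ huq
  have n4 := h.b₁.ne _ _ h2
  have n5 := h.b₁.ne _ _ h3
  have o2 := h.old_of_ne h2 (Or.inr hvb) (Or.inl n1)
  have o3 := h.old_of_ne h3 (Or.inr hvc) (Or.inl n1)
  have o4 := hs _ _ (h.old_of_ne h4 (Or.inl n3.symm) (Or.inr n1.symm))
  have o5 := h.old_of_ne h5 (Or.inl n3.symm) (Or.inl n2)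
  have o6 := h.old_of_ne h6 (Or.inl n3.symm) (Or.inl n2)
  have hno := h.inv.pendantSquare u q b c v
  have d1 := h.atMostTwo_of_new huq
  have hl2 : AtMostTwo A v := by
    rcases hl with hl | hl | hl
    · exact h.symm.atMostTwo_of_new hl.1
    · exact h.symm.atMostTwo_of_new hl.1
    · exact h.symm.atMostTwo_of_new hl.1
  have hls := h.b₁.lsymm b c
  have := h.huv
  unfold PendantSquare at hno
  unfold NewPolarTheta
  have := h.le u q
  have := h.le b c
  have := h.le v b
  have := h.le v c
  have := hs v q
  grind

/-- The pair `xy` is the edge `uv`, in one of the two orders. -/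
def NewEdge (u v x y : V) : Prop := (x = u ∧ y = v) ∨ (x = v ∧ y = u)

theorem newPolarTheta_of_newEdge (h : Played A L A₁ L₁ u v) {p a q b c : V} (hn : NewEdge u v p a)
    (h2 : A₁ p b) (h3 : A₁ p c)
    (h4 : A₁ q a) (h5 : A₁ q b) (h6 : A₁ q c) (hbc : b ≠ c) (hvb : b ≠ a) (hvc : c ≠ a)
    (huq : L₁ p q)
    (hl : (L₁ a b ∧ L₁ a c) ∨ (L₁ a b ∧ L₁ b c) ∨ (L₁ a c ∧ L₁ b c)) :
    ∃ q b c, NewPolarTheta A L₁ u v q b c ∨ NewPolarTheta A L₁ v u q b c := by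
  rcases hn with ⟨rfl, rfl⟩ | ⟨rfl, rfl⟩
  · rcases newPolarTheta_of_edge h h2 h3 h4 h5 h6 hbc hvb hvc huq hl with h' | h'
    · exact ⟨_, _, _, Or.inl h'⟩
    · exact ⟨_, _, _, Or.inl h'⟩
  · rcases newPolarTheta_of_edge h.symm h2 h3 h4 h5 h6 hbc hvb hvc huq hl with h' | h'
    · exact ⟨_, _, _, Or.inr h'⟩
    · exact ⟨_, _, _, Or.inr h'⟩

/-- A polar theta after the move contains the new edge, and has the shape `NewPolarTheta`. -/
theorem Played.polarTheta_cases (h : Played A L A₁ L₁ u v)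
    {p q a b c : V} (hc : PolarTheta A₁ L₁ p q a b c) :
    ∃ q b c, NewPolarTheta A L₁ u v q b c ∨ NewPolarTheta A L₁ v u q b c := by
  obtain ⟨h1, h2, h3, h4, h5, h6, h7, h8, h9, h10⟩ := hc
  have hls := h.b₁.lsymm
  have nab := h.b₁.lne _ _ h9
  have nac := h.b₁.lne _ _ h10
  rcases (h.adj p a).1 h1 with o1 | o
  swap; · exact newPolarTheta_of_newEdge h o h2 h3 h4 h5 h6 h7 nab.symm nac.symm h8 (Or.inl ⟨h9,
            h10⟩)
  rcases (h.adj p b).1 h2 with o2 | o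
  swap; · exact newPolarTheta_of_newEdge h o h1 h3 h5 h4 h6 nac nab h7.symm h8 (Or.inr
            (Or.inl ⟨hls _ _ h9, h10⟩))
  rcases (h.adj p c).1 h3 with o3 | o
  swap; · exact newPolarTheta_of_newEdge h o h1 h2 h6 h4 h5 nab nac h7 h8 (Or.inr
            (Or.inl ⟨hls _ _ h10, h9⟩))
  rcases (h.adj q a).1 h4 with o4 | o
  swap; · exact newPolarTheta_of_newEdge h o h5 h6 h1 h2 h3 h7 nab.symm nac.symm (hls _ _ h8)
            (Or.inl ⟨h9, h10⟩)
  rcases (h.adj q b).1 h5 with o5 | o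
  swap; · exact newPolarTheta_of_newEdge h o h4 h6 h2 h1 h3 nac nab h7.symm (hls _ _ h8) (Or.inr
            (Or.inl ⟨hls _ _ h9, h10⟩))
  rcases (h.adj q c).1 h6 with o6 | o
  swap; · exact newPolarTheta_of_newEdge h o h4 h5 h3 h1 h2 nab nac h7 (hls _ _ h8) (Or.inr
            (Or.inl ⟨hls _ _ h10, h9⟩))
  exact absurd ⟨o1, o2, o3, o4, o5, o6, h7, h.le _ _ h8, h.le _ _ h9,
    h.le _ _ h10⟩ (h.inv.polarTheta p q a b c)

/-! ### How a move creates the other configurations -/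

theorem NewEdge.swap {x y : V} (h : NewEdge u v x y) : NewEdge u v y x := by
  unfold NewEdge at *; tauto

theorem PendantSquare.swap (hA : Board A L) {p q b c a : V} (h : PendantSquare A L p q b c a) :
    PendantSquare A L p q c b a := by
  have := hA.lsymm b c
  unfold PendantSquare at *; tauto

theorem MiddleTheta.swap {p q a b c : V} (h : MiddleTheta A L p q a b c) :
    MiddleTheta A L q p a b c := by
  unfold MiddleTheta at *
  have : q ≠ p := h.2.2.2.2.2.2.1.symm
  tauto

theorem MiddleTheta.rot (hA : Board A L) {p q a b c : V} (h : MiddleTheta A L p q a b c) :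
    MiddleTheta A L p q b c a := by
  have := hA.lsymm a b
  have := hA.lsymm a c
  unfold MiddleTheta at *; tauto

theorem PuncturedBipartite.swap {p a q q' b c : V} (h : PuncturedBipartite A L p a q q' b c) :
    PuncturedBipartite A L p a q q' c b := by
  have : c ≠ b := h.2.2.2.2.2.2.2.2.1.symm
  unfold PuncturedBipartite at *; tauto

theorem PuncturedBipartite.dual (hA : Board A L) {p a q q' b c : V}
    (h : PuncturedBipartite A L p a q q' b c) :
    PuncturedBipartite A L a p b c q q' := by
  have := hA.lsymm p a
  have := hA.symm q b
  have := hA.symm q c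
  have := hA.symm q' b
  have := hA.symm q' c
  unfold PuncturedBipartite at *; tauto

theorem Bull.swap (hA : Board A L) {p q c b a : V} (h : Bull A L p q c b a) :
    Bull A L q p c a b := by
  have := hA.lsymm a b
  have := hA.symm p q
  unfold Bull at *; tauto

theorem PendantDiamond.swap {p q b c a : V}
    (h : PendantDiamond A L p q b c a) : PendantDiamond A L p q c b a := by
  have : c ≠ b := h.2.2.2.2.2.2.1.symm
  unfold PendantDiamond at *; tauto

/-- Up to the symmetry exchanging `b` and `c`, a pendant square after the move has the new edge as
`pb`, `qa` or `qb`. -/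
theorem Played.pendantSquare_cases (h : Played A L A₁ L₁ u v) {p q b c a : V}
    (hc : PendantSquare A₁ L₁ p q b c a) :
    ∃ p q b c a, PendantSquare A₁ L₁ p q b c a ∧
      (NewEdge u v p b ∨ NewEdge u v q a ∨ NewEdge u v q b) := by
  have hc' := hc.swap h.b₁
  obtain ⟨h1, h2, h3, h4, h5, l1, l2, l3, l4, l5, d1, d2⟩ := id hc
  rcases (h.adj _ _).1 h1 with o1 | o
  swap; · exact ⟨_, _, _, _, _, hc, Or.inl o⟩
  rcases (h.adj _ _).1 h2 with o2 | o
  swap; · exact ⟨_, _, _, _, _, hc', Or.inl o⟩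
  rcases (h.adj _ _).1 h3 with o3 | o
  swap; · exact ⟨_, _, _, _, _, hc, Or.inr (Or.inl o)⟩
  rcases (h.adj _ _).1 h4 with o4 | o
  swap; · exact ⟨_, _, _, _, _, hc, Or.inr (Or.inr o)⟩
  rcases (h.adj _ _).1 h5 with o5 | o
  swap; · exact ⟨_, _, _, _, _, hc', Or.inr (Or.inr o)⟩
  exact absurd ⟨o1, o2, o3, o4, o5, h.le _ _ l1, h.le _ _ l2, h.le _ _ l3, h.le _ _ l4, h.le _ _ l5,
    h.atMostTwo d1, h.atMostTwo d2⟩ (h.inv.pendantSquare p q b c a)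

/-- Up to the reflection of the bull, the new edge is the base `pq`, the side `pc` or the horn `pb`.
-/
theorem Played.bull_cases (h : Played A L A₁ L₁ u v) {p q c b a : V} (hc : Bull A₁ L₁ p q c b a) :
    ∃ p q c b a, Bull A₁ L₁ p q c b a ∧
      (NewEdge u v p q ∨ NewEdge u v p c ∨ NewEdge u v p b) := by
  have hc' := hc.swap h.b₁
  obtain ⟨h1, h2, h3, h4, h5, l1, l2, l3, l4, l5, d1, d2⟩ := id hc
  rcases (h.adj _ _).1 h1 with o1 | o
  swap; · exact ⟨_, _, _, _, _, hc, Or.inl o⟩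
  rcases (h.adj _ _).1 h2 with o2 | o
  swap; · exact ⟨_, _, _, _, _, hc, Or.inr (Or.inl o)⟩
  rcases (h.adj _ _).1 h3 with o3 | o
  swap; · exact ⟨_, _, _, _, _, hc', Or.inr (Or.inl o)⟩
  rcases (h.adj _ _).1 h4 with o4 | o
  swap; · exact ⟨_, _, _, _, _, hc, Or.inr (Or.inr o)⟩
  rcases (h.adj _ _).1 h5 with o5 | o
  swap; · exact ⟨_, _, _, _, _, hc', Or.inr (Or.inr o)⟩
  exact absurd ⟨o1, o2, o3, o4, o5, h.le _ _ l1, h.le _ _ l2, h.le _ _ l3, h.le _ _ l4, h.le _ _ l5,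
    h.atMostTwo d1, h.atMostTwo d2⟩ (h.inv.bull p q c b a)

/-- All edges of a middle theta are equivalent, so the new one may be taken to be `pa`. -/
theorem Played.middleTheta_cases (h : Played A L A₁ L₁ u v) {p q a b c : V}
    (hc : MiddleTheta A₁ L₁ p q a b c) :
    ∃ p q a b c, MiddleTheta A₁ L₁ p q a b c ∧ NewEdge u v p a := by
  have hc' := hc.swap
  obtain ⟨h1, h2, h3, h4, h5, h6, n, l1, l2, l3, d1, d2⟩ := id hc
  rcases (h.adj _ _).1 h1 with o1 | o
  swap; · exact ⟨_, _, _, _, _, hc, o⟩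
  rcases (h.adj _ _).1 h2 with o2 | o
  swap; · exact ⟨_, _, _, _, _, hc.rot h.b₁, o⟩
  rcases (h.adj _ _).1 h3 with o3 | o
  swap; · exact ⟨_, _, _, _, _, (hc.rot h.b₁).rot h.b₁, o⟩
  rcases (h.adj _ _).1 h4 with o4 | o
  swap; · exact ⟨_, _, _, _, _, hc', o⟩
  rcases (h.adj _ _).1 h5 with o5 | o
  swap; · exact ⟨_, _, _, _, _, hc'.rot h.b₁, o⟩
  rcases (h.adj _ _).1 h6 with o6 | o
  swap; · exact ⟨_, _, _, _, _, (hc'.rot h.b₁).rot h.b₁, o⟩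
  exact absurd ⟨o1, o2, o3, o4, o5, o6, n, h.le _ _ l1, h.le _ _ l2, h.le _ _ l3,
    h.atMostThree d1, h.atMostThree d2⟩ (h.inv.middleTheta p q a b c)

/-- Up to symmetry, the new edge of a punctured bipartite graph either meets the missing edge or is
disjoint from it: it is `pb` or `qb`. -/
theorem Played.punctured_cases (h : Played A L A₁ L₁ u v) {p a q q' b c : V}
    (hc : PuncturedBipartite A₁ L₁ p a q q' b c) :
    ∃ p a q q' b c, PuncturedBipartite A₁ L₁ p a q q' b c ∧
      (NewEdge u v p b ∨ NewEdge u v q b) := by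
  have c1 := hc.swap
  have c2 := hc.dual h.b₁
  have c3 := c2.swap
  have c4 := c3.dual h.b₁
  have c5 := c4.swap
  obtain ⟨h1, h2, h3, h4, h5, h6, h7, h8, n1, n2, l1, l2, l3, l4, l5, d1, d2⟩ := id hc
  rcases (h.adj _ _).1 h1 with o1 | o
  swap; · exact ⟨_, _, _, _, _, _, hc, Or.inl o⟩
  rcases (h.adj _ _).1 h2 with o2 | o
  swap; · exact ⟨_, _, _, _, _, _, c1, Or.inl o⟩
  rcases (h.adj _ _).1 h3 with o3 | o
  swap; · exact ⟨_, _, _, _, _, _, c2, Or.inl o⟩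
  rcases (h.adj _ _).1 h4 with o4 | o
  swap; · exact ⟨_, _, _, _, _, _, c3, Or.inl o⟩
  rcases (h.adj _ _).1 h5 with o5 | o
  swap; · exact ⟨_, _, _, _, _, _, hc, Or.inr o⟩
  rcases (h.adj _ _).1 h6 with o6 | o
  swap; · exact ⟨_, _, _, _, _, _, c1, Or.inr o⟩
  rcases (h.adj _ _).1 h7 with o7 | o
  swap; · exact ⟨_, _, _, _, _, _, c4, Or.inr o⟩
  rcases (h.adj _ _).1 h8 with o8 | o
  swap; · exact ⟨_, _, _, _, _, _, c5, Or.inr o⟩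
  exact absurd ⟨o1, o2, o3, o4, o5, o6, o7, o8, n1, n2, h.le _ _ l1, h.le _ _ l2, h.le _ _ l3,
    h.le _ _ l4, h.le _ _ l5, h.atMostTwo d1, h.atMostTwo d2⟩ (h.inv.punctured p a q q' b c)

/-- Up to the symmetry exchanging `b` and `c`, the new edge of a pendant diamond is `pq`, `pb`, `qb`
or `qa`. -/
theorem Played.pendantDiamond_cases (h : Played A L A₁ L₁ u v) {p q b c a : V}
    (hc : PendantDiamond A₁ L₁ p q b c a) :
    ∃ p q b c a, PendantDiamond A₁ L₁ p q b c a ∧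
      (NewEdge u v p q ∨ NewEdge u v p b ∨ NewEdge u v q b ∨ NewEdge u v q a) := by
  have c1 := hc.swap
  obtain ⟨h1, h2, h3, h4, h5, h6, n, l1, l2, l3, d1⟩ := id hc
  rcases (h.adj _ _).1 h1 with o1 | o
  swap; · exact ⟨_, _, _, _, _, hc, Or.inl o⟩
  rcases (h.adj _ _).1 h2 with o2 | o
  swap; · exact ⟨_, _, _, _, _, hc, Or.inr (Or.inl o)⟩
  rcases (h.adj _ _).1 h3 with o3 | o
  swap; · exact ⟨_, _, _, _, _, c1, Or.inr (Or.inl o)⟩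
  rcases (h.adj _ _).1 h4 with o4 | o
  swap; · exact ⟨_, _, _, _, _, hc, Or.inr (Or.inr (Or.inl o))⟩
  rcases (h.adj _ _).1 h5 with o5 | o
  swap; · exact ⟨_, _, _, _, _, c1, Or.inr (Or.inr (Or.inl o))⟩
  rcases (h.adj _ _).1 h6 with o6 | o
  swap; · exact ⟨_, _, _, _, _, hc, Or.inr (Or.inr (Or.inr o))⟩
  exact absurd ⟨o1, o2, o3, o4, o5, o6, n, h.le _ _ l1, h.le _ _ l2, h.le _ _ l3,
    h.atMostTwo d1⟩ (h.inv.pendantDiamond p q b c a)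

/-! ### A move creates at most one polar theta -/

/-- A vertex that may still be joined to something has no neighbours besides three known ones. -/
theorem Played.exact (h : Played A L A₁ L₁ u v) {x y a b c : V} (hl : L₁ x y) (ha : A₁ x a)
    (hb : A₁ x b)
    (hc : A₁ x c) (h1 : a ≠ b) (h2 : a ≠ c) (h3 : b ≠ c) :
    ∀ w, A₁ x w → w = a ∨ w = b ∨ w = c := exact_three h.b₁ hl ha hb hc h1 h2 h3

theorem AtMostTwo.exact {x b c : V} (h : AtMostTwo A x) (hb : A x b) (hc : A x c) (hbc : b ≠ c) :
    ∀ w, A x w → w = b ∨ w = c := by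
  intro w hw
  have := h b c w hb hc hw
  tauto

/-- Two new polar thetas with the same middle vertices have the same poles: otherwise the position
before the move contained a punctured bipartite graph or a pendant square, or violated the cherry
condition. -/
theorem NewPolarTheta.unique_of_middles (h : Played A L A₁ L₁ u v) {q q' b c : V}
    (h1 : NewPolarTheta A L₁ u v q b c) (h2 : NewPolarTheta A L₁ u v q' b c) : q = q' := by
  by_contra hqq
  obtain ⟨a1, a2, a3, a4, a5, hbc, a6, a7⟩ := h1
  obtain ⟨-, -, b3, b4, b5, -, b6, b7⟩ := h2
  have hs := h.b.symm
  have hls := h.b.lsymm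
  have d1 := h.atMostTwo_of_new a6
  have d2 : AtMostTwo A v := by
    rcases a7 with hl | hl
    · exact h.symm.atMostTwo_of_new hl.1
    · exact h.symm.atMostTwo_of_new hl.2.1
  have l1 := h.le _ _ a6
  have l2 := h.le _ _ b6
  have l0 := h.huv
  have hle := h.le
  have n1 := h.b.ne
  have n2 := h.b.lne
  rcases a7 with a7 | a7
  · exact h.inv.punctured u v q q' b c ⟨a1, a2, a3, b3, a4, a5, b4, b5, hbc, hqq, l0, l1, l2,
      hle _ _ a7.1,
      hle _ _ a7.2.1, d1, d2⟩
  · have l3 := hle _ _ a7.2.1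
    have l4 := hle _ _ a7.2.2
    have e1 := exact_three h.b (hls _ _ l4) (hs _ _ a2) (hs _ _ a5) (hs _ _ b5)
      (n2 _ _ l1) (n2 _ _ l2) hqq
    have k1 := h.inv.cherry u b c a1 a2 l4
    have k2 := h.inv.pendantSquare v c q q' u
    have e2 := d1.exact a1 a2 hbc
    have e3 := exact_three h.b l4 (hs _ _ a1) (hs _ _ a4) (hs _ _ b4)
      (n2 _ _ l1) (n2 _ _ l2) hqq
    unfold Guard at k1
    unfold PendantSquare at k2
    grind

theorem NewPolarTheta.swap (h : Played A L A₁ L₁ u v) {q b c : V}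
    (h1 : NewPolarTheta A L₁ u v q b c) : NewPolarTheta A L₁ u v q c b ∨
      (¬ L₁ v b ∧ L₁ v c ∧ L₁ b c) := by
  have := h.b₁.lsymm b c
  have := h.b₁.lsymm c b
  unfold NewPolarTheta at *
  grind

/-- All new polar thetas in which `u` is a pole have the same second pole, so the reply `uq`
destroys all of them. -/
theorem NewPolarTheta.unique (h : Played A L A₁ L₁ u v) {q q' b c b' c' : V}
    (h1 : NewPolarTheta A L₁ u v q b c) (h2 : NewPolarTheta A L₁ u v q' b' c') : q = q' := by
  have d1 := h.atMostTwo_of_new h1.2.2.2.2.2.2.1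
  have e1 := d1.exact h1.1 h1.2.1 h1.2.2.2.2.2.1
  have := e1 b' h2.1
  have := e1 c' h2.2.1
  have := h2.2.2.2.2.2.1
  have k1 := h1.2.2.2.2.2.2.2
  have k2 := h2.2.2.2.2.2.2.2
  have hls := h.b₁.lsymm
  have k3 := h1.swap h
  have k4 := h2.swap h
  have k5 := NewPolarTheta.unique_of_middles h (q := q) (q' := q') (b := b) (c := c)
  have k6 := NewPolarTheta.unique_of_middles h (q := q) (q' := q') (b := c) (c := b)
  grind

/-- After the reply `uq` there is no new polar theta with `v` as a pole. -/
theorem NewPolarTheta.not_opposite (h : Played A L A₁ L₁ u v) {q b c q' b' c' : V}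
    (h1 : NewPolarTheta A L₁ u v q b c) (h2 : NewPolarTheta A
      (Without L₁ u q) v u q' b' c') : False := by
  obtain ⟨a1, a2, a3, a4, a5, hbc, a6, a7⟩ := h1
  obtain ⟨b1, b2, b3, b4, b5, hbc', b6, b7⟩ := h2
  have hs := h.b.symm
  have d1 := h.atMostTwo_of_new a6
  have d2 := h.symm.atMostTwo_of_new b6.1
  have e1 := d1.exact a1 a2 hbc
  have e2 := d2.exact b1 b2 hbc'
  have hls := h.b₁.lsymm
  have k1 := h.inv.pendantSquare v q' b' c' u
  unfold PendantSquare at k1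
  unfold Without at *
  have hle := h.le
  have l0 := h.huv
  have l0' := h.b.lsymm _ _ h.huv
  grind

/-! ### Answering a polar theta -/

theorem NewPolarTheta.no_middleTheta (h : Played A L A₁ L₁ u v) {q b c : V}
    (h1 : NewPolarTheta A L₁ u v q b c) {p' q' x y z : V} (h2 : MiddleTheta A₁
      (Without L₁ u q) p' q' x y z) :
    False := by
  obtain ⟨p', q', x, y, z, h2, he⟩ := (h.mono_legal u q).middleTheta_cases h2
  obtain ⟨a1, a2, a3, a4, a5, hbc, a6, a7⟩ := h1
  obtain ⟨b1, b2, b3, b4, b5, b6, hn, l1, l2, l3, d1, d2⟩ := h2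
  have hls := h.b₁.lsymm
  have a1 := h.of_adj a1
  have a2 := h.of_adj a2
  have a3 := h.of_adj a3
  have huv := h.new
  have := h.b.notAdj u v h.huv
  have := h.b.notAdj v u (h.b.lsymm _ _ h.huv)
  have := h.b₁.lne
  unfold Without at *
  rcases he with ⟨rfl, rfl⟩ | ⟨rfl, rfl⟩
  · have := d1 b c x y
    have := d1 b c x z
    grind
  · have d3 := d1 x y z q b1 b2 b3 a3
    grind

/-- The vertices `u` and `q` have degree three, with the middle vertices as neighbours. -/
theorem NewPolarTheta.exact (h : Played A L A₁ L₁ u v) {q b c : V}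
    (h1 : NewPolarTheta A L₁ u v q b c) :
    b ≠ v ∧ c ≠ v ∧ (∀ w, A₁ u w → w = v ∨ w = b ∨ w = c) ∧ ∀ w,
      A₁ q w → w = v ∨ w = b ∨ w = c := by
  obtain ⟨a1, a2, a3, a4, a5, hbc, a6, a7⟩ := h1
  have hls := h.b₁.lsymm
  have hs := h.b₁.symm
  have huv := h.new
  have nu := h.b.notAdj _ _ h.huv
  have nub : b ≠ v := by rintro rfl; contradiction
  have nuc : c ≠ v := by rintro rfl; contradiction
  exact ⟨nub, nuc, exact_three h.b₁ a6 huv (h.of_adj a1) (h.of_adj a2) nub.symm nuc.symm hbc,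
    exact_three h.b₁ (hls _ _ a6) (hs _ _ (h.of_adj a3)) (h.of_adj a4)
      (h.of_adj a5) nub.symm nuc.symm hbc⟩

theorem NewPolarTheta.no_punctured (h : Played A L A₁ L₁ u v) {q b c : V}
    (h1 : NewPolarTheta A L₁ u v q b c) {P a Q Q' B C : V} (h2 : PuncturedBipartite A₁
      (Without L₁ u q) P a Q Q' B C) :
    False := by
  obtain ⟨P, a, Q, Q', B, C, h2, he⟩ := (h.mono_legal u q).punctured_cases h2
  obtain ⟨nb, nc, e1, e2⟩ := h1.exact h
  obtain ⟨a1, a2, a3, a4, a5, hbc, a6, a7⟩ := h1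
  obtain ⟨b1, b2, b3, b4, b5, b6, b7, b8, n1, n2, l1, l2, l3, l4, l5, d1, d2⟩ := h2
  have hls := h.b₁.lsymm
  have hs := h.b₁.symm
  have huv := h.new
  have nuv := h.b₁.ne _ _ huv
  have hna := h.b₁.notAdj
  have hne := h.b₁.lne
  have f1 := d1.exact b1 b2 n1
  have f2 := d2.exact b3 b4 n2
  have f3 := h.exact (hls _ _ l2.1) (hs _ _ b3) b5 b6 (hne _ _ l4.1) (hne _ _ l5.1) n1
  have f4 := h.exact (hls _ _ l4.1) (hs _ _ b1) (hs _ _ b5) (hs _ _ b7) (hne _ _ l2.1)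
    (hne _ _ l3.1) n2
  have f5 := d1 v b c
  have f6 := d2 v b c
  unfold Without at *
  have k1 := h.inv.middleTheta b c u q a
  have k2 := h.inv.pendantSquare a C Q Q' P
  have k3 := h.inv.pendantSquare P Q' B C a
  unfold MiddleTheta at k1
  unfold PendantSquare at k2 k3
  have d1' := (h.mono_legal u q).atMostTwo d1
  have d2' := (h.mono_legal u q).atMostTwo d2
  have d4 := h.atMostTwo_of_new a6
  have d3 := h.b.le_three
  have hle := h.le
  have l0 := h.huv
  have l0' := h.b.lsymm _ _ h.huv
  have o := h.adj
  have a1' := h.of_adj a1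
  have a2' := h.of_adj a2
  have a3' := h.of_adj a3
  have a4' := h.of_adj a4
  have a5' := h.of_adj a5
  have hs0 := h.b.symm
  have hne0 := h.b.ne
  have hls0 := h.b.lsymm
  have hna0 := h.b.notAdj
  rcases he with (⟨rfl, rfl⟩ | ⟨rfl, rfl⟩) | (⟨rfl, rfl⟩ | ⟨rfl, rfl⟩)
  · grind
  · clear k2 k3
    have : C = q := by grind
    grind
  · clear k1 k3
    have : Q' = q := by grind
    grind
  · clear k1 k2
    have : C = q := by grind
    grind

theorem NewPolarTheta.no_pendantSquare (h : Played A L A₁ L₁ u v) {q b c : V}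
    (h1 : NewPolarTheta A L₁ u v q b c) {P Q B C a : V} (h2 : PendantSquare A₁
      (Without L₁ u q) P Q B C a) :
    False := by
  obtain ⟨P, Q, B, C, a, h2, he⟩ := (h.mono_legal u q).pendantSquare_cases h2
  obtain ⟨nb, nc, e1, e2⟩ := h1.exact h
  obtain ⟨a1, a2, a3, a4, a5, hbc, a6, a7⟩ := h1
  obtain ⟨b1, b2, b3, b4, b5, l1, l2, l3, l4, l5, d1, d2⟩ := h2
  have hls := h.b₁.lsymm
  have hs := h.b₁.symm
  have huv := h.new
  have nuv := h.b₁.ne _ _ huv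
  have a1 := h.of_adj a1
  have a2 := h.of_adj a2
  have a3 := h.of_adj a3
  have a4 := h.of_adj a4
  have a5 := h.of_adj a5
  have hna := h.b₁.notAdj
  have hne := h.b₁.lne
  unfold Without at *
  unfold NewEdge at he
  have f1 := d1.exact b1 b2 (hne _ _ l2.1)
  have f3 := h.exact (hls _ _ l1.1) b3 b4 b5 (hne _ _ l4.1) (hne _ _ l5.1) (hne _ _ l2.1)
  have f5 := d1 v b c
  have f6 := d2 v b c
  rcases he with (⟨rfl, rfl⟩ | ⟨rfl, rfl⟩) | (⟨rfl, rfl⟩ | ⟨rfl, rfl⟩) | (⟨rfl, rfl⟩ | ⟨rfl, rfl⟩)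
  all_goals grind

theorem NewPolarTheta.no_bull (h : Played A L A₁ L₁ u v)
    (hnt : ∀ p q b c, ¬ Threat A₁ L₁ p q b c) {q b c : V}
    (h1 : NewPolarTheta A L₁ u v q b c) {P Q B C a : V} (h2 : Bull A₁ (Without L₁ u q) P Q C B a) :
    False := by
  obtain ⟨P, Q, C, B, a, h2, he⟩ := (h.mono_legal u q).bull_cases h2
  obtain ⟨nb, nc, e1, e2⟩ := h1.exact h
  obtain ⟨a1, a2, a3, a4, a5, hbc, a6, a7⟩ := h1
  obtain ⟨b1, b2, b3, b4, b5, l1, l2, l3, l4, l5, d1, d2⟩ := h2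
  have hls := h.b₁.lsymm
  have hs := h.b₁.symm
  have huv := h.new
  have nuv := h.b₁.ne _ _ huv
  have a1 := h.of_adj a1
  have a2 := h.of_adj a2
  have a3 := h.of_adj a3
  have a4 := h.of_adj a4
  have a5 := h.of_adj a5
  have hna := h.b₁.notAdj
  have hne := h.b₁.lne
  have k1 := hnt v b u q
  have k2 := hnt v c u q
  have k3 := hnt b c u q
  unfold Threat at k1 k2 k3
  unfold Without at *
  unfold NewEdge at he
  have f5 := d1 v b c
  have f6 := d2 v b c
  rcases he with (⟨rfl, rfl⟩ | ⟨rfl, rfl⟩) | (⟨rfl, rfl⟩ | ⟨rfl, rfl⟩) | (⟨rfl, rfl⟩ | ⟨rfl, rfl⟩)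
  all_goals grind

theorem without_comm (x y : V) : Without L x y = Without L y x := by
  funext a b
  unfold Without
  apply propext
  tauto

/-- Joining the poles is a good reply to a polar theta. -/
theorem NewPolarTheta.inv (h : Played A L A₁ L₁ u v) (hnt : ∀ p q b c, ¬ Threat A₁ L₁ p q b c)
    (hdb : ∀ p q b c a, ¬ PendantDiamond A₁ L₁ p q b c a) {q b c : V}
      (h1 : NewPolarTheta A L₁ u v q b c) :
    Inv A₁ (Without L₁ u q) := by
  refine h.symm.inv_of_cherry hnt (h.of_adj h1.2.2.1) h1.2.2.2.2.2.2.1 ?_ ?_ ?_ ?_ ?_ ?_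
  · rintro P Q B C a ⟨h1, h2, h3, h4, h5, h6, n, l1, l2, l3, d⟩
    exact hdb P Q B C a ⟨h1, h2, h3, h4, h5, h6, n, l1.1, l2.1, l3.1, d⟩
  · exact fun P Q B C a hc => h1.no_pendantSquare h hc
  · exact fun P Q B C a hc => h1.no_bull h hnt hc
  · intro P Q B C a hc
    obtain ⟨q', b', c', hc | hc⟩ := (h.mono_legal u q).polarTheta_cases hc
    · have h2 : NewPolarTheta A L₁ u v q' b' c' := by
        obtain ⟨a1, a2, a3, a4, a5, hbc, a6, a7⟩ := hc
        have := h.b.ne _ _ a1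
        have := h.b.ne _ _ a2
        have := h.b.lne _ _ h.huv
        unfold Without at a6 a7
        exact ⟨a1, a2, a3, a4, a5, hbc, a6.1, by grind⟩
      have hqq := h1.unique h h2
      subst hqq
      exact hc.2.2.2.2.2.2.1.2 (Or.inl ⟨rfl, rfl⟩)
    · exact NewPolarTheta.not_opposite h h1 hc
  · exact fun P Q B C a hc => h1.no_middleTheta h hc
  · exact fun P a Q Q' B C hc => h1.no_punctured h hc

/-! ### Answering a punctured bipartite graph -/

/-- All six vertices of a punctured bipartite graph have no neighbours outside it, by the bounds on
the degrees. -/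
theorem PuncturedBipartite.exact (h : Played A L A₁ L₁ u v) {p a q q' b c : V}
    (hx : PuncturedBipartite A₁ L₁ p a q q' b c) :
    (∀ w, A₁ p w → w = b ∨ w = c) ∧ (∀ w, A₁ a w → w = q ∨ w = q') ∧
    (∀ w, A₁ q w → w = a ∨ w = b ∨ w = c) ∧ (∀ w, A₁ q' w → w = a ∨ w = b ∨ w = c) ∧
    (∀ w, A₁ b w → w = p ∨ w = q ∨ w = q') ∧ (∀ w, A₁ c w → w = p ∨ w = q ∨ w = q') := by
  obtain ⟨b1, b2, b3, b4, b5, b6, b7, b8, n1, n2, l1, l2, l3, l4, l5, d1, d2⟩ := hx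
  have hls := h.b₁.lsymm
  have hs := h.b₁.symm
  have hne := h.b₁.lne
  exact ⟨d1.exact b1 b2 n1, d2.exact b3 b4 n2,
    h.exact (hls _ _ l2) (hs _ _ b3) b5 b6 (hne _ _ l4) (hne _ _ l5) n1,
    h.exact (hls _ _ l3) (hs _ _ b4) b7 b8 (hne _ _ l4) (hne _ _ l5) n1,
    h.exact (hls _ _ l4) (hs _ _ b1) (hs _ _ b5) (hs _ _ b7) (hne _ _ l2) (hne _ _ l3) n2,
    h.exact (hls _ _ l5) (hs _ _ b2) (hs _ _ b6) (hs _ _ b8) (hne _ _ l2) (hne _ _ l3) n2⟩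

/-- If the move completes a punctured bipartite graph, then neither `bc` nor `qq'` is legal, since
the position before the move contained no middle theta and no pendant square. -/
theorem PuncturedBipartite.illegal (h : Played A L A₁ L₁ u v) {p a q q' b c : V}
    (hx : PuncturedBipartite A₁ L₁ p a q q' b c) (he : NewEdge u v p b ∨ NewEdge u v q b) :
    ¬ L₁ b c ∧ ¬ L₁ q q' := by
  obtain ⟨e1, e2, e3, e4, e5, e6⟩ := hx.exact h
  obtain ⟨b1, b2, b3, b4, b5, b6, b7, b8, n1, n2, l1, l2, l3, l4, l5, d1, d2⟩ := hx
  have hs := h.b.symm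
  have hs1 := h.b₁.symm
  have hls := h.b.lsymm
  have hle := h.le
  have hd := h.b.le_three
  have o := fun x y hxy => h.old_of_ne (x := x) (y := y) hxy
  have d1' := h.atMostTwo d1
  have d2' := h.atMostTwo d2
  have hn := h.b₁.ne
  have hn' := h.b₁.lne
  have o2 := o _ _ b2 (by grind [NewEdge]) (by grind [NewEdge])
  have o3 := o _ _ b3 (by grind [NewEdge]) (by grind [NewEdge])
  have o4 := o _ _ b4 (by grind [NewEdge]) (by grind [NewEdge])
  have o6 := o _ _ b6 (by grind [NewEdge]) (by grind [NewEdge])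
  have o7 := o _ _ b7 (by grind [NewEdge]) (by grind [NewEdge])
  have o8 := o _ _ b8 (by grind [NewEdge]) (by grind [NewEdge])
  refine ⟨fun l => ?_, fun l => ?_⟩
  · rcases he with he | he
    · exact h.inv.middleTheta q q' a b c ⟨hs _ _ o3,
        o _ _ b5 (by grind [NewEdge]) (by grind [NewEdge]),
        o6, hs _ _ o4, o7, o8, n2, hle _ _ l4, hle _ _ l5, hle _ _ l, hd _ _ (hls _ _ (hle _ _ l2)),
        hd _ _ (hls _ _ (hle _ _ l3))⟩
    · exact h.inv.pendantSquare p q' b c a ⟨o _ _ b1 (by grind [NewEdge]) (by grind [NewEdge]), o2,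
        hs _ _ o4,
        o7, o8, hle _ _ l3, hle _ _ l, hle _ _ l1, hle _ _ l4, hle _ _ l5, d1', d2'⟩
  · exact h.inv.pendantSquare a c q q' p ⟨o3, o4, hs _ _ o2, hs _ _ o6, hs _ _ o8, hle _ _ l5,
      hle _ _ l,
      hls _ _ (hle _ _ l1), hle _ _ l2, hle _ _ l3, d2', d1'⟩

theorem PuncturedBipartite.no_punctured (h : Played A L A₁ L₁ u v) {p a q q' b c : V}
    (hx : PuncturedBipartite A₁ L₁ p a q q' b c) (he : NewEdge u v p b ∨ NewEdge u v q b)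
    {P α Q Q' B C : V} (h2 : PuncturedBipartite A₁ (Without L₁ p q) P α Q Q' B C) : False := by
  obtain ⟨P, α, Q, Q', B, C, h2, he'⟩ := (h.mono_legal p q).punctured_cases h2
  obtain ⟨i1, i2⟩ := hx.illegal h he
  obtain ⟨e1, e2, e3, e4, e5, e6⟩ := hx.exact h
  obtain ⟨a1, a2, a3, a4, a5, a6, a7, a8, m1, m2, m3, m4, m5, m6, m7, c1, c2⟩ := h2
  have hs1 := h.b₁.symm
  have hls := h.b₁.lsymm
  have hn' := h.b₁.lne
  obtain ⟨b1, b2, b3, b4, b5, b6, b7, b8, n1, n2, l1, l2, l3, l4, l5, d1, d2⟩ := hx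
  unfold Without at *
  unfold NewEdge at *
  rcases he with (⟨rfl, rfl⟩ | ⟨rfl, rfl⟩) | (⟨rfl, rfl⟩ | ⟨rfl, rfl⟩) <;>
  rcases he' with (⟨rfl, rfl⟩ | ⟨rfl, rfl⟩) | (⟨rfl, rfl⟩ | ⟨rfl, rfl⟩)
  all_goals grind

theorem PuncturedBipartite.no_middleTheta (h : Played A L A₁ L₁ u v) {p a q q' b c : V}
    (hx : PuncturedBipartite A₁ L₁ p a q q' b c) (he : NewEdge u v p b ∨ NewEdge u v q b)
    {P Q x y z : V} (h2 : MiddleTheta A₁ (Without L₁ p q) P Q x y z) : False := by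
  obtain ⟨P, Q, x, y, z, h2, he'⟩ := (h.mono_legal p q).middleTheta_cases h2
  obtain ⟨i1, i2⟩ := hx.illegal h he
  obtain ⟨e1, e2, e3, e4, e5, e6⟩ := hx.exact h
  obtain ⟨a1, a2, a3, a4, a5, a6, m1, m2, m3, m4, c1, c2⟩ := h2
  have hs1 := h.b₁.symm
  have hls := h.b₁.lsymm
  have hn' := h.b₁.lne
  obtain ⟨b1, b2, b3, b4, b5, b6, b7, b8, n1, n2, l1, l2, l3, l4, l5, d1, d2⟩ := hx
  unfold Without at *
  unfold NewEdge at *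
  rcases he with (⟨rfl, rfl⟩ | ⟨rfl, rfl⟩) | (⟨rfl, rfl⟩ | ⟨rfl, rfl⟩) <;>
  rcases he' with ⟨rfl, rfl⟩ | ⟨rfl, rfl⟩
  all_goals grind

theorem PuncturedBipartite.no_pendantSquare (h : Played A L A₁ L₁ u v) {p a q q' b c : V}
    (hx : PuncturedBipartite A₁ L₁ p a q q' b c) (he : NewEdge u v p b ∨ NewEdge u v q b)
    {P Q B C α : V} (h2 : PendantSquare A₁ (Without L₁ p q) P Q B C α) : False := by
  obtain ⟨P, Q, B, C, α, h2, he'⟩ := (h.mono_legal p q).pendantSquare_cases h2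
  obtain ⟨i1, i2⟩ := hx.illegal h he
  obtain ⟨e1, e2, e3, e4, e5, e6⟩ := hx.exact h
  obtain ⟨a1, a2, a3, a4, a5, m1, m2, m3, m4, m5, c1, c2⟩ := h2
  have hs1 := h.b₁.symm
  have hls := h.b₁.lsymm
  have hn' := h.b₁.lne
  obtain ⟨b1, b2, b3, b4, b5, b6, b7, b8, n1, n2, l1, l2, l3, l4, l5, d1, d2⟩ := hx
  unfold Without at *
  unfold NewEdge at *
  rcases he with (⟨rfl, rfl⟩ | ⟨rfl, rfl⟩) | (⟨rfl, rfl⟩ | ⟨rfl, rfl⟩) <;>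
  rcases he' with (⟨rfl, rfl⟩ | ⟨rfl, rfl⟩) | (⟨rfl, rfl⟩ | ⟨rfl, rfl⟩) | (⟨rfl, rfl⟩ | ⟨rfl, rfl⟩)
  all_goals grind

theorem PuncturedBipartite.no_bull (h : Played A L A₁ L₁ u v) {p a q q' b c : V}
    (hx : PuncturedBipartite A₁ L₁ p a q q' b c) (he : NewEdge u v p b ∨ NewEdge u v q b)
    {P Q B C α : V} (h2 : Bull A₁ (Without L₁ p q) P Q C B α) : False := by
  obtain ⟨P, Q, C, B, α, h2, he'⟩ := (h.mono_legal p q).bull_cases h2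
  obtain ⟨i1, i2⟩ := hx.illegal h he
  obtain ⟨e1, e2, e3, e4, e5, e6⟩ := hx.exact h
  obtain ⟨a1, a2, a3, a4, a5, m1, m2, m3, m4, m5, c1, c2⟩ := h2
  have hs1 := h.b₁.symm
  have hls := h.b₁.lsymm
  have hn' := h.b₁.lne
  have hn := h.b₁.ne
  have hna := h.b₁.notAdj
  obtain ⟨b1, b2, b3, b4, b5, b6, b7, b8, n1, n2, l1, l2, l3, l4, l5, d1, d2⟩ := hx
  unfold Without at *
  unfold NewEdge at *
  rcases he with (⟨rfl, rfl⟩ | ⟨rfl, rfl⟩) | (⟨rfl, rfl⟩ | ⟨rfl, rfl⟩) <;>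
  rcases he' with (⟨rfl, rfl⟩ | ⟨rfl, rfl⟩) | (⟨rfl, rfl⟩ | ⟨rfl, rfl⟩) | (⟨rfl, rfl⟩ | ⟨rfl, rfl⟩)
  all_goals grind

theorem PendantDiamond.mono (hle : ∀ x y, L' x y → L x y) {p q b c a : V}
    (h : PendantDiamond A L' p q b c a) :
    PendantDiamond A L p q b c a := by
  obtain ⟨h1, h2, h3, h4, h5, h6, n, l1, l2, l3, d⟩ := h
  exact ⟨h1, h2, h3, h4, h5, h6, n, hle _ _ l1, hle _ _ l2, hle _ _ l3, d⟩

theorem PolarTheta.mono (hle : ∀ x y, L' x y → L x y) {p q b c a : V}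
    (h : PolarTheta A L' p q b c a) :
    PolarTheta A L p q b c a := by
  obtain ⟨h1, h2, h3, h4, h5, h6, n, l1, l2, l3⟩ := h
  exact ⟨h1, h2, h3, h4, h5, h6, n, hle _ _ l1, hle _ _ l2, hle _ _ l3⟩

theorem MiddleTheta.mono (hle : ∀ x y, L' x y → L x y) {p q b c a : V}
    (h : MiddleTheta A L' p q b c a) :
    MiddleTheta A L p q b c a := by
  obtain ⟨h1, h2, h3, h4, h5, h6, n, l1, l2, l3, d⟩ := h
  exact ⟨h1, h2, h3, h4, h5, h6, n, hle _ _ l1, hle _ _ l2, hle _ _ l3, d⟩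

theorem PendantSquare.mono (hle : ∀ x y, L' x y → L x y) {p q b c a : V}
    (h : PendantSquare A L' p q b c a) :
    PendantSquare A L p q b c a := by
  obtain ⟨h1, h2, h3, h4, h5, l1, l2, l3, l4, l5, d⟩ := h
  exact ⟨h1, h2, h3, h4, h5, hle _ _ l1, hle _ _ l2, hle _ _ l3, hle _ _ l4, hle _ _ l5, d⟩

theorem Bull.mono (hle : ∀ x y, L' x y → L x y) {p q b c a : V} (h : Bull A L' p q b c a) :
    Bull A L p q b c a := by
  obtain ⟨h1, h2, h3, h4, h5, l1, l2, l3, l4, l5, d⟩ := h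
  exact ⟨h1, h2, h3, h4, h5, hle _ _ l1, hle _ _ l2, hle _ _ l3, hle _ _ l4, hle _ _ l5, d⟩

theorem PuncturedBipartite.mono (hle : ∀ x y, L' x y → L x y) {p q b c a d : V}
    (h : PuncturedBipartite A L' p q b c a d) :
    PuncturedBipartite A L p q b c a d := by
  obtain ⟨h1, h2, h3, h4, h5, h6, h7, h8, n, n', l1, l2, l3, l4, l5, d⟩ := h
  exact ⟨h1, h2, h3, h4, h5, h6, h7, h8, n, n', hle _ _ l1, hle _ _ l2, hle _ _ l3, hle _ _ l4,
    hle _ _ l5, d⟩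

/-- The reply `pq` is good when a move has completed a punctured bipartite graph. -/
theorem PuncturedBipartite.inv (h : Played A L A₁ L₁ u v) (hnt : ∀ p q b c, ¬ Threat A₁ L₁ p q b c)
    (hdb : ∀ p q b c a, ¬ PendantDiamond A₁ L₁ p q b c a) (hdk : ∀ p q a b c,
      ¬ PolarTheta A₁ L₁ p q a b c)
    {p a q q' b c : V} (hx : PuncturedBipartite A₁ L₁ p a q q' b c)
      (he : NewEdge u v p b ∨ NewEdge u v q b) :
    Inv A₁ (Without L₁ p q) := by
  have key : ∀ {u v x y : V}, Played A L A₁ L₁ u v → A₁ u y → L₁ v y →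
      Without L₁ v y = Without L₁ p q → Inv A₁ (Without L₁ p q) := by
    intro u' v' x y h' h1 h2 h3
    rw [← h3]
    refine h'.inv_of_cherry hnt h1 h2 ?_ ?_ ?_ ?_ ?_ ?_
    all_goals rw [h3]
    · exact fun _ _ _ _ _ hc => hdb _ _ _ _ _ (hc.mono Without.le)
    · exact fun _ _ _ _ _ hc => hx.no_pendantSquare h he hc
    · exact fun _ _ _ _ _ hc => hx.no_bull h he hc
    · exact fun _ _ _ _ _ hc => hdk _ _ _ _ _ (hc.mono Without.le)
    · exact fun _ _ _ _ _ hc => hx.no_middleTheta h he hc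
    · exact fun _ _ _ _ _ _ hc => hx.no_punctured h he hc
  obtain ⟨b1, b2, b3, b4, b5, b6, b7, b8, n1, n2, l1, l2, -⟩ := id hx
  have hs := h.b₁.symm
  have hls := h.b₁.lsymm
  rcases he with (⟨rfl, rfl⟩ | ⟨rfl, rfl⟩) | (⟨rfl, rfl⟩ | ⟨rfl, rfl⟩)
  · exact key (x := p) h.symm (hs _ _ b5) l2 rfl
  · exact key (x := p) h (hs _ _ b5) l2 rfl
  · exact key (x := p) h.symm (hs _ _ b1) (hls _ _ l2) (without_comm _ _)
  · exact key (x := p) h (hs _ _ b1) (hls _ _ l2) (without_comm _ _)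

/-! ### Answering a middle theta -/

/-- When the edge `pa` completes a middle theta, the reply `ab` is good. The poles are not joinable,
as otherwise there was a pendant square before the move. -/
theorem MiddleTheta.inv (h : Played A L A₁ L₁ u v) (hnt : ∀ p q b c, ¬ Threat A₁ L₁ p q b c)
    (hdb : ∀ p q b c a, ¬ PendantDiamond A₁ L₁ p q b c a) (hdk : ∀ p q a b c,
      ¬ PolarTheta A₁ L₁ p q a b c)
    (hxx : ∀ p a q q' b c, ¬ PuncturedBipartite A₁ L₁ p a q q' b c)
    {q b c : V} (ht : MiddleTheta A₁ L₁ u q v b c) : Inv A₁ (Without L₁ v b) := by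
  obtain ⟨b1, b2, b3, b4, b5, b6, n, l1, l2, l3, d1, d2⟩ := ht
  have hs := h.b₁.symm
  have hls := h.b₁.lsymm
  have hn := h.b₁.ne
  have hn' := h.b₁.lne
  have hna := h.b₁.notAdj
  have d3 := h.b₁.le_three _ _ l1
  -- if the poles were joinable, there was a pendant square on the four old edges at `b` and `c`
  have huq : ¬ L₁ u q := by
    intro l
    have o2 := h.old_of_ne b2 (by grind) (by grind)
    have o3 := h.old_of_ne b3 (by grind) (by grind)
    have o4 := h.old_of_ne b4 (by grind) (by grind)
    have o5 := h.old_of_ne b5 (by grind) (by grind)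
    have o6 := h.old_of_ne b6 (by grind) (by grind)
    exact h.inv.pendantSquare u q b c v ⟨o2, o3, o4, o5, o6, h.le _ _ l, h.le _ _ l3, h.huv,
      h.le _ _ l1,
      h.le _ _ l2, h.atMostTwo_of_new l, h.symm.atMostTwo_of_new l1⟩
  have huq' : ¬ L₁ q u := fun l => huq (hls _ _ l)
  have e1 : ∀ w, A₁ u w → w = v ∨ w = b ∨ w = c := by
    intro w hw
    have := d1 v b c w b1 b2 b3 hw
    grind
  have e2 : ∀ x y, A₁ v x → A₁ v y → x ≠ y → x ≠ u → y ≠ u → x = q ∨ y = q := by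
    intro x y hx hy
    have := d3 u q x y
    grind
  refine h.inv_of_cherry hnt b2 l1 ?_ ?_ ?_ ?_ ?_ ?_
  · exact fun _ _ _ _ _ hc => hdb _ _ _ _ _ (hc.mono Without.le)
  · intro P Q B C α h2
    obtain ⟨P, Q, B, C, α, h2, he'⟩ := (h.mono_legal v b).pendantSquare_cases h2
    obtain ⟨a1, a2, a3, a4, a5, m1, m2, m3, m4, m5, c1, c2⟩ := h2
    have f1 := c1 v b c
    have f2 := c2 v b c
    have f3 := c1 u q C
    unfold Without at *
    unfold NewEdge at *
    rcases he' with (⟨rfl, rfl⟩ | ⟨rfl, rfl⟩) | (⟨rfl, rfl⟩ | ⟨rfl, rfl⟩) | (⟨rfl, rfl⟩ | ⟨rfl,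
      rfl⟩)
    all_goals grind
  · intro P Q C B α h2
    obtain ⟨P, Q, C, B, α, h2, he'⟩ := (h.mono_legal v b).bull_cases h2
    obtain ⟨a1, a2, a3, a4, a5, m1, m2, m3, m4, m5, c1, c2⟩ := h2
    have f1 := c2 v b c
    unfold Without at *
    unfold NewEdge at *
    rcases he' with (⟨rfl, rfl⟩ | ⟨rfl, rfl⟩) | (⟨rfl, rfl⟩ | ⟨rfl, rfl⟩) | (⟨rfl, rfl⟩ | ⟨rfl,
      rfl⟩)
    all_goals grind
  · exact fun _ _ _ _ _ hc => hdk _ _ _ _ _ (hc.mono Without.le)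
  · intro P Q x y z h2
    obtain ⟨P, Q, x, y, z, h2, he'⟩ := (h.mono_legal v b).middleTheta_cases h2
    obtain ⟨a1, a2, a3, a4, a5, a6, m1, m2, m3, m4, c1, c2⟩ := h2
    unfold Without at *
    unfold NewEdge at *
    rcases he' with ⟨rfl, rfl⟩ | ⟨rfl, rfl⟩
    all_goals grind
  · exact fun _ _ _ _ _ _ hc => hxx _ _ _ _ _ _ (hc.mono Without.le)

/-! ### Answering a pendant square -/

theorem PendantSquare.no_bull (h : Played A L A₁ L₁ u v) {p q b c a : V}
    (hc : PendantSquare A₁ L₁ p q b c a) (he : NewEdge u v p b ∨ NewEdge u v q a ∨ NewEdge u v q b)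
    {P Q C B α : V} (h2 : Bull A₁ L₁ P Q C B α) : False := by
  obtain ⟨P, Q, C, B, α, h2, he'⟩ := h.bull_cases h2
  obtain ⟨a1, a2, a3, a4, a5, m1, m2, m3, m4, m5, c1, c2⟩ := h2
  obtain ⟨b1, b2, b3, b4, b5, l1, l2, l3, l4, l5, d1, d2⟩ := hc
  have hs1 := h.b₁.symm
  have hls := h.b₁.lsymm
  have hn' := h.b₁.lne
  have hn := h.b₁.ne
  have hna := h.b₁.notAdj
  have f1 := d1.exact b1 b2 (hn' _ _ l2)
  have f3 := h.exact (hls _ _ l1) b3 b4 b5 (hn' _ _ l4) (hn' _ _ l5) (hn' _ _ l2)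
  have f4 := c2 a b c
  have f5 := d2 q Q C
  have f6 := h.exact m2 a1 a2 a4 (hn _ _ a3) (hn' _ _ m1) (hn' _ _ m5).symm
  unfold NewEdge at *
  rcases he with (⟨rfl, rfl⟩ | ⟨rfl, rfl⟩) | (⟨rfl, rfl⟩ | ⟨rfl, rfl⟩) | (⟨rfl, rfl⟩ | ⟨rfl,
    rfl⟩) <;>
  rcases he' with (⟨rfl, rfl⟩ | ⟨rfl, rfl⟩) | (⟨rfl, rfl⟩ | ⟨rfl, rfl⟩) | (⟨rfl, rfl⟩ | ⟨rfl, rfl⟩)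
  all_goals grind

/-- If the new edge is the pendant edge `qa` and some pendant square survives the reply `ab`, then
`a` has a neighbour `s` besides `q`, which is adjacent to `c` and may be joined to `p` and `q`. -/
theorem PendantSquare.survivor_pendant (h : Played A L A₁ L₁ u v) {p b c : V}
    (hc : PendantSquare A₁ L₁ p u b c v) {P Q B C α : V} (h2 : PendantSquare A₁
      (Without L₁ v b) P Q B C α) :
    ∃ s, A₁ v s ∧ A₁ c s ∧ L₁ u s ∧ L₁ p s := by
  obtain ⟨P, Q, B, C, α, h2, he'⟩ := (h.mono_legal v b).pendantSquare_cases h2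
  obtain ⟨a1, a2, a3, a4, a5, m1, m2, m3, m4, m5, c1, c2⟩ := h2
  obtain ⟨b1, b2, b3, b4, b5, l1, l2, l3, l4, l5, d1, d2⟩ := hc
  have hs1 := h.b₁.symm
  have hls := h.b₁.lsymm
  have hn' := h.b₁.lne
  have hn := h.b₁.ne
  have hna := h.b₁.notAdj
  have f1 := d1.exact b1 b2 (hn' _ _ l2)
  have f3 := h.exact (hls _ _ l1) b3 b4 b5 (hn' _ _ l4) (hn' _ _ l5) (hn' _ _ l2)
  have f4 := c2 v b c
  have f5 := c1 v b c
  have f6 := d2 B C α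
  have f7 := h.b₁.le_three c _ (hls _ _ l5) u p C α
  unfold NewEdge at *
  unfold Without at *
  rcases he' with (⟨rfl, rfl⟩ | ⟨rfl, rfl⟩) | (⟨rfl, rfl⟩ | ⟨rfl, rfl⟩) | (⟨rfl, rfl⟩ | ⟨rfl, rfl⟩)
  · grind
  · refine ⟨C, a2, ?_⟩
    have : Q = c := by grind
    have : α = p := by grind
    grind
  · grind
  · grind
  · grind
  · grind

/-- When the new edge is the pendant edge, one of the replies `ab`, `ac` destroys all pendant
squares. Otherwise `a` has a neighbour `s` adjacent to `b` and to `c`, and before the move `b`, `c`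
were the poles of a middle theta with middle vertices `p`, `q`, `s`. -/
theorem PendantSquare.reply_pendant (h : Played A L A₁ L₁ u v) {p b c : V}
    (hc : PendantSquare A₁ L₁ p u b c v) :
    (∀ P Q B C α, ¬ PendantSquare A₁ (Without L₁ v b) P Q B C α) ∨
    (∀ P Q B C α, ¬ PendantSquare A₁ (Without L₁ v c) P Q B C α) := by
  by_contra! hno
  obtain ⟨⟨P, Q, B, C, α, h1⟩, ⟨P', Q', B', C', α', h2⟩⟩ := hno
  obtain ⟨s, s1, s2, s3, s4⟩ := hc.survivor_pendant h h1
  obtain ⟨t, t1, t2, t3, t4⟩ := (hc.swap h.b₁).survivor_pendant h h2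
  obtain ⟨b1, b2, b3, b4, b5, l1, l2, l3, l4, l5, d1, d2⟩ := hc
  have hs := h.b.symm
  have hls := h.b.lsymm
  have hs1 := h.b₁.symm
  have hn := h.b₁.ne
  have hn' := h.b₁.lne
  have hna := h.b₁.notAdj
  have d3 := d2 s t u
  have hst : s = t := by grind
  subst hst
  have hle := h.le
  have o := fun x y hxy => h.old_of_ne (x := x) (y := y) hxy
  refine h.inv.middleTheta b c p u s ⟨hs _ _ (o _ _ b1 ?_ ?_), hs _ _ (o _ _ b4 ?_ ?_),
    o _ _ t2 ?_ ?_,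
    hs _ _ (o _ _ b2 ?_ ?_), hs _ _ (o _ _ b5 ?_ ?_), o _ _ s2 ?_ ?_, hn' _ _ l2, hle _ _ l1,
      hle _ _ s4,
    hle _ _ s3, h.b.le_three _ _ (hle _ _ l2), h.b.le_three _ _ (hls _ _ (hle _ _ l2))⟩
  all_goals grind

/-- If the new edge is `qb` and some pendant square survives the reply `bc`, then `a` and `b` have a
common neighbour `s` outside the square which may be joined to `p` and `q`. -/
theorem PendantSquare.survivor_near (h : Played A L A₁ L₁ u v) {p c a : V}
    (hc : PendantSquare A₁ L₁ p u v c a) {P Q B C α : V} (h2 : PendantSquare A₁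
      (Without L₁ v c) P Q B C α) :
    ∃ s, A₁ v s ∧ A₁ a s ∧ s ≠ u ∧ s ≠ p ∧ L₁ u s ∧ L₁ p s := by
  obtain ⟨P, Q, B, C, α, h2, he'⟩ := (h.mono_legal v c).pendantSquare_cases h2
  obtain ⟨a1, a2, a3, a4, a5, m1, m2, m3, m4, m5, c1, c2⟩ := h2
  obtain ⟨b1, b2, b3, b4, b5, l1, l2, l3, l4, l5, d1, d2⟩ := hc
  have hs1 := h.b₁.symm
  have hls := h.b₁.lsymm
  have hn' := h.b₁.lne
  have hn := h.b₁.ne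
  have hna := h.b₁.notAdj
  have f1 := d1.exact b1 b2 (hn' _ _ l2)
  have f3 := h.exact (hls _ _ l1) b3 b4 b5 (hn' _ _ l4) (hn' _ _ l5) (hn' _ _ l2)
  have f4 := c2 v a c
  have f5 := c1 v a c
  have f8 := c1 p u C
  have f7 := h.b₁.le_three v _ l2 u p C α
  have f9 := h.b₁.le_three v _ l2 u p B C
  unfold NewEdge at *
  unfold Without at *
  rcases he' with (⟨rfl, rfl⟩ | ⟨rfl, rfl⟩) | (⟨rfl, rfl⟩ | ⟨rfl, rfl⟩) | (⟨rfl, rfl⟩ | ⟨rfl, rfl⟩)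
  · grind
  · grind
  · grind
  · grind
  · grind
  · have hC : C = p ∨ α = p := by grind
    rcases hC with rfl | rfl
    · grind
    · have : P = a := by grind
      subst this
      exact ⟨C, a5, a2, by grind, by grind, by grind, by grind⟩

/-- In the presence of the vertex `s` of `PendantSquare.survivor_near`, no pendant square survives
the reply `ab`. -/
theorem PendantSquare.no_survivor_near (h : Played A L A₁ L₁ u v) {p c a : V}
    (hc : PendantSquare A₁ L₁ p u v c a) {s : V} (s1 : A₁ v s) (s2 : A₁ a s) (s3 : s ≠ u)
      (s4 : s ≠ p)
    (s5 : L₁ u s) (s6 : L₁ p s)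
    {P Q B C α : V} (h2 : PendantSquare A₁ (Without L₁ v a) P Q B C α) : False := by
  obtain ⟨P, Q, B, C, α, h2, he'⟩ := (h.mono_legal v a).pendantSquare_cases h2
  obtain ⟨a1, a2, a3, a4, a5, m1, m2, m3, m4, m5, c1, c2⟩ := h2
  obtain ⟨b1, b2, b3, b4, b5, l1, l2, l3, l4, l5, d1, d2⟩ := hc
  have hs1 := h.b₁.symm
  have hls := h.b₁.lsymm
  have hn' := h.b₁.lne
  have hn := h.b₁.ne
  have hna := h.b₁.notAdj
  have f1 := d1.exact b1 b2 (hn' _ _ l2)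
  have f3 := h.exact (hls _ _ l1) b3 b4 b5 (hn' _ _ l4) (hn' _ _ l5) (hn' _ _ l2)
  have f6 := h.exact l2 h.symm.new (hs1 _ _ b1) s1 (hn' _ _ l1).symm s3.symm s4.symm
  have f4 := c2 v a c
  have f5 := c1 v a c
  have f8 := c1 p u s
  unfold NewEdge at *
  unfold Without at *
  rcases he' with (⟨rfl, rfl⟩ | ⟨rfl, rfl⟩) | (⟨rfl, rfl⟩ | ⟨rfl, rfl⟩) | (⟨rfl, rfl⟩ | ⟨rfl, rfl⟩)
  · grind
  · grind
  · grind
  · grind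
  · grind
  · have hC : (C = p ∧ α = s) ∨ (C = s ∧ α = p) := by grind
    rcases hC with ⟨rfl, rfl⟩ | ⟨rfl, rfl⟩
    · have hP : P = c := by grind
      subst hP
      have hs0 := h.b.symm
      have hls0 := h.b.lsymm
      have hle := h.le
      have o := fun x y hxy => h.old_of_ne (x := x) (y := y) hxy
      have k := h.inv.cherry C Q P (o _ _ b1 (by grind) (by grind)) (o _ _ b2 (by grind) (by grind))
        (hle _ _ l2)
      have g1 := c1.exact a2 a1 (by grind)
      have hof := fun x y (hxy : A x y) => h.of_adj hxy
      have hna0 := h.b.notAdj _ _ (hls0 _ _ h.huv)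
      unfold Guard at k
      clear a1 a2 a3 a4 a5 m1 m2 m3 m4 m5 c1 c2
      grind
    · have : P = a := by grind
      subst this
      grind

/-- When the new edge is the edge `qb` of the square at the pendant edge, one of the replies `bc`,
`ab` destroys all pendant squares. -/
theorem PendantSquare.reply_near (h : Played A L A₁ L₁ u v) {p c a : V}
    (hc : PendantSquare A₁ L₁ p u v c a) :
    (∀ P Q B C α, ¬ PendantSquare A₁ (Without L₁ v c) P Q B C α) ∨
    (∀ P Q B C α, ¬ PendantSquare A₁ (Without L₁ v a) P Q B C α) := by
  by_contra! hno
  obtain ⟨⟨P, Q, B, C, α, h1⟩, ⟨P', Q', B', C', α', h2⟩⟩ := hno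
  obtain ⟨s, s1, s2, s3, s4, s5, s6⟩ := hc.survivor_near h h1
  exact hc.no_survivor_near h s1 s2 s3 s4 s5 s6 h2

/-- If the new edge is `pb` and some pendant square survives the reply `bc`, then `a` and `b` have a
common neighbour `s` outside the square which may be joined to `p` and `q`. -/
theorem PendantSquare.survivor_far (h : Played A L A₁ L₁ u v) {q c a : V}
    (hc : PendantSquare A₁ L₁ u q v c a) {P Q B C α : V} (h2 : PendantSquare A₁
      (Without L₁ v c) P Q B C α) :
    ∃ s, A₁ v s ∧ A₁ a s ∧ s ≠ u ∧ s ≠ q ∧ L₁ u s ∧ L₁ q s := by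
  obtain ⟨P, Q, B, C, α, h2, he'⟩ := (h.mono_legal v c).pendantSquare_cases h2
  obtain ⟨a1, a2, a3, a4, a5, m1, m2, m3, m4, m5, c1, c2⟩ := h2
  obtain ⟨b1, b2, b3, b4, b5, l1, l2, l3, l4, l5, d1, d2⟩ := hc
  have hs1 := h.b₁.symm
  have hls := h.b₁.lsymm
  have hn' := h.b₁.lne
  have hn := h.b₁.ne
  have hna := h.b₁.notAdj
  have f1 := d1.exact b1 b2 (hn' _ _ l2)
  have f3 := h.exact (hls _ _ l1) b3 b4 b5 (hn' _ _ l4) (hn' _ _ l5) (hn' _ _ l2)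
  have f4 := c2 v a c
  have f5 := c1 v a c
  have f8 := c1 u q C
  have f7 := h.b₁.le_three v _ l2 u q C α
  have f9 := h.b₁.le_three v _ l2 u q B C
  unfold NewEdge at *
  unfold Without at *
  rcases he' with (⟨rfl, rfl⟩ | ⟨rfl, rfl⟩) | (⟨rfl, rfl⟩ | ⟨rfl, rfl⟩) | (⟨rfl, rfl⟩ | ⟨rfl, rfl⟩)
  · grind
  · grind
  · grind
  · have hb : (B = q ∨ C = q) := by grind
    have hP : P = a := by grind
    subst hP
    rcases hb with rfl | rfl
    · exact ⟨C, a5, a2, by grind, by grind, by grind, by grind⟩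
    · exact ⟨B, a4, a1, by grind, by grind, by grind, by grind⟩
  · grind
  · have hb : (C = q ∨ α = q) := by grind
    grind

/-- If moreover some pendant square survives the reply `pq`, then the vertex `s` is adjacent to `c`
as well. -/
theorem PendantSquare.survivor_far_adj (h : Played A L A₁ L₁ u v) {q c a : V}
    (hc : PendantSquare A₁ L₁ u q v c a) {s : V} (s1 : A₁ v s) (s3 : s ≠ u) (s4 : s ≠ q)
      (s5 : L₁ u s)
    {P Q B C α : V} (h2 : PendantSquare A₁ (Without L₁ u q) P Q B C α) : A₁ c s := by
  obtain ⟨P, Q, B, C, α, h2, he'⟩ := (h.mono_legal u q).pendantSquare_cases h2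
  obtain ⟨a1, a2, a3, a4, a5, m1, m2, m3, m4, m5, c1, c2⟩ := h2
  obtain ⟨b1, b2, b3, b4, b5, l1, l2, l3, l4, l5, d1, d2⟩ := hc
  have hs1 := h.b₁.symm
  have hls := h.b₁.lsymm
  have hn' := h.b₁.lne
  have hn := h.b₁.ne
  have hna := h.b₁.notAdj
  have f1 := d1.exact b1 b2 (hn' _ _ l2)
  have f3 := h.exact (hls _ _ l1) b3 b4 b5 (hn' _ _ l4) (hn' _ _ l5) (hn' _ _ l2)
  have f6 := h.exact l2 h.symm.new (hs1 _ _ b4) s1 (hn' _ _ l1) s3.symm s4.symm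
  have f4 := c2 v a c
  have f5 := c1 v a c
  have f8 := c1 u q s
  unfold NewEdge at *
  unfold Without at *
  rcases he' with (⟨rfl, rfl⟩ | ⟨rfl, rfl⟩) | (⟨rfl, rfl⟩ | ⟨rfl, rfl⟩) | (⟨rfl, rfl⟩ | ⟨rfl, rfl⟩)
  all_goals grind

/-- When the new edge is the edge `pb` of the square opposite to the pendant edge, one of the
replies `bc`, `pq` destroys all pendant squares. Otherwise `q`, `s` were the poles of a middle theta
with middle vertices `a`, `b`, `c` before the move. -/
theorem PendantSquare.reply_far (h : Played A L A₁ L₁ u v) {q c a : V}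
    (hc : PendantSquare A₁ L₁ u q v c a) :
    (∀ P Q B C α, ¬ PendantSquare A₁ (Without L₁ v c) P Q B C α) ∨
    (∀ P Q B C α, ¬ PendantSquare A₁ (Without L₁ u q) P Q B C α) := by
  by_contra! hno
  obtain ⟨⟨P, Q, B, C, α, h1⟩, ⟨P', Q', B', C', α', h2⟩⟩ := hno
  obtain ⟨s, s1, s2, s3, s4, s5, s6⟩ := hc.survivor_far h h1
  have s7 := hc.survivor_far_adj h s1 s3 s4 s5 h2
  obtain ⟨b1, b2, b3, b4, b5, l1, l2, l3, l4, l5, d1, d2⟩ := hc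
  have hs := h.b.symm
  have hls := h.b.lsymm
  have hs1 := h.b₁.symm
  have hn := h.b₁.ne
  have hn' := h.b₁.lne
  have hle := h.le
  have o := fun x y hxy => h.old_of_ne (x := x) (y := y) hxy
  refine h.inv.middleTheta q s a v c ⟨o _ _ b3 ?_ ?_, o _ _ b4 ?_ ?_, o _ _ b5 ?_ ?_,
    hs _ _ (o _ _ s2 ?_ ?_),
    hs _ _ (o _ _ s1 ?_ ?_), hs _ _ (o _ _ s7 ?_ ?_), s4.symm, hle _ _ l4, hle _ _ l5, hle _ _ l2,
    h.b.le_three _ _ (hls _ _ (hle _ _ l1)), h.b.le_three _ _ (hls _ _ (hle _ _ s5))⟩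
  all_goals grind

/-- A good reply to a pendant square, in the absence of the configurations that are answered first.
-/
theorem PendantSquare.inv (h : Played A L A₁ L₁ u v) (hnt : ∀ p q b c, ¬ Threat A₁ L₁ p q b c)
    (hdb : ∀ p q b c a, ¬ PendantDiamond A₁ L₁ p q b c a) (hdk : ∀ p q a b c,
      ¬ PolarTheta A₁ L₁ p q a b c)
    (hx : ∀ p a q q' b c, ¬ PuncturedBipartite A₁ L₁ p a q q' b c) (ht : ∀ p q a b c,
      ¬ MiddleTheta A₁ L₁ p q a b c)
    {p q b c a : V} (hc : PendantSquare A₁ L₁ p q b c a)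
    (he : NewEdge u v p b ∨ NewEdge u v q a ∨ NewEdge u v q b) :
    ∃ x y, L₁ x y ∧ Inv A₁ (Without L₁ x y) := by
  have key : ∀ {u v y : V}, Played A L A₁ L₁ u v → A₁ u y → L₁ v y →
      (∀ P Q B C α, ¬ PendantSquare A₁ (Without L₁ v y) P Q B C α) → Inv A₁ (Without L₁ v y) := by
    intro u' v' y h' h1 h2 h3
    refine h'.inv_of_cherry hnt h1 h2 ?_ h3 ?_ ?_ ?_ ?_
    · exact fun _ _ _ _ _ hc => hdb _ _ _ _ _ (hc.mono Without.le)
    · exact fun _ _ _ _ _ h4 => hc.no_bull h he (h4.mono Without.le)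
    · exact fun _ _ _ _ _ hc => hdk _ _ _ _ _ (hc.mono Without.le)
    · exact fun _ _ _ _ _ hc => ht _ _ _ _ _ (hc.mono Without.le)
    · exact fun _ _ _ _ _ _ hc => hx _ _ _ _ _ _ (hc.mono Without.le)
  have hs := h.b₁.symm
  have hls := h.b₁.lsymm
  have hpb : ∀ {u v q c a : V}, Played A L A₁ L₁ u v → PendantSquare A₁ L₁ u q v c a →
      ∃ x y, L₁ x y ∧ Inv A₁ (Without L₁ x y) := by
    intro u' v' q' c' a' h' hc
    rcases hc.reply_far h' with h3 | h3
    · exact ⟨v', c', hc.2.2.2.2.2.2.1, key h' hc.2.1 hc.2.2.2.2.2.2.1 h3⟩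
    · exact ⟨u', q', hc.2.2.2.2.2.1, key h'.symm (hs _ _ hc.2.2.2.1) hc.2.2.2.2.2.1 h3⟩
  have hqa : ∀ {u v p b c : V}, Played A L A₁ L₁ u v → PendantSquare A₁ L₁ p u b c v →
      ∃ x y, L₁ x y ∧ Inv A₁ (Without L₁ x y) := by
    intro u' v' p' b' c' h' hc
    obtain ⟨b1, b2, b3, b4, b5, l1, l2, l3, l4, l5, d1, d2⟩ := id hc
    rcases hc.reply_pendant h' with h3 | h3
    · exact ⟨v', b', l4, key h' b4 l4 h3⟩
    · exact ⟨v', c', l5, key h' b5 l5 h3⟩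
  have hqb : ∀ {u v p c a : V}, Played A L A₁ L₁ u v → PendantSquare A₁ L₁ p u v c a →
      ∃ x y, L₁ x y ∧ Inv A₁ (Without L₁ x y) := by
    intro u' v' p' c' a' h' hc
    obtain ⟨b1, b2, b3, b4, b5, l1, l2, l3, l4, l5, d1, d2⟩ := id hc
    rcases hc.reply_near h' with h3 | h3
    · exact ⟨v', c', l2, key h' b5 l2 h3⟩
    · exact ⟨v', a', hls _ _ l4, key h' b3 (hls _ _ l4) h3⟩
  rcases he with (⟨rfl, rfl⟩ | ⟨rfl, rfl⟩) | (⟨rfl, rfl⟩ | ⟨rfl, rfl⟩) | (⟨rfl, rfl⟩ | ⟨rfl, rfl⟩)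
  · exact hpb h hc
  · exact hpb h.symm hc
  · exact hqa h hc
  · exact hqa h.symm hc
  · exact hqb h hc
  · exact hqb h.symm hc

/-! ### Answering a bull -/

/-- The vertices `p` and `q` have degree three, so they have no neighbours outside the bull. -/
theorem Bull.exact (h : Played A L A₁ L₁ u v) {p q c b a : V} (hc : Bull A₁ L₁ p q c b a) :
    (∀ w, A₁ p w → w = q ∨ w = c ∨ w = b) ∧ (∀ w, A₁ q w → w = p ∨ w = c ∨ w = a) := by
  obtain ⟨b1, b2, b3, b4, b5, l1, l2, l3, l4, l5, d1, d2⟩ := hc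
  have hs := h.b₁.symm
  have hn := h.b₁.ne
  have hn' := h.b₁.lne
  exact ⟨h.exact l2 b1 b2 b4 (hn _ _ b3) (hn' _ _ l1) (hn' _ _ l5).symm,
    h.exact l1 (hs _ _ b1) b3 b5 (hn _ _ b2) (hn' _ _ l2) (hn' _ _ l4).symm⟩

/-- When the new edge is the horn `pb`, the reply `qb` destroys all bulls. -/
theorem Bull.no_pendant (h : Played A L A₁ L₁ u v) {q c a : V} (hc : Bull A₁ L₁ u q c v a)
    {P Q B C α : V} (h2 : Bull A₁ (Without L₁ v q) P Q C B α) : False := by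
  obtain ⟨P, Q, C, B, α, h2, he'⟩ := (h.mono_legal v q).bull_cases h2
  obtain ⟨e1, e2⟩ := hc.exact h
  obtain ⟨a1, a2, a3, a4, a5, m1, m2, m3, m4, m5, c1, c2⟩ := h2
  obtain ⟨b1, b2, b3, b4, b5, l1, l2, l3, l4, l5, d1, d2⟩ := hc
  have hs1 := h.b₁.symm
  have hls := h.b₁.lsymm
  have hn' := h.b₁.lne
  have hn := h.b₁.ne
  have hna := h.b₁.notAdj
  have f1 := c1 q c v
  have f2 := c2 q c v
  unfold NewEdge at *
  unfold Without at *
  rcases he' with (⟨rfl, rfl⟩ | ⟨rfl, rfl⟩) | (⟨rfl, rfl⟩ | ⟨rfl, rfl⟩) | (⟨rfl, rfl⟩ | ⟨rfl, rfl⟩)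
  all_goals grind

/-- If `q`, `u`, `v` form a triangle, each of them has at most one further neighbour, and these may
be joined to the vertices of the triangle as listed, then neither `qu` nor `qv` was guarded before
the move, which contradicts the cherry condition at `q`. -/
theorem Played.not_unguarded_triangle (h : Played A L A₁ L₁ u v) {q a b s : V} (h1 : A₁ q u)
    (h2 : A₁ q v)
    (hu : ∀ w, A₁ u w → w = q ∨ w = v ∨ w = b) (hv : ∀ w, A₁ v w → w = q ∨ w = u ∨ w = s)
    (hq : ∀ w, A₁ q w → w = u ∨ w = v ∨ w = a)
    (l1 : L q b) (l2 : L q s) (l3 : L u a) (l4 : L v a) : False := by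
  have hn := h.b₁.ne
  have k := h.inv.cherry q u v (h.old_of_ne h1 (by grind) (by grind))
    (h.old_of_ne h2 (by grind) (by grind)) h.huv
  have hof := fun x y (hxy : A x y) => h.of_adj hxy
  have hna0 := h.b.notAdj _ _ h.huv
  have hna1 := h.b.notAdj _ _ (h.b.lsymm _ _ h.huv)
  have hl0 := h.huv
  have hl1 := h.b.lsymm _ _ h.huv
  unfold Guard at k
  grind

/-- When the new edge is the side `pc` of the triangle, the reply `bc` destroys all bulls. -/
theorem Bull.no_side (h : Played A L A₁ L₁ u v) {q b a : V} (hc : Bull A₁ L₁ u q v b a)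
    {P Q B C α : V} (h2 : Bull A₁ (Without L₁ v b) P Q C B α) : False := by
  obtain ⟨P, Q, C, B, α, h2, he'⟩ := (h.mono_legal v b).bull_cases h2
  obtain ⟨e1, e2⟩ := hc.exact h
  obtain ⟨f1, f2⟩ := h2.exact (h.mono_legal v b)
  obtain ⟨a1, a2, a3, a4, a5, m1, m2, m3, m4, m5, c1, c2⟩ := h2
  obtain ⟨b1, b2, b3, b4, b5, l1, l2, l3, l4, l5, d1, d2⟩ := hc
  have hs1 := h.b₁.symm
  have hls := h.b₁.lsymm
  have hn' := h.b₁.lne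
  have hn := h.b₁.ne
  have hna := h.b₁.notAdj
  have f3 := c1 q b v
  have f4 := c2 q b v
  have key : ∃ s, (∀ w, A₁ v w → w = q ∨ w = u ∨ w = s) ∧ L₁ q s ∧ L₁ u a := by
    unfold NewEdge at *
    unfold Without at *
    rcases he' with (⟨rfl, rfl⟩ | ⟨rfl, rfl⟩) | (⟨rfl, rfl⟩ | ⟨rfl, rfl⟩) | (⟨rfl, rfl⟩ | ⟨rfl,
      rfl⟩)
    · grind
    · grind
    · grind
    · have : Q = q := by grind
      subst this
      exact ⟨B, f1, m1.1, l2⟩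
    · grind
    · grind
  obtain ⟨s, k1, k2, k3⟩ := key
  exact Played.not_unguarded_triangle h (b := b) (hs1 _ _ b1) b3 e1 k1 (by grind) (h.le _ _ l1)
    (h.le _ _ k2)
    (h.le _ _ k3) (h.le _ _ (hls _ _ l4))

/-- If the new edge is the base `pq` and some bull survives the reply `qb`, then the apex `c` has
exactly one neighbour `s` besides `p` and `q`; the pairs `qs` and `ca` are legal. -/
theorem Bull.survivor_base (h : Played A L A₁ L₁ u v) {c b a : V} (hc : Bull A₁ L₁ u v c b a)
    {P Q B C α : V} (h2 : Bull A₁ (Without L₁ v b) P Q C B α) :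
    ∃ s, (∀ w, A₁ c w → w = u ∨ w = v ∨ w = s) ∧ A₁ c s ∧ s ≠ u ∧ s ≠ v ∧ L₁ v s ∧ L₁ c a := by
  obtain ⟨P, Q, C, B, α, h2, he'⟩ := (h.mono_legal v b).bull_cases h2
  obtain ⟨e1, e2⟩ := hc.exact h
  obtain ⟨f1, f2⟩ := h2.exact (h.mono_legal v b)
  obtain ⟨a1, a2, a3, a4, a5, m1, m2, m3, m4, m5, c1, c2⟩ := h2
  obtain ⟨b1, b2, b3, b4, b5, l1, l2, l3, l4, l5, d1, d2⟩ := hc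
  have hs1 := h.b₁.symm
  have hls := h.b₁.lsymm
  have hn' := h.b₁.lne
  have hn := h.b₁.ne
  have hna := h.b₁.notAdj
  have f3 := c1 u b v
  have f4 := c2 u b v
  have f5 := c2 c b v
  have f6 := c2 u c a
  unfold NewEdge at *
  unfold Without at *
  rcases he' with (⟨rfl, rfl⟩ | ⟨rfl, rfl⟩) | (⟨rfl, rfl⟩ | ⟨rfl, rfl⟩) | (⟨rfl, rfl⟩ | ⟨rfl, rfl⟩)
  · grind
  · grind
  · grind
  · have : Q = c := by grind
    subst this
    have : B = a := by grind
    subst this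
    exact ⟨α, by grind, a5, by grind, by grind, m2.1, m1.1⟩
  · grind
  · grind

/-- When the new edge is the base, one of the replies `qb`, `pa` destroys all bulls; otherwise the
cherry condition failed at the apex before the move. -/
theorem Bull.reply_base (h : Played A L A₁ L₁ u v) {c b a : V} (hc : Bull A₁ L₁ u v c b a) :
    (∀ P Q C B α, ¬ Bull A₁ (Without L₁ v b) P Q C B α) ∨
    (∀ P Q C B α, ¬ Bull A₁ (Without L₁ u a) P Q C B α) := by
  by_contra! hno
  obtain ⟨⟨P, Q, B, C, α, h1⟩, ⟨P', Q', B', C', α', h2⟩⟩ := hno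
  obtain ⟨s, s0, s1, s2, s3, s4, s5⟩ := hc.survivor_base h h1
  obtain ⟨t, t0, t1, t2, t3, t4, t5⟩ := (hc.swap h.b₁).survivor_base h.symm h2
  have hst : s = t := by grind
  subst hst
  obtain ⟨e1, e2⟩ := hc.exact h
  obtain ⟨b1, b2, b3, b4, b5, l1, l2, l3, l4, l5, d1, d2⟩ := hc
  have hs1 := h.b₁.symm
  have hls := h.b₁.lsymm
  have hn := h.b₁.ne
  have k := h.inv.cherry c u v (h.old_of_ne (hs1 _ _ b2) (by grind) (by grind))
    (h.old_of_ne (hs1 _ _ b3) (by grind) (by grind)) h.huv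
  have hof := fun x y (hxy : A x y) => h.of_adj hxy
  have hna0 := h.b.notAdj _ _ h.huv
  have hna1 := h.b.notAdj _ _ (h.b.lsymm _ _ h.huv)
  have hl0 := h.huv
  have hl1 := h.b.lsymm _ _ h.huv
  have hle := h.le
  unfold Guard at k
  grind

/-- A good reply to a bull, in the absence of the configurations that are answered first. -/
theorem Bull.inv (h : Played A L A₁ L₁ u v) (hnt : ∀ p q b c, ¬ Threat A₁ L₁ p q b c)
    (hdb : ∀ p q b c a, ¬ PendantDiamond A₁ L₁ p q b c a) (hdk : ∀ p q a b c,
      ¬ PolarTheta A₁ L₁ p q a b c)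
    (hx : ∀ p a q q' b c, ¬ PuncturedBipartite A₁ L₁ p a q q' b c) (ht : ∀ p q a b c,
      ¬ MiddleTheta A₁ L₁ p q a b c)
    (hcp : ∀ p q a b c, ¬ PendantSquare A₁ L₁ p q a b c)
    {p q c b a : V} (hc : Bull A₁ L₁ p q c b a)
    (he : NewEdge u v p q ∨ NewEdge u v p c ∨ NewEdge u v p b) :
    ∃ x y, L₁ x y ∧ Inv A₁ (Without L₁ x y) := by
  have key : ∀ {u v y : V}, Played A L A₁ L₁ u v → A₁ u y → L₁ v y →
      (∀ P Q B C α, ¬ Bull A₁ (Without L₁ v y) P Q B C α) →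
      ∃ x y, L₁ x y ∧ Inv A₁ (Without L₁ x y) := by
    intro u' v' y h' h1 h2 h3
    refine ⟨v', y, h2, h'.inv_of_cherry hnt h1 h2 ?_ ?_ h3 ?_ ?_ ?_⟩
    · exact fun _ _ _ _ _ hc => hdb _ _ _ _ _ (hc.mono Without.le)
    · exact fun _ _ _ _ _ h4 => hcp _ _ _ _ _ (h4.mono Without.le)
    · exact fun _ _ _ _ _ hc => hdk _ _ _ _ _ (hc.mono Without.le)
    · exact fun _ _ _ _ _ hc => ht _ _ _ _ _ (hc.mono Without.le)
    · exact fun _ _ _ _ _ _ hc => hx _ _ _ _ _ _ (hc.mono Without.le)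
  have hs := h.b₁.symm
  have hls := h.b₁.lsymm
  have hpq : ∀ {u v c b a : V}, Played A L A₁ L₁ u v → Bull A₁ L₁ u v c b a →
      ∃ x y, L₁ x y ∧ Inv A₁ (Without L₁ x y) := by
    intro u' v' c' b' a' h' hc
    obtain ⟨b1, b2, b3, b4, b5, l1, l2, l3, l4, l5, d1, d2⟩ := id hc
    rcases hc.reply_base h' with h3 | h3
    · exact key h' b4 l1 h3
    · exact key h'.symm b5 l2 h3
  obtain ⟨b1, b2, b3, b4, b5, l1, l2, l3, l4, l5, d1, d2⟩ := id hc
  rcases he with (⟨rfl, rfl⟩ | ⟨rfl, rfl⟩) | (⟨rfl, rfl⟩ | ⟨rfl, rfl⟩) | (⟨rfl, rfl⟩ | ⟨rfl, rfl⟩)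
  · exact hpq h hc
  · exact hpq h.symm hc
  · exact key h b4 (hls _ _ l5) fun _ _ _ _ _ h4 => hc.no_side h h4
  · exact key h.symm b4 (hls _ _ l5) fun _ _ _ _ _ h4 => hc.no_side h.symm h4
  · exact key h b1 (hls _ _ l1) fun _ _ _ _ _ h4 => hc.no_pendant h h4
  · exact key h.symm b1 (hls _ _ l1) fun _ _ _ _ _ h4 => hc.no_pendant h.symm h4

/-! ### Moves at a vertex of full degree -/

/-- The new edge does not belong to a pendant square if one of its ends, or a common neighbour of
its ends, has no legal pair left. The lemmas below say the same for other configurations, under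
similar hypotheses. -/
theorem Played.no_pendantSquare_of_full (h : Played A L A₁ L₁ u v) {q : V} (hq : ∀ x, ¬ L₁ q x)
    (hf : q = u ∨ q = v ∨ (A₁ q u ∧ A₁ q v)) {P Q B C α : V} (h2 : PendantSquare A₁ L₁ P Q B C α) :
    False := by
  obtain ⟨P, Q, B, C, α, h2, he'⟩ := h.pendantSquare_cases h2
  obtain ⟨a1, a2, a3, a4, a5, m1, m2, m3, m4, m5, c1, c2⟩ := h2
  have hs1 := h.b₁.symm
  have hls := h.b₁.lsymm
  have hn' := h.b₁.lne
  have f1 := c1.exact a1 a2 (hn' _ _ m2)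
  have f2 := h.exact (hls _ _ m1) a3 a4 a5 (hn' _ _ m4) (hn' _ _ m5) (hn' _ _ m2)
  unfold NewEdge at he'
  grind

theorem Played.no_polarTheta_of_full (h : Played A L A₁ L₁ u v) {q : V} (hq : ∀ x, ¬ L₁ q x)
    (hf : q = u ∨ q = v ∨ (A₁ q u ∧ A₁ q v)) {P Q B C α : V} (h2 : PolarTheta A₁ L₁ P Q α B C) :
    False := by
  obtain ⟨Q, b, c, h2⟩ := h.polarTheta_cases h2
  have hls := h.b₁.lsymm
  have hs1 := h.b₁.symm
  have hof := fun x y (hxy : A x y) => h.of_adj hxy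
  rcases h2 with h2 | h2
  · obtain ⟨-, -, e1, -⟩ := h2.exact h
    unfold NewPolarTheta at h2
    grind
  · obtain ⟨-, -, e1, -⟩ := h2.exact h.symm
    unfold NewPolarTheta at h2
    grind

theorem Played.no_middleTheta_of_full (h : Played A L A₁ L₁ u v) {q : V} (hq : ∀ x, ¬ L₁ q x)
    (hf : (AtMostThree A₁ u ∧ AtMostThree A₁ v ∧ A₁ q u ∧ A₁ q v) ∨
      ((q = u ∨ q = v) ∧ ¬ AtMostThree A₁ q)) {P Q B C α : V} (h2 : MiddleTheta A₁ L₁ P Q α B C) :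
    False := by
  obtain ⟨P, Q, α, B, C, h2, he'⟩ := h.middleTheta_cases h2
  obtain ⟨a1, a2, a3, a4, a5, a6, m1, m2, m3, m4, c1, c2⟩ := h2
  have hs1 := h.b₁.symm
  have hls := h.b₁.lsymm
  have hn' := h.b₁.lne
  have f1 := c1 α B C q
  unfold NewEdge at he'
  grind

theorem Played.no_bull_of_full (h : Played A L A₁ L₁ u v) {q : V} (hq : ∀ x, ¬ L₁ q x)
    (hf : q = u ∨ q = v ∨ (A₁ q u ∧ A₁ q v ∧
      ((∀ x, A₁ u x → A₁ v x → x = q)))) {P Q B C α : V} (h2 : Bull A₁ L₁ P Q C B α) :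
    False := by
  obtain ⟨P, Q, C, B, α, h2, he'⟩ := h.bull_cases h2
  obtain ⟨f1, f2⟩ := h2.exact h
  obtain ⟨a1, a2, a3, a4, a5, m1, m2, m3, m4, m5, c1, c2⟩ := h2
  have hs1 := h.b₁.symm
  have hls := h.b₁.lsymm
  have hn' := h.b₁.lne
  unfold NewEdge at he'
  grind

theorem Played.no_punctured_of_full (h : Played A L A₁ L₁ u v) {q : V} (hq : ∀ x, ¬ L₁ q x)
    (hf : q = u ∨ q = v ∨ (A₁ q u ∧ A₁ q v)) {P Q Q' B C α : V}
      (h2 : PuncturedBipartite A₁ L₁ P α Q Q' B C) :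
    False := by
  obtain ⟨P, α, Q, Q', B, C, h2, he'⟩ := h.punctured_cases h2
  obtain ⟨e1, e2, e3, e4, e5, e6⟩ := h2.exact h
  obtain ⟨a1, a2, a3, a4, a5, a6, a7, a8, m1, m2, m3, m4, m5, m6, m7, c1, c2⟩ := h2
  have hs1 := h.b₁.symm
  have hls := h.b₁.lsymm
  have hn' := h.b₁.lne
  unfold NewEdge at he'
  grind

/-! ### Answering a pendant diamond -/

theorem not_atMostThree {x a b c d : V} (ha : A x a) (hb : A x b) (hc : A x c) (hd : A x d)
    (h1 : a ≠ b) (h2 : a ≠ c) (h3 : a ≠ d) (h4 : b ≠ c) (h5 : b ≠ d) (h6 : c ≠ d) :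
    ¬ AtMostThree A x := by
  intro h
  have := h a b c d ha hb hc hd
  grind

/-- The reply `pa` destroys all pendant diamonds. -/
theorem PendantDiamond.no_pendantDiamond (h : Played A L A₁ L₁ u v) {p q b c a : V}
    (hd : PendantDiamond A₁ L₁ p q b c a)
    (hbc : ¬ A₁ b c)
    (hf : NewEdge u v p q ∨ NewEdge u v p b ∨ NewEdge u v q b ∨ NewEdge u v q a)
    {P Q B C α : V} (h2 : PendantDiamond A₁ (Without L₁ p a) P Q B C α) : False := by
  obtain ⟨P, Q, B, C, α, h2, he'⟩ := (h.mono_legal p a).pendantDiamond_cases h2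
  obtain ⟨b1, b2, b3, b4, b5, b6, n1, l1, l2, l3, d⟩ := hd
  obtain ⟨a1, a2, a3, a4, a5, a6, n2, m1, m2, m3, c1⟩ := h2
  have hs1 := h.b₁.symm
  have hls := h.b₁.lsymm
  have hn' := h.b₁.lne
  have hn := h.b₁.ne
  have hna := h.b₁.notAdj
  have e1 := exact_four h.b₁ (hs1 _ _ b1) b4 b5 b6 (hn _ _ b2) (hn _ _ b3) (hn' _ _ l1) n1
    (hn' _ _ l2).symm
    (hn' _ _ l3).symm
  have e2 := exact_four h.b₁ (hs1 _ _ a1) a4 a5 a6 (hn _ _ a2) (hn _ _ a3) (hn' _ _ m1.1) n2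
    (hn' _ _ m2.1).symm
    (hn' _ _ m3.1).symm
  have e3 := exact_three h.b₁ l1 b1 b2 b3 (hn _ _ b4) (hn _ _ b5) n1
  have hq : ∀ x, ¬ L₁ q x := fun x hx => not_atMostThree (hs1 _ _ b1) b4 b5 b6 (hn _ _ b2)
    (hn _ _ b3)
    (hn' _ _ l1) n1 (hn' _ _ l2).symm (hn' _ _ l3).symm (h.b₁.le_three _ _ hx)
  have hQ : ∀ x, ¬ L₁ Q x := fun x hx => not_atMostThree (hs1 _ _ a1) a4 a5 a6 (hn _ _ a2)
    (hn _ _ a3)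
    (hn' _ _ m1.1) n2 (hn' _ _ m2.1).symm (hn' _ _ m3.1).symm (h.b₁.le_three _ _ hx)
  have hbc' : ¬ A₁ c b := fun h' => hbc (hs1 _ _ h')
  have hbp : p ≠ b := hn _ _ b2
  have hqq : Q = q := by
    unfold Without at *
    unfold NewEdge at *
    clear h2
    rcases hf with (⟨rfl, rfl⟩ | ⟨rfl, rfl⟩) | (⟨rfl, rfl⟩ | ⟨rfl, rfl⟩) | (⟨rfl, rfl⟩ | ⟨rfl,
      rfl⟩) | (⟨rfl, rfl⟩ | ⟨rfl, rfl⟩) <;>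
    rcases he' with (⟨rfl, rfl⟩ | ⟨rfl, rfl⟩) | (⟨rfl, rfl⟩ | ⟨rfl, rfl⟩) | (⟨rfl, rfl⟩ | ⟨rfl,
      rfl⟩) | (⟨rfl, rfl⟩ | ⟨rfl, rfl⟩)
    all_goals grind
  subst hqq
  have hα : α = p ∨ α = b ∨ α = c ∨ α = a := by grind
  unfold Without at *
  rcases hα with rfl | rfl | rfl | rfl
  · grind
  · grind
  · grind
  · grind

/-- The reply `pa` to a pendant diamond is good. Since `q` has degree four, no other configuration
can contain the new edge. -/
theorem PendantDiamond.inv (h : Played A L A₁ L₁ u v) (hnt : ∀ p q b c, ¬ Threat A₁ L₁ p q b c)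
    {p q b c a : V} (hd : PendantDiamond A₁ L₁ p q b c a)
    (he : NewEdge u v p q ∨ NewEdge u v p b ∨ NewEdge u v q b ∨ NewEdge u v q a) :
    Inv A₁ (Without L₁ p a) := by
  obtain ⟨b1, b2, b3, b4, b5, b6, n1, l1, l2, l3, d⟩ := id hd
  have hbc : ¬ A₁ b c := h.k4 p q b c b1 b2 b3 b4 b5
  have lbc : ¬ L₁ b c := fun l => hnt p q b c ⟨b1, b2, b3, b4, b5, l⟩
  have hs1 := h.b₁.symm
  have hls := h.b₁.lsymm
  have hn' := h.b₁.lne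
  have hn := h.b₁.ne
  have hna := h.b₁.notAdj
  have hf : ¬ AtMostThree A₁ q := not_atMostThree (hs1 _ _ b1) b4 b5 b6 (hn _ _ b2) (hn _ _ b3)
    (hn' _ _ l1) n1 (hn' _ _ l2).symm (hn' _ _ l3).symm
  have hq : ∀ x, ¬ Without L₁ p a q x := fun x hx => hf (h.b₁.le_three _ _ hx.1)
  have hp3 := h.b₁.le_three _ _ l1
  have hb3 := h.b₁.le_three _ _ (hls _ _ l2)
  have ha3 := h.b₁.le_three _ _ l2
  have e3 := exact_three h.b₁ l1 b1 b2 b3 (hn _ _ b4) (hn _ _ b5) n1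
  have hl : ¬ Without L₁ p a p a := fun h' => h'.2 (Or.inl ⟨rfl, rfl⟩)
  have hfq : FullSplit A₁ (Without L₁ p a) q :=
    fun _ _ _ _ _ _ _ _ _ _ _ _ _ _ => ⟨b, c, b4, b5, n1, hbc, fun l => lbc l.1⟩
  have hfp : FullSplit A₁ (Without L₁ p a) p := fullSplit_of_atMostThree hp3
  have hfb : FullSplit A₁ (Without L₁ p a) b := fullSplit_of_atMostThree hb3
  have hfa : FullSplit A₁ (Without L₁ p a) a := fullSplit_of_atMostThree ha3
  have hbc' : ¬ A₁ c b := fun h' => hbc (hs1 _ _ h')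
  have hbp : p ≠ b := hn _ _ b2
  have h' := h.mono_legal p a
  have hmem : q = u ∨ q = v ∨ (A₁ q u ∧ A₁ q v) := by
    unfold NewEdge at he; grind
  refine h'.inv_of (fun p q b c ht => hnt p q b c ?_) (Or.inl ?_) ?_ ?_
    (fun P Q B C α hc => hd.no_pendantDiamond h hbc he hc) ?_ ?_ ?_ ?_ ?_
  · exact ⟨ht.1, ht.2.1, ht.2.2.1, ht.2.2.2.1, ht.2.2.2.2.1, ht.2.2.2.2.2.1⟩
  · have g1 : Guard A₁ (Without L₁ p a) p q := ⟨a, Or.inr ⟨b6, (hn' _ _ l1).symm, hna _ _ l1, hl⟩⟩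
    have g2 : Guard A₁ (Without L₁ p a) p b := ⟨c, Or.inl ⟨b3, n1.symm, hbc, fun l => lbc l.1⟩⟩
    have g3 : Guard A₁ (Without L₁ p a) q b := ⟨c, Or.inl ⟨b5, n1.symm, hbc, fun l => lbc l.1⟩⟩
    have g4 : Guard A₁ (Without L₁ p a) q a := ⟨p, Or.inl ⟨hs1 _ _ b1, hn' _ _ l1,
      hna _ _ (hls _ _ l1),
      fun l => l.2 (Or.inr ⟨rfl, rfl⟩)⟩⟩
    rcases he with (⟨rfl, rfl⟩ | ⟨rfl, rfl⟩) | (⟨rfl, rfl⟩ | ⟨rfl, rfl⟩) | (⟨rfl, rfl⟩ | ⟨rfl,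
      rfl⟩) |
      (⟨rfl, rfl⟩ | ⟨rfl, rfl⟩)
    exacts [g1, g1.symm, g2, g2.symm, g3, g3.symm, g4, g4.symm]
  · unfold NewEdge at he
    grind
  · unfold NewEdge at he
    grind
  · exact fun _ _ _ _ _ hc => h'.no_pendantSquare_of_full hq hmem hc
  · refine fun _ _ _ _ _ hc => h'.no_bull_of_full hq ?_ hc
    unfold NewEdge at he
    grind
  · exact fun _ _ _ _ _ hc => h'.no_polarTheta_of_full hq hmem hc
  · refine fun _ _ _ _ _ hc => h'.no_middleTheta_of_full hq ?_ hc
    unfold NewEdge at he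
    grind
  · exact fun _ _ _ _ _ _ hc => h'.no_punctured_of_full hq hmem hc

/-- The reply in a position without threats: it destroys a configuration that the move has created,
if there is one, and otherwise restores the cherry condition at the new edge. -/
theorem Played.reply_of_no_threat (h : Played A L A₁ L₁ u v)
    (hnt : ∀ p q b c, ¬ Threat A₁ L₁ p q b c) :
    (∃ x y, L₁ x y ∧ Inv A₁ (Without L₁ x y)) ∨ Inv A₁ L₁ := by
  by_cases hdb : ∃ p q b c a, PendantDiamond A₁ L₁ p q b c a
  · obtain ⟨p, q, b, c, a, hc⟩ := hdb
    obtain ⟨p, q, b, c, a, hc, he⟩ := h.pendantDiamond_cases hc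
    exact Or.inl ⟨p, a, hc.2.2.2.2.2.2.2.1, hc.inv h hnt he⟩
  by_cases hdk : ∃ p q a b c, PolarTheta A₁ L₁ p q a b c
  · obtain ⟨p, q, b, c, a, hc⟩ := hdk
    push Not at hdb
    obtain ⟨q, b, c, hc | hc⟩ := h.polarTheta_cases hc
    · exact Or.inl ⟨u, q, hc.2.2.2.2.2.2.1, hc.inv h hnt hdb⟩
    · exact Or.inl ⟨v, q, hc.2.2.2.2.2.2.1, hc.inv h.symm hnt hdb⟩
  by_cases hx : ∃ p a q q' b c, PuncturedBipartite A₁ L₁ p a q q' b c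
  · obtain ⟨p, a, q, q', b, c, hc⟩ := hx
    push Not at hdb hdk
    obtain ⟨p, a, q, q', b, c, hc, he⟩ := h.punctured_cases hc
    exact Or.inl ⟨p, q, hc.2.2.2.2.2.2.2.2.2.2.2.1, hc.inv h hnt hdb hdk he⟩
  by_cases ht : ∃ p q a b c, MiddleTheta A₁ L₁ p q a b c
  · obtain ⟨p, q, a, b, c, hc⟩ := ht
    push Not at hdb hdk hx
    obtain ⟨p, q, a, b, c, hc, ⟨rfl, rfl⟩ | ⟨rfl, rfl⟩⟩ := h.middleTheta_cases hc
    · exact Or.inl ⟨a, b, hc.2.2.2.2.2.2.2.1, hc.inv h hnt hdb hdk hx⟩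
    · exact Or.inl ⟨a, b, hc.2.2.2.2.2.2.2.1, hc.inv h.symm hnt hdb hdk hx⟩
  by_cases hcp : ∃ p q b c a, PendantSquare A₁ L₁ p q b c a
  · obtain ⟨p, q, b, c, a, hc⟩ := hcp
    push Not at hdb hdk hx ht
    obtain ⟨p, q, b, c, a, hc, he⟩ := h.pendantSquare_cases hc
    exact Or.inl (hc.inv h hnt hdb hdk hx ht he)
  by_cases hq2 : ∃ p q c b a, Bull A₁ L₁ p q c b a
  · obtain ⟨p, q, c, b, a, hc⟩ := hq2
    push Not at hdb hdk hx ht hcp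
    obtain ⟨p, q, c, b, a, hc, he⟩ := h.bull_cases hc
    exact Or.inl (hc.inv h hnt hdb hdk hx ht hcp he)
  push Not at hdb hdk hx ht hcp hq2
  by_cases hg : ∃ z, A₁ u z ∧ L₁ v z
  · obtain ⟨z, h1, h2⟩ := hg
    refine Or.inl ⟨v, z, h2, h.inv_of_cherry hnt h1 h2 ?_ ?_ ?_ ?_ ?_ ?_⟩
    · exact fun _ _ _ _ _ hc => hdb _ _ _ _ _ (hc.mono Without.le)
    · exact fun _ _ _ _ _ hc => hcp _ _ _ _ _ (hc.mono Without.le)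
    · exact fun _ _ _ _ _ hc => hq2 _ _ _ _ _ (hc.mono Without.le)
    · exact fun _ _ _ _ _ hc => hdk _ _ _ _ _ (hc.mono Without.le)
    · exact fun _ _ _ _ _ hc => ht _ _ _ _ _ (hc.mono Without.le)
    · exact fun _ _ _ _ _ _ hc => hx _ _ _ _ _ _ (hc.mono Without.le)
  by_cases hg' : ∃ z, A₁ v z ∧ L₁ u z
  · obtain ⟨z, h1, h2⟩ := hg'
    refine Or.inl ⟨u, z, h2, h.symm.inv_of_cherry hnt h1 h2 ?_ ?_ ?_ ?_ ?_ ?_⟩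
    · exact fun _ _ _ _ _ hc => hdb _ _ _ _ _ (hc.mono Without.le)
    · exact fun _ _ _ _ _ hc => hcp _ _ _ _ _ (hc.mono Without.le)
    · exact fun _ _ _ _ _ hc => hq2 _ _ _ _ _ (hc.mono Without.le)
    · exact fun _ _ _ _ _ hc => hdk _ _ _ _ _ (hc.mono Without.le)
    · exact fun _ _ _ _ _ hc => ht _ _ _ _ _ (hc.mono Without.le)
    · exact fun _ _ _ _ _ _ hc => hx _ _ _ _ _ _ (hc.mono Without.le)
  push Not at hg hg'
  exact Or.inr (h.inv_of_no_cherry hnt (fun z hz _ => hg z hz) (fun z hz _ => hg' z hz) hdb hcp hq2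
    hdk ht hx)

/-! ### Answering a threat of `K₄` -/

/-- The new edge `uv` is the central edge of a diamond with tips `x`, `y` that may be joined. -/
def BaseThreat (A L₁ : V → V → Prop) (u v x y : V) : Prop :=
  A u x ∧ A u y ∧ A v x ∧ A v y ∧ L₁ x y

/-- The new edge `uv` is a side edge of a diamond with central edge `uw` whose tips `v`, `x` may be
joined. -/
def SideThreat (A L₁ : V → V → Prop) (u v w x : V) : Prop :=
  A u w ∧ A v w ∧ A u x ∧ A w x ∧ L₁ v x

/-- Every threat after the move is a diamond containing the new edge as central edge or as side
edge. -/
theorem Played.threat_cases (h : Played A L A₁ L₁ u v) {p q b c : V} (ht : Threat A₁ L₁ p q b c) :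
    BaseThreat A L₁ u v b c ∨ (∃ w z, SideThreat A L₁ u v w z ∧ NewEdge v z b c) ∨
      (∃ w z, SideThreat A L₁ v u w z ∧ NewEdge u z b c) := by
  have side : ∀ {p q b c : V}, NewEdge u v p b → A₁ p q → A₁ p c → A₁ q b → A₁ q c → L₁ b c →
      (∃ w z, SideThreat A L₁ u v w z ∧ NewEdge v z b c) ∨
      (∃ w z, SideThreat A L₁ v u w z ∧ NewEdge u z b c) := by
    intro p q b c he h1 h2 h3 h4 h5
    have hn := h.b₁.ne
    have hn' := h.b₁.lne
    have hs := h.b.symm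
    have o := fun x y hxy => h.old_of_ne (x := x) (y := y) hxy
    have o1 := o _ _ h1
    have o2 := o _ _ h2
    have o3 := o _ _ h3
    have o4 := o _ _ h4
    rcases he with ⟨rfl, rfl⟩ | ⟨rfl, rfl⟩
    · refine Or.inl ⟨q, c, ⟨?_, ?_, ?_, ?_, h5⟩, Or.inl ⟨rfl, rfl⟩⟩
      all_goals grind
    · refine Or.inr ⟨q, c, ⟨?_, ?_, ?_, ?_, h5⟩, Or.inl ⟨rfl, rfl⟩⟩
      all_goals grind
  obtain ⟨h1, h2, h3, h4, h5, l⟩ := ht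
  have hs := h.b.symm
  have hs1 := h.b₁.symm
  have hls := h.b₁.lsymm
  rcases (h.adj _ _).1 h2 with o2 | o
  swap; · exact Or.inr (side o h1 h3 h4 h5 l)
  rcases (h.adj _ _).1 h3 with o3 | o
  swap
  · rcases side o h1 h2 h5 h4 (hls _ _ l) with ⟨w, z, h', h''⟩ | ⟨w, z, h', h''⟩
    · exact Or.inr (Or.inl ⟨w, z, h', h''.swap⟩)
    · exact Or.inr (Or.inr ⟨w, z, h', h''.swap⟩)
  rcases (h.adj _ _).1 h4 with o4 | o
  swap; · exact Or.inr (side o (hs1 _ _ h1) h5 h2 h3 l)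
  rcases (h.adj _ _).1 h5 with o5 | o
  swap
  · rcases side o (hs1 _ _ h1) h4 h3 h2 (hls _ _ l) with ⟨w, z, h', h''⟩ | ⟨w, z, h', h''⟩
    · exact Or.inr (Or.inl ⟨w, z, h', h''.swap⟩)
    · exact Or.inr (Or.inr ⟨w, z, h', h''.swap⟩)
  rcases (h.adj _ _).1 h1 with o1 | o
  · exact absurd ⟨o1, o2, o3, o4, o5, h.le _ _ l⟩ (h.inv.threat p q b c)
  · left
    rcases o with ⟨rfl, rfl⟩ | ⟨rfl, rfl⟩
    · exact ⟨o2, o3, o4, o5, l⟩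
    · exact ⟨o4, o5, o2, o3, l⟩

/-- There is at most one threat with the new edge as central edge: two of them would form a polar
theta without the new edge. -/
theorem BaseThreat.unique (h : Played A L A₁ L₁ u v) {x y x' y' : V}
    (h1 : BaseThreat A L₁ u v x y) (h2 : BaseThreat A (Without L₁ x y) u v x' y') : False := by
  obtain ⟨a1, a2, a3, a4, l⟩ := h1
  obtain ⟨b1, b2, b3, b4, m⟩ := h2
  have hk := h.inv.polarTheta u v
  have hls := h.b.lsymm
  have d := h.b.le_three _ _ h.huv
  have d1 := d x y x' y' a1 a2 b1 b2
  have hle := h.le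
  have hn := h.b₁.lne
  have l0 := h.huv
  have k1 := hk x y x'
  have k2 := hk x y y'
  have k3 := hk y x x'
  have k4 := hk y x y'
  unfold PolarTheta at *
  unfold Without at *
  grind

/-- The two kinds of threats do not occur together, by the cherry condition at a tip of the diamond.
-/
theorem BaseThreat.no_side (h : Played A L A₁ L₁ u v) {x y w z : V}
    (h1 : BaseThreat A L₁ u v x y) (h2 : SideThreat A L₁ u v w z) : False := by
  obtain ⟨a1, a2, a3, a4, l⟩ := h1
  obtain ⟨b1, b2, b3, b4, m⟩ := h2
  have hls := h.b.lsymm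
  have hs := h.b.symm
  have hle := h.le
  have hn := h.b₁.lne
  have hna := h.b.notAdj
  have l0 := h.huv
  have d := h.b.le_three _ _ h.huv x y z w a1 a2 b3 b1
  have dx := h.b.le_three _ _ (hle _ _ l)
  have dy := h.b.le_three _ _ (hls _ _ (hle _ _ l))
  have d2 := (h.symm.atMostTwo_of_new m).exact a3 a4 (hn _ _ l)
  have k1 := h.inv.cherry x u v
  have k2 := h.inv.cherry y u v
  unfold Guard at *
  have hx := dx u v z
  have hy := dy u v z
  have hn0 := h.b.ne
  have hw : w = x ∨ w = y := by grind
  have du : ∀ t, A u t → t = x ∨ t = y ∨ t = z :=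
    exact_three h.b h.huv a1 a2 b3 (hn _ _ l) (by grind) (by grind)
  rcases hw with rfl | rfl
  · clear k2 hy
    grind
  · clear k1 hx
    grind

/-- All side threats in which `v` is a tip ask for the same pair `vx`: otherwise there was a pendant
diamond before the move. -/
theorem SideThreat.unique (h : Played A L A₁ L₁ u v) {w x w' x' : V}
    (h1 : SideThreat A L₁ u v w x) (h2 : SideThreat A L₁ u v w' x') : x = x' := by
  obtain ⟨a1, a2, a3, a4, l⟩ := h1
  obtain ⟨b1, b2, b3, b4, m⟩ := h2
  by_contra hxx
  have hls := h.b.lsymm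
  have hs := h.b.symm
  have hle := h.le
  have hn := h.b.ne
  have hna := h.b.notAdj
  have l0 := h.huv
  have d := h.b.le_three _ _ h.huv w x x' w' a1 a3 b3 b1
  have k := h.inv.pendantDiamond u w x x' v
  have d2 := (h.symm.atMostTwo_of_new m)
  unfold PendantDiamond at k
  grind

/-- The move does not create threats at both of its ends, by the cherry condition at the common
vertex `w`. -/
theorem SideThreat.opposite (h : Played A L A₁ L₁ u v) {w x w' x' : V}
    (h1 : SideThreat A L₁ u v w x) (h2 : SideThreat A L₁ v u w' x') : False := by
  obtain ⟨a1, a2, a3, a4, l⟩ := h1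
  obtain ⟨b1, b2, b3, b4, m⟩ := h2
  have hls := h.b.lsymm
  have hs := h.b.symm
  have hle := h.le
  have hn := h.b.ne
  have hna := h.b.notAdj
  have l0 := h.huv
  have d1 := (h.symm.atMostTwo_of_new l).exact b1 b3 (hn _ _ b4)
  have d2 := (h.atMostTwo_of_new m).exact a1 a3 (hn _ _ a4)
  have hw : w' = w := by grind
  subst hw
  have huv := h.b.lne _ _ l0
  have ew := exact_four h.b (hs _ _ a1) (hs _ _ a2) a4 b4 huv (by grind) (by grind) (by grind)
    (by grind) (by grind)
  have k := h.inv.cherry w' u v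
  unfold Guard at k
  grind

theorem BaseThreat.no_threat (h : Played A L A₁ L₁ u v) {x y : V}
    (h1 : BaseThreat A L₁ u v x y) : ∀ p q b c, ¬ Threat A₁ (Without L₁ x y) p q b c := by
  intro p q b c ht
  rcases (h.mono_legal x y).threat_cases ht with h2 | ⟨w, z, h2, -⟩ | ⟨w, z, h2, -⟩
  · exact h1.unique h h2
  · exact h1.no_side h ⟨h2.1, h2.2.1, h2.2.2.1, h2.2.2.2.1, h2.2.2.2.2.1⟩
  · have h3 : BaseThreat A L₁ v u x y := ⟨h1.2.2.1, h1.2.2.2.1, h1.1, h1.2.1, h1.2.2.2.2⟩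
    exact h3.no_side h.symm ⟨h2.1, h2.2.1, h2.2.2.1, h2.2.2.2.1, h2.2.2.2.2.1⟩

theorem SideThreat.no_threat (h : Played A L A₁ L₁ u v) {w x : V}
    (h1 : SideThreat A L₁ u v w x) : ∀ p q b c, ¬ Threat A₁ (Without L₁ v x) p q b c := by
  intro p q b c ht
  rcases (h.mono_legal v x).threat_cases ht with h2 | ⟨w', z, h2, -⟩ | ⟨w', z, h2, -⟩
  · have h3 : BaseThreat A L₁ u v b c := ⟨h2.1, h2.2.1, h2.2.2.1, h2.2.2.2.1, h2.2.2.2.2.1⟩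
    exact h3.no_side h h1
  · have h3 : SideThreat A L₁ u v w' z := ⟨h2.1, h2.2.1, h2.2.2.1, h2.2.2.2.1, h2.2.2.2.2.1⟩
    have := h1.unique h h3
    subst this
    exact h2.2.2.2.2.2 (Or.inl ⟨rfl, rfl⟩)
  · exact h1.opposite h ⟨h2.1, h2.2.1, h2.2.2.1, h2.2.2.2.1, h2.2.2.2.2.1⟩

/-- If the new edge lies in a triangle, then it does not belong to a pendant square. -/
theorem Played.no_pendantSquare_of_triangle (h : Played A L A₁ L₁ u v) {z : V} (h1 : A₁ z u)
    (h2 : A₁ z v)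
    {P Q B C α : V} (h2 : PendantSquare A₁ L₁ P Q B C α) : False := by
  obtain ⟨P, Q, B, C, α, h2, he'⟩ := h.pendantSquare_cases h2
  obtain ⟨a1, a2, a3, a4, a5, m1, m2, m3, m4, m5, c1, c2⟩ := h2
  have hs1 := h.b₁.symm
  have hls := h.b₁.lsymm
  have hn' := h.b₁.lne
  have hn := h.b₁.ne
  have hna := h.b₁.notAdj
  have f1 := c1.exact a1 a2 (hn' _ _ m2)
  have f2 := h.exact (hls _ _ m1) a3 a4 a5 (hn' _ _ m4) (hn' _ _ m5) (hn' _ _ m2)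
  unfold NewEdge at he'
  grind

theorem Played.no_polarTheta_of_triangle (h : Played A L A₁ L₁ u v)
    (hnt : ∀ p q b c, ¬ Threat A₁ L₁ p q b c) {z : V} (h1 : A₁ z u) (h2 : A₁ z v)
    {P Q B C α : V} (h2 : PolarTheta A₁ L₁ P Q α B C) :
    False := by
  have key : ∀ {u v q b c : V}, Played A L A₁ L₁ u v → A₁ z u → A₁ z v →
    NewPolarTheta A L₁ u v q b c → False := by
    intro u v q b c h h1 h2 h3
    obtain ⟨-, -, e1, -⟩ := h3.exact h
    obtain ⟨a1, a2, a3, a4, a5, hbc, a6, a7⟩ := h3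
    have hn := h.b₁.ne
    have hs := h.b₁.symm
    have k1 := hnt v b u q
    have k2 := hnt v c u q
    have hof := fun x y (hxy : A x y) => h.of_adj hxy
    have huv := h.new
    unfold Threat at k1 k2
    grind
  obtain ⟨Q, b, c, h3 | h3⟩ := h.polarTheta_cases h2
  · exact key h h1 ‹_› h3
  · exact key h.symm ‹_› h1 h3

theorem Played.no_middleTheta_of_triangle (h : Played A L A₁ L₁ u v) {z : V} (h1 : A₁ z u)
    (h2 : A₁ z v)
    {P Q B C α : V} (h2 : MiddleTheta A₁ L₁ P Q α B C) :
    False := by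
  obtain ⟨P, Q, α, B, C, h2, he'⟩ := h.middleTheta_cases h2
  obtain ⟨a1, a2, a3, a4, a5, a6, m1, m2, m3, m4, c1, c2⟩ := h2
  have hs1 := h.b₁.symm
  have hls := h.b₁.lsymm
  have hn' := h.b₁.lne
  have hn := h.b₁.ne
  have hna := h.b₁.notAdj
  have f1 := c1 α B C z
  unfold NewEdge at he'
  grind

theorem Played.no_punctured_of_triangle (h : Played A L A₁ L₁ u v) {z : V} (h1 : A₁ z u)
    (h2 : A₁ z v)
    {P Q Q' B C α : V} (h2 : PuncturedBipartite A₁ L₁ P α Q Q' B C) :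
    False := by
  obtain ⟨P, α, Q, Q', B, C, h2, he'⟩ := h.punctured_cases h2
  obtain ⟨e1, e2, e3, e4, e5, e6⟩ := h2.exact h
  obtain ⟨a1, a2, a3, a4, a5, a6, a7, a8, m1, m2, m3, m4, m5, m6, m7, c1, c2⟩ := h2
  have hs1 := h.b₁.symm
  have hls := h.b₁.lsymm
  have hn' := h.b₁.lne
  have hn := h.b₁.ne
  have hna := h.b₁.notAdj
  unfold NewEdge at he'
  grind

/-- If the new edge lies in two triangles, then it does not belong to a bull. -/
theorem Played.no_bull_of_two_triangles (h : Played A L A₁ L₁ u v) {z w : V} (h1 : A₁ u z)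
    (h2 : A₁ v z) (h3 : A₁ u w) (h4 : A₁ v w) (hzw : z ≠ w)
    {P Q B C α : V} (h2 : Bull A₁ L₁ P Q C B α) : False := by
  obtain ⟨P, Q, C, B, α, h2, he'⟩ := h.bull_cases h2
  obtain ⟨f1, f2⟩ := h2.exact h
  obtain ⟨a1, a2, a3, a4, a5, m1, m2, m3, m4, m5, c1, c2⟩ := h2
  have hs1 := h.b₁.symm
  have hls := h.b₁.lsymm
  have hn' := h.b₁.lne
  have hn := h.b₁.ne
  have hna := h.b₁.notAdj
  unfold NewEdge at he'
  grind

/-- If the new edge is a side edge of a diamond, then it does not belong to a bull. -/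
theorem Played.no_bull_of_side (h : Played A L A₁ L₁ u v) {w x : V} (h1 : A₁ u w)
    (h2 : A₁ v w) (h3 : A₁ u x) (h4 : A₁ w x) (hvx : v ≠ x)
    {P Q B C α : V} (h2 : Bull A₁ L₁ P Q C B α) : False := by
  obtain ⟨P, Q, C, B, α, h2, he'⟩ := h.bull_cases h2
  obtain ⟨f1, f2⟩ := h2.exact h
  obtain ⟨a1, a2, a3, a4, a5, m1, m2, m3, m4, m5, c1, c2⟩ := h2
  have hs1 := h.b₁.symm
  have hls := h.b₁.lsymm
  have hn' := h.b₁.lne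
  have hn := h.b₁.ne
  have hna := h.b₁.notAdj
  have f3 := c2 u v w
  unfold NewEdge at he'
  grind

/-- After the reply to a threat at the central edge no pendant diamond is left. -/
theorem BaseThreat.no_pendantDiamond (h : Played A L A₁ L₁ u v) {x y : V}
    (h1 : BaseThreat A L₁ u v x y)
    {P Q B C α : V} (h2 : PendantDiamond A₁ (Without L₁ x y) P Q B C α) : False := by
  obtain ⟨P, Q, B, C, α, h2, he'⟩ := (h.mono_legal x y).pendantDiamond_cases h2
  obtain ⟨a1, a2, a3, a4, a5, a6, n2, m1, m2, m3, c1⟩ := h2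
  obtain ⟨t1, t2, t3, t4, t5⟩ := h1
  have hs1 := h.b₁.symm
  have hls := h.b₁.lsymm
  have hn' := h.b₁.lne
  have hn := h.b₁.ne
  have hna := h.b₁.notAdj
  have hof := fun x y (hxy : A x y) => h.of_adj hxy
  have e3 := exact_three h.b₁ m1.1 a1 a2 a3 (hn _ _ a4) (hn _ _ a5) n2
  have e4 := exact_four h.b₁ (hs1 _ _ a1) a4 a5 a6 (hn _ _ a2) (hn _ _ a3) (hn' _ _ m1.1) n2
    (hn' _ _ m2.1).symm
    (hn' _ _ m3.1).symm
  have hbc := h.k4 P Q B C a1 a2 a3 a4 a5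
  unfold Without at *
  unfold NewEdge at he'
  rcases he' with (⟨rfl, rfl⟩ | ⟨rfl, rfl⟩) | (⟨rfl, rfl⟩ | ⟨rfl, rfl⟩) | (⟨rfl, rfl⟩ | ⟨rfl,
    rfl⟩) | (⟨rfl, rfl⟩ | ⟨rfl, rfl⟩)
  · have o2 := h.old_of_ne a2 (by grind) (by grind)
    have o3 := h.old_of_ne a3 (by grind) (by grind)
    have o4 := h.old_of_ne a4 (by grind) (by grind)
    have o5 := h.old_of_ne a5 (by grind) (by grind)
    have o6 := h.old_of_ne a6 (by grind) (by grind)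
    have lbc : L₁ B C := by grind
    exact h.inv.pendantSquare P Q B C α ⟨o2, o3, o6, o4, o5, h.huv, h.le _ _ lbc, h.le _ _ m1.1,
      h.le _ _ m2.1, h.le _ _ m3.1, h.atMostTwo_of_new m1.1, h.atMostTwo c1⟩
  · have o2 := h.old_of_ne a2 (by grind) (by grind)
    have o3 := h.old_of_ne a3 (by grind) (by grind)
    have o4 := h.old_of_ne a4 (by grind) (by grind)
    have o5 := h.old_of_ne a5 (by grind) (by grind)
    have o6 := h.old_of_ne a6 (by grind) (by grind)
    have lbc : L₁ B C := by grind
    exact h.inv.pendantSquare P Q B C α ⟨o2, o3, o6, o4, o5, h.b.lsymm _ _ h.huv, h.le _ _ lbc,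
      h.le _ _ m1.1,
      h.le _ _ m2.1, h.le _ _ m3.1, h.symm.atMostTwo_of_new m1.1, h.atMostTwo c1⟩
  · grind
  · grind
  · grind
  · grind
  · grind
  · grind

theorem SideThreat.no_pendantDiamond (h : Played A L A₁ L₁ u v) {w x : V}
    (h1 : SideThreat A L₁ u v w x)
    {P Q B C α : V} (h2 : PendantDiamond A₁ (Without L₁ v x) P Q B C α) : False := by
  obtain ⟨P, Q, B, C, α, h2, he'⟩ := (h.mono_legal v x).pendantDiamond_cases h2
  obtain ⟨a1, a2, a3, a4, a5, a6, n2, m1, m2, m3, c1⟩ := h2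
  obtain ⟨t1, t2, t3, t4, t5⟩ := h1
  have hs1 := h.b₁.symm
  have hls := h.b₁.lsymm
  have hn' := h.b₁.lne
  have hn := h.b₁.ne
  have hna := h.b₁.notAdj
  have hof := fun x y (hxy : A x y) => h.of_adj hxy
  have e3 := exact_three h.b₁ m1.1 a1 a2 a3 (hn _ _ a4) (hn _ _ a5) n2
  have e4 := exact_four h.b₁ (hs1 _ _ a1) a4 a5 a6 (hn _ _ a2) (hn _ _ a3) (hn' _ _ m1.1) n2
    (hn' _ _ m2.1).symm
    (hn' _ _ m3.1).symm
  have hbc := h.k4 P Q B C a1 a2 a3 a4 a5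
  unfold Without at *
  unfold NewEdge at he'
  rcases he' with (⟨rfl, rfl⟩ | ⟨rfl, rfl⟩) | (⟨rfl, rfl⟩ | ⟨rfl, rfl⟩) | (⟨rfl, rfl⟩ | ⟨rfl,
    rfl⟩) | (⟨rfl, rfl⟩ | ⟨rfl, rfl⟩)
  · grind
  · grind
  · have o1 := h.old_of_ne (hs1 _ _ a1) (by grind) (by grind)
    have o4 := h.old_of_ne a4 (by grind) (by grind)
    have o5 := h.old_of_ne a5 (by grind) (by grind)
    have o6 := h.old_of_ne a6 (by grind) (by grind)
    have o3 := h.old_of_ne a3 (by grind) (by grind)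
    have lbc : L₁ B C := by grind
    obtain ⟨s, t, k1, k2, k3, k4, k5⟩ := h.inv.full Q P B C α o1 o4 o5 o6 (hn _ _ a2) (hn _ _ a3)
      (hn' _ _ m1.1) n2 (hn' _ _ m2.1).symm (hn' _ _ m3.1).symm
    have l0 := h.huv
    have hle := h.le
    have hls0 := h.b.lsymm
    have hs0 := h.b.symm
    have f1 := e4 s (hof _ _ k1)
    have f2 := e4 t (hof _ _ k2)
    grind
  · grind
  · have o1 := h.old_of_ne a1 (by grind) (by grind)
    have o2 := h.old_of_ne a2 (by grind) (by grind)
    have o5 := h.old_of_ne a5 (by grind) (by grind)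
    have o6 := h.old_of_ne a6 (by grind) (by grind)
    have o3 := h.old_of_ne a3 (by grind) (by grind)
    have lbc : L₁ B C := by grind
    exact h.inv.bull P Q C B α ⟨o1, o3, o5, o2, o6, h.huv, h.le _ _ m1.1, h.le _ _ m2.1,
      h.le _ _ m3.1,
      h.le _ _ lbc, h.atMostTwo c1, h.symm.atMostTwo_of_new (hls _ _ m2.1)⟩
  · grind
  · grind
  · grind

/-- After the reply to a threat at the central edge `uv`, an edge `us` whose end `s` may be joined
to `v` is guarded: the vertex `u` has full degree, so any further neighbour of `s` is a guard; and
if there is none, then `x` or `y` is a guard, as there was no pendant square. -/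
theorem BaseThreat.guard (h : Played A L A₁ L₁ u v) {x y s : V} (h1 : BaseThreat A L₁ u v x y)
    (hus : A₁ u s) (hvs : Without L₁ x y v s) : Guard A₁ (Without L₁ x y) u s := by
  have hnt := h1.no_threat h
  obtain ⟨t1, t2, t3, t4, t5⟩ := h1
  have hs1 := h.b₁.symm
  have hls := h.b₁.lsymm
  have hn' := h.b₁.lne
  have hn := h.b₁.ne
  have hna := h.b₁.notAdj
  have hof := fun x y (hxy : A x y) => h.of_adj hxy
  have huv := h.new
  have nuv := hn _ _ huv
  have nxv := hn _ _ (hof _ _ t3)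
  have nyv := hn _ _ (hof _ _ t4)
  have nsx : s ≠ x := by
    rintro rfl
    exact hna _ _ hvs.1 (hof _ _ t3)
  have nsy : s ≠ y := by
    rintro rfl
    exact hna _ _ hvs.1 (hof _ _ t4)
  have hus0 := h.old_of_ne hus (Or.inr (hn' _ _ hvs.1).symm) (Or.inl nuv)
  have hf : ∀ z, ¬ L₁ u z := fun z hz => not_atMostThree huv (hof _ _ t1) (hof _ _ t2) hus nxv nyv
    (hn' _ _ hvs.1) (hn' _ _ t5) nsx.symm nsy.symm (h.b₁.le_three _ _ hz)
  have e := exact_four h.b₁ huv (hof _ _ t1) (hof _ _ t2) hus nxv nyv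
    (hn' _ _ hvs.1) (hn' _ _ t5) nsx.symm nsy.symm
  have hsx : ¬ A₁ s x := fun hsx => hnt u x v s ⟨hof _ _ t1, huv, hus, hs1 _ _ (hof _ _ t3),
    hs1 _ _ hsx, hvs⟩
  have hsy : ¬ A₁ s y := fun hsy => hnt u y v s ⟨hof _ _ t2, huv, hus, hs1 _ _ (hof _ _ t4),
    hs1 _ _ hsy, hvs⟩
  have hl' : ∀ z, ¬ Without L₁ x y u z := fun z hz => hf z hz.1
  by_cases hsz : ∃ z, A₁ s z ∧ z ≠ u
  · obtain ⟨z, h2, h3⟩ := hsz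
    refine ⟨z, Or.inr ⟨h2, h3, fun h4 => ?_, hl' z⟩⟩
    have := hna _ _ (hls _ _ hvs.1)
    have := h.b₁.ne s s
    grind
  · push Not at hsz
    by_cases h2 : L₁ s x ∧ L₁ s y
    · exfalso
      refine h.inv.pendantSquare v u x y s ⟨t3, t4, hus0, t1, t2, h.b.lsymm _ _ h.huv, h.le _ _ t5,
        h.le _ _ hvs.1,
        h.le _ _ h2.1, h.le _ _ h2.2, h.symm.atMostTwo_of_new hvs.1, ?_⟩
      intro a b c ha hb _
      left
      rw [hsz a (hof _ _ ha), hsz b (hof _ _ hb)]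
    · by_cases h3 : L₁ s x
      · exact ⟨y, Or.inl ⟨hof _ _ t2, nsy.symm, hsy, fun h4 => h2 ⟨h3, h4.1⟩⟩⟩
      · exact ⟨x, Or.inl ⟨hof _ _ t1, nsx.symm, hsx, fun h4 => h3 h4.1⟩⟩

/-- The forced reply to a threat with the new edge as central edge restores the invariant. -/
theorem BaseThreat.inv (h : Played A L A₁ L₁ u v) {x y : V} (h1 : BaseThreat A L₁ u v x y) :
    Inv A₁ (Without L₁ x y) := by
  have hnt := h1.no_threat h
  have h' := h.mono_legal x y
  have h2 : BaseThreat A L₁ v u x y := ⟨h1.2.2.1, h1.2.2.2.1, h1.1, h1.2.1, h1.2.2.2.2⟩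
  obtain ⟨t1, t2, t3, t4, t5⟩ := id h1
  have hs1 := h.b₁.symm
  have hls := h'.b₁.lsymm
  have hne := h.b₁.lne _ _ t5
  have hn := h.b₁.ne
  have hof := fun x y (hxy : A x y) => h.of_adj hxy
  have hxy : ¬ A₁ x y := h.b₁.notAdj _ _ t5
  have hl : ¬ Without L₁ x y x y := fun h' => h'.2 (Or.inl ⟨rfl, rfl⟩)
  refine ⟨h.k4, hnt, ?_, ?_, fun P Q B C α hc => h1.no_pendantDiamond h hc,
    fun P Q B C α hc => h'.no_pendantSquare_of_triangle (hs1 _ _ (hof _ _ t1)) (hs1 _ _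
      (hof _ _ t3)) hc,
    fun P Q B C α hc => h'.no_bull_of_two_triangles (hof _ _ t1) (hof _ _ t3) (hof _ _ t2)
      (hof _ _ t4)
      hne hc,
    fun P Q B C α hc => h'.no_polarTheta_of_triangle hnt (hs1 _ _ (hof _ _ t1)) (hs1 _ _
      (hof _ _ t3)) hc,
    fun P Q B C α hc => h'.no_middleTheta_of_triangle (hs1 _ _ (hof _ _ t1)) (hs1 _ _
      (hof _ _ t3)) hc,
    fun P α Q Q' B C hc => h'.no_punctured_of_triangle (hs1 _ _ (hof _ _ t1)) (hs1 _ _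
      (hof _ _ t3)) hc⟩
  · intro a b c hab hac hbc
    by_cases o1 : A a b
    · by_cases o2 : A a c
      · rcases h.inv.cherry a b c o1 o2 (h.le _ _ hbc.1) with hg | hg
        · exact Or.inl (hg.mono h')
        · exact Or.inr (hg.mono h')
      · left
        rcases (h.adj a c).1 hac with o | ⟨rfl, rfl⟩ | ⟨rfl, rfl⟩
        · contradiction
        · exact h1.guard h hab (hls _ _ hbc)
        · exact h2.guard h.symm hab (hls _ _ hbc)
    · right
      rcases (h.adj a b).1 hab with o | ⟨rfl, rfl⟩ | ⟨rfl, rfl⟩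
      · contradiction
      · exact h1.guard h hac hbc
      · exact h2.guard h.symm hac hbc
  · intro q
    by_cases h3 : q = u
    · subst h3
      exact fun _ _ _ _ _ _ _ _ _ _ _ _ _ _ => ⟨x, y, hof _ _ t1, hof _ _ t2, hne, hxy, hl⟩
    by_cases h4 : q = v
    · subst h4
      exact fun _ _ _ _ _ _ _ _ _ _ _ _ _ _ => ⟨x, y, hof _ _ t3, hof _ _ t4, hne, hxy, hl⟩
    exact h'.full h3 h4

/-- The forced reply to a threat with the new edge as side edge restores the invariant. -/
theorem SideThreat.inv (h : Played A L A₁ L₁ u v) {w x : V} (h1 : SideThreat A L₁ u v w x) :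
    Inv A₁ (Without L₁ v x) := by
  have hnt := h1.no_threat h
  obtain ⟨t1, t2, t3, t4, t5⟩ := id h1
  have hs1 := h.b₁.symm
  have hof := fun x y (hxy : A x y) => h.of_adj hxy
  have h' := h.mono_legal v x
  have huv := h.new
  have h3 : A₁ v u := hs1 _ _ huv
  have h4 : ¬ Without L₁ v x v x := fun h5 => h5.2 (Or.inl ⟨rfl, rfl⟩)
  have h5 := h.b₁.lne _ _ t5
  have h6 := h.b₁.notAdj _ _ t5
  refine h'.inv_of hnt (Or.inl ⟨x, Or.inl ⟨hof _ _ t3, h5.symm, h6, h4⟩⟩)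
    (fun _ _ _ _ _ _ _ _ _ _ _ _ _ _ => ⟨v, x, huv, hof _ _ t3, h5, h6, h4⟩)
    (fullSplit_of_atMostThree (h.b₁.le_three _ _ t5))
    (fun P Q B C α hc => h1.no_pendantDiamond h hc)
    (fun P Q B C α hc => h'.no_pendantSquare_of_triangle (hs1 _ _ (hof _ _ t1)) (hs1 _ _
      (hof _ _ t2)) hc)
    (fun P Q B C α hc => h'.no_bull_of_side (hof _ _ t1) (hof _ _ t2) (hof _ _ t3)
      (hof _ _ t4) h5 hc)
    (fun P Q B C α hc => h'.no_polarTheta_of_triangle hnt (hs1 _ _ (hof _ _ t1)) (hs1 _ _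
      (hof _ _ t2)) hc)
    (fun P Q B C α hc => h'.no_middleTheta_of_triangle (hs1 _ _ (hof _ _ t1)) (hs1 _ _
      (hof _ _ t2)) hc)
    (fun P α Q Q' B C hc => h'.no_punctured_of_triangle (hs1 _ _ (hof _ _ t1)) (hs1 _ _
      (hof _ _ t2)) hc)

/-- After every move Blocker can restore the part of the invariant that concerns `K₄`, possibly
without using his move. -/
theorem Played.reply (h : Played A L A₁ L₁ u v) :
    (∃ x y, L₁ x y ∧ Inv A₁ (Without L₁ x y)) ∨ Inv A₁ L₁ := by
  by_cases hnt : ∀ p q b c, ¬ Threat A₁ L₁ p q b c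
  · exact h.reply_of_no_threat hnt
  push Not at hnt
  obtain ⟨p, q, b, c, ht⟩ := hnt
  left
  rcases h.threat_cases ht with h1 | ⟨w, z, h1, -⟩ | ⟨w, z, h1, -⟩
  · exact ⟨b, c, h1.2.2.2.2, h1.inv h⟩
  · exact ⟨v, z, h1.2.2.2.2, h1.inv h⟩
  · exact ⟨u, z, h1.2.2.2.2, h1.inv h.symm⟩

/-! ### Octahedra -/

/-- An octahedron with antipodal pairs `xx'`, `yy'`, `zz'`, whose edge `xy` is not yet claimed but
legal. -/
structure OctThreat (A L : V → V → Prop) (x x' y y' z z' : V) : Prop where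
  e1 : A x y'
  e2 : A x z
  e3 : A x z'
  e4 : A x' y
  e5 : A x' y'
  e6 : A x' z
  e7 : A x' z'
  e8 : A y z
  e9 : A y z'
  e10 : A y' z
  e11 : A y' z'
  nx : x ≠ x'
  ny : y ≠ y'
  nz : z ≠ z'
  l : L x y

/-- An octahedron with antipodal pairs `xx'`, `yy'`, `zz'`; the edge `xy` is required through the
last relation of `OctThreat`. -/
def Octahedron (A : V → V → Prop) (x x' y y' z z' : V) : Prop :=
  OctThreat A A x x' y y' z z'

/-- The six vertices of an octahedron without the edge `xy` form a connected component of
Constructor's graph, described by `S`, in which `xy` is the only legal pair. -/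
structure OctComp (A L : V → V → Prop) (x x' y y' z z' : V) (S : V → Prop) : Prop where
  mem : ∀ w, S w ↔ w = x ∨ w = x' ∨ w = y ∨ w = y' ∨ w = z ∨ w = z'
  closed : ∀ w t, S w → A w t → S t
  legal : ∀ w t, S w → S t → L w t → (w = x ∧ t = y) ∨ (w = y ∧ t = x)
  full : ∀ w, S w → w = x ∨ w = y ∨ (∀ t, ¬ L w t) ∧ ¬ AtMostThree A w
  split : ∀ w, S w → FullSplit A L w

theorem OctThreat.comp (h : Board A L) {x x' y y' z z' : V} (ho : OctThreat A L x x' y y' z z') :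
    ∃ S, OctComp A L x x' y y' z z' S := by
  obtain ⟨e1, e2, e3, e4, e5, e6, e7, e8, e9, e10, e11, nx, ny, nz, l⟩ := ho
  have hs := h.symm
  have hn := h.ne
  have hls := h.lsymm
  have hn' := h.lne
  have f1 := exact_three h l e1 e2 e3 (hn _ _ e10) (hn _ _ e11) nz
  have f2 := exact_three h (hls _ _ l) (hs _ _ e4) e8 e9 (hn _ _ e6) (hn _ _ e7) nz
  have f3 := exact_four h e4 e5 e6 e7 ny (hn _ _ e8) (hn _ _ e9) (hn _ _ e10) (hn _ _ e11) nz
  have f4 := exact_four h (hs _ _ e1) (hs _ _ e5) e10 e11 nx (hn _ _ e2) (hn _ _ e3) (hn _ _ e6)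
    (hn _ _ e7) nz
  have f5 := exact_four h (hs _ _ e2) (hs _ _ e6) (hs _ _ e8) (hs _ _ e10) nx (hn' _ _ l)
    (hn _ _ e1)
    (hn _ _ e4) (hn _ _ e5) ny
  have f6 := exact_four h (hs _ _ e3) (hs _ _ e7) (hs _ _ e9) (hs _ _ e11) nx (hn' _ _ l)
    (hn _ _ e1)
    (hn _ _ e4) (hn _ _ e5) ny
  have g3 := not_atMostThree e4 e5 e6 e7 ny (hn _ _ e8) (hn _ _ e9) (hn _ _ e10) (hn _ _ e11) nz
  have g4 := not_atMostThree (hs _ _ e1) (hs _ _ e5) e10 e11 nx (hn _ _ e2) (hn _ _ e3) (hn _ _ e6)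
    (hn _ _ e7) nz
  have g5 := not_atMostThree (hs _ _ e2) (hs _ _ e6) (hs _ _ e8) (hs _ _ e10) nx (hn' _ _ l)
    (hn _ _ e1)
    (hn _ _ e4) (hn _ _ e5) ny
  have g6 := not_atMostThree (hs _ _ e3) (hs _ _ e7) (hs _ _ e9) (hs _ _ e11) nx (hn' _ _ l)
    (hn _ _ e1)
    (hn _ _ e4) (hn _ _ e5) ny
  have k3 : ∀ t, ¬ L x' t := fun t ht => g3 (h.le_three _ _ ht)
  have k4 : ∀ t, ¬ L y' t := fun t ht => g4 (h.le_three _ _ ht)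
  have k5 : ∀ t, ¬ L z t := fun t ht => g5 (h.le_three _ _ ht)
  have k6 : ∀ t, ¬ L z' t := fun t ht => g6 (h.le_three _ _ ht)
  have m1 : ¬ A z z' := by grind
  have m2 : ¬ A x x' := by grind
  refine ⟨fun w => w = x ∨ w = x' ∨ w = y ∨ w = y' ∨ w = z ∨ w = z', fun w => Iff.rfl, ?_, ?_, ?_,
    ?_⟩
  · grind
  · grind
  · grind
  · rintro w (rfl | rfl | rfl | rfl | rfl | rfl)
    · exact fullSplit_of_atMostThree (h.le_three _ _ l)
    · exact fun _ _ _ _ _ _ _ _ _ _ _ _ _ _ => ⟨z, z', e6, e7, nz, m1, k5 _⟩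
    · exact fullSplit_of_atMostThree (h.le_three _ _ (hls _ _ l))
    · exact fun _ _ _ _ _ _ _ _ _ _ _ _ _ _ => ⟨z, z', e10, e11, nz, m1, k5 _⟩
    · exact fun _ _ _ _ _ _ _ _ _ _ _ _ _ _ => ⟨x, x', hs _ _ e2, hs _ _ e6, nx, m2,
        fun hl => k3 _ (hls _ _ hl)⟩
    · exact fun _ _ _ _ _ _ _ _ _ _ _ _ _ _ => ⟨x, x', hs _ _ e3, hs _ _ e7, nx, m2,
        fun hl => k3 _ (hls _ _ hl)⟩

/-- No octahedron is completed, since no octahedron lacked exactly one edge before the move. -/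
theorem Played.no_octahedron (h : Played A L A₁ L₁ u v)
    (hno : ∀ x x' y y' z z', ¬ OctThreat A L x x' y y' z z')
    (hno' : ∀ x x' y y' z z', ¬ Octahedron A x x' y y' z z') :
    ∀ x x' y y' z z', ¬ Octahedron A₁ x x' y y' z z' := by
  have key : ∀ {x x' y y' z z' : V}, OctThreat A₁ A₁ x x' y y' z z' → NewEdge u v x y → False := by
    rintro x x' y y' z z' ⟨e1, e2, e3, e4, e5, e6, e7, e8, e9, e10, e11, nx, ny, nz, l⟩ he
    have hn := h.b₁.ne
    have hl : L x y := by
      rcases he with ⟨rfl, rfl⟩ | ⟨rfl, rfl⟩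
      · exact h.huv
      · exact h.b.lsymm _ _ h.huv
    have h1 := hn _ _ l
    have h2 := hn _ _ e1
    have h3 := hn _ _ e2
    have h4 := hn _ _ e3
    have h5 := hn _ _ e4
    have h6 := hn _ _ e8
    have h7 := hn _ _ e9
    have o := fun a b hab => h.old_of_ne (x := a) (y := b) hab
    refine hno x x' y y' z z' ⟨o _ _ e1 ?_ ?_, o _ _ e2 ?_ ?_, o _ _ e3 ?_ ?_, o _ _ e4 ?_ ?_,
      o _ _ e5 ?_ ?_, o _ _ e6 ?_ ?_, o _ _ e7 ?_ ?_, o _ _ e8 ?_ ?_, o _ _ e9 ?_ ?_,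
      o _ _ e10 ?_ ?_, o _ _ e11 ?_ ?_, nx, ny, nz, hl⟩
    all_goals
      rcases he with ⟨rfl, rfl⟩ | ⟨rfl, rfl⟩
      · clear e1 e2 e3 e4 e5 e6 e7 e8 e9 e10 e11 l hn o
        grind
      · clear e1 e2 e3 e4 e5 e6 e7 e8 e9 e10 e11 l hn o
        grind
  intro x x' y y' z z' ho
  obtain ⟨e1, e2, e3, e4, e5, e6, e7, e8, e9, e10, e11, nx, ny, nz, l⟩ := id ho
  have s := h.b₁.symm
  have ad := fun a b => (h.adj a b).1
  rcases ad _ _ e1 with o1 | o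
  swap; · exact key ⟨l, e2, e3, e5, e4, e6, e7, e10, e11, e8, e9, nx, ny.symm, nz, e1⟩ o
  rcases ad _ _ e2 with o2 | o
  swap; · exact key ⟨e3, l, e1, e6, e7, e4, e5, s _ _ e8, s _ _ e10, s _ _ e9, s _ _ e11, nx, nz,
            ny, e2⟩ o
  rcases ad _ _ e3 with o3 | o
  swap; · exact key ⟨e2, l, e1, e7, e6, e4, e5, s _ _ e9, s _ _ e11, s _ _ e8, s _ _ e10, nx,
            nz.symm, ny, e3⟩ o
  rcases ad _ _ e4 with o4 | o
  swap; · exact key ⟨e5, e6, e7, l, e1, e2, e3, e8, e9, e10, e11, nx.symm, ny, nz, e4⟩ o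
  rcases ad _ _ e5 with o5 | o
  swap; · exact key ⟨e4, e6, e7, e1, l, e2, e3, e10, e11, e8, e9, nx.symm, ny.symm, nz, e5⟩ o
  rcases ad _ _ e6 with o6 | o
  swap; · exact key ⟨e7, e4, e5, e2, e3, l, e1, s _ _ e8, s _ _ e10, s _ _ e9, s _ _ e11, nx.symm,
            nz, ny, e6⟩ o
  rcases ad _ _ e7 with o7 | o
  swap; · exact key ⟨e6, e4, e5, e3, e2, l, e1, s _ _ e9, s _ _ e11, s _ _ e8, s _ _ e10, nx.symm,
            nz.symm, ny, e7⟩ o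
  rcases ad _ _ e8 with o8 | o
  swap; · exact key ⟨e9, s _ _ l, s _ _ e4, e10, e11, s _ _ e1, s _ _ e5, s _ _ e2, s _ _ e6,
            s _ _ e3, s _ _ e7, ny, nz, nx, e8⟩ o
  rcases ad _ _ e9 with o9 | o
  swap; · exact key ⟨e8, s _ _ l, s _ _ e4, e11, e10, s _ _ e1, s _ _ e5, s _ _ e3, s _ _ e7,
            s _ _ e2, s _ _ e6, ny, nz.symm, nx, e9⟩ o
  rcases ad _ _ e10 with o10 | o
  swap; · exact key ⟨e11, s _ _ e1, s _ _ e5, e8, e9, s _ _ l, s _ _ e4, s _ _ e2, s _ _ e6,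
            s _ _ e3, s _ _ e7, ny.symm, nz, nx, e10⟩ o
  rcases ad _ _ e11 with o11 | o
  swap; · exact key ⟨e10, s _ _ e1, s _ _ e5, e9, e8, s _ _ l, s _ _ e4, s _ _ e3, s _ _ e7,
            s _ _ e2, s _ _ e6, ny.symm, nz.symm, nx, e11⟩ o
  rcases ad _ _ l with o12 | o
  swap; · exact key ho o
  exact hno' _ _ _ _ _ _ ⟨o1, o2, o3, o4, o5, o6, o7, o8, o9, o10, o11, nx, ny, nz, o12⟩

/-- The octahedron threatened after the move lies in the component of the new edge. -/
theorem OctThreat.located (h : Played A L A₁ L₁ u v)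
    (hno : ∀ x x' y y' z z', ¬ OctThreat A L x x' y y' z z') {x x' y y' z z' : V}
    (ho : OctThreat A₁ L₁ x x' y y' z z') {S : V → Prop} (hS : ∀ w t, S w → A₁ w t → S t)
    (hu : S u) : S x ∧ S y := by
  obtain ⟨e1, e2, e3, e4, e5, e6, e7, e8, e9, e10, e11, nx, ny, nz, l⟩ := id ho
  have hv := hS _ _ hu h.new
  have hs := h.b₁.symm
  by_contra hc
  have key : ∀ a b, A₁ a b → ¬ S a → A a b := by
    intro a b h1 h2
    rcases (h.adj a b).1 h1 with h3 | ⟨rfl, rfl⟩ | ⟨rfl, rfl⟩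
    · exact h3
    · contradiction
    · contradiction
  have hs0 := h.b.symm
  have hx : ¬ S x := by grind
  have hx' : ¬ S x' := by grind
  have hy : ¬ S y := by grind
  have hy' : ¬ S y' := by grind
  exact hno x x' y y' z z' ⟨key _ _ e1 hx, key _ _ e2 hx, key _ _ e3 hx, key _ _ e4 hx',
    key _ _ e5 hx', key _ _ e6 hx', key _ _ e7 hx', key _ _ e8 hy, key _ _ e9 hy, key _ _ e10 hy',
    key _ _ e11 hy', nx, ny, nz, h.le _ _ l⟩

/-- The new edge belongs to the component of the threatened octahedron. -/
theorem OctThreat.mem (h : Played A L A₁ L₁ u v)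
    (hno : ∀ x x' y y' z z', ¬ OctThreat A L x x' y y' z z') {x x' y y' z z' : V}
    (ho : OctThreat A₁ L₁ x x' y y' z z') {S : V → Prop} (hS : OctComp A₁ L₁ x x' y y' z z' S) :
    S u := by
  obtain ⟨e1, e2, e3, e4, e5, e6, e7, e8, e9, e10, e11, nx, ny, nz, l⟩ := id ho
  by_contra hu
  have key : ∀ a b, A₁ a b → S a → S b → A a b := by
    intro a b h1 h2 h3
    rcases (h.adj a b).1 h1 with h4 | ⟨rfl, rfl⟩ | ⟨rfl, rfl⟩
    · exact h4
    · contradiction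
    · contradiction
  have hm := hS.mem
  have h1 := (hm x).2 (by simp)
  have h2 := (hm x').2 (by simp)
  have h3 := (hm y).2 (by simp)
  have h4 := (hm y').2 (by simp)
  have h5 := (hm z).2 (by simp)
  have h6 := (hm z').2 (by simp)
  exact hno x x' y y' z z' ⟨key _ _ e1 h1 h4, key _ _ e2 h1 h5, key _ _ e3 h1 h6, key _ _ e4 h2 h3,
    key _ _ e5 h2 h4, key _ _ e6 h2 h5, key _ _ e7 h2 h6, key _ _ e8 h3 h5, key _ _ e9 h3 h6,
    key _ _ e10 h4 h5, key _ _ e11 h4 h6, nx, ny, nz, h.le _ _ l⟩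

/-- Claiming the missing edge of an octahedron is a good reply: no legal pair is left in the
component of the new edge, and every configuration, threat or cherry that the move could have
created needs one. -/
theorem OctThreat.inv (h : Played A L A₁ L₁ u v)
    (hno : ∀ x x' y y' z z', ¬ OctThreat A L x x' y y' z z') {x x' y y' z z' : V}
    (ho : OctThreat A₁ L₁ x x' y y' z z') :
    Inv A₁ (Without L₁ x y) ∧ ∀ a a' b b' c c', ¬ OctThreat A₁ (Without L₁ x y) a a' b b' c c' := by
  obtain ⟨S, hS⟩ := ho.comp h.b₁
  have hu := ho.mem h hno hS
  have hv := hS.closed _ _ hu h.new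
  have h' := h.mono_legal x y
  have hl : ∀ a b, S a → S b → ¬ Without L₁ x y a b := fun a b ha hb hab =>
    hab.2 (hS.legal a b ha hb hab.1)
  have hnew : ∀ a b, NewEdge u v a b → S a ∧ S b := by
    rintro a b (⟨rfl, rfl⟩ | ⟨rfl, rfl⟩)
    · exact ⟨hu, hv⟩
    · exact ⟨hv, hu⟩
  have hcl := hS.closed
  have hs1 := h.b₁.symm
  have hfull : ∃ q, (∀ t, ¬ Without L₁ x y q t) ∧ (q = u ∨ q = v) ∧ ¬ AtMostThree A₁ q := by
    have huv := h.new
    have hna := h.b₁.notAdj _ _ ho.l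
    have hn := h.b₁.ne _ _ huv
    rcases hS.full u hu with h1 | h1 | ⟨h1, h1'⟩
    · rcases hS.full v hv with h2 | h2 | ⟨h2, h2'⟩
      · grind
      · grind
      · exact ⟨v, fun t ht => h2 t ht.1, Or.inr rfl, h2'⟩
    · rcases hS.full v hv with h2 | h2 | ⟨h2, h2'⟩
      · grind
      · grind
      · exact ⟨v, fun t ht => h2 t ht.1, Or.inr rfl, h2'⟩
    · exact ⟨u, fun t ht => h1 t ht.1, Or.inl rfl, h1'⟩
  obtain ⟨q, hq, hquv, hq3⟩ := hfull
  have hquv' : q = u ∨ q = v ∨ (A₁ q u ∧ A₁ q v) := by tauto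
  have hfo : ∀ w, S w → FullSplit A₁ (Without L₁ x y) w := by
    intro w hw a b c d ha hb hc hd h1 h2 h3 h4 h5 h6
    obtain ⟨s, t, k1, k2, k3, k4, k5⟩ := hS.split w hw a b c d ha hb hc hd h1 h2 h3 h4 h5 h6
    exact ⟨s, t, k1, k2, k3, k4, fun k => k5 k.1⟩
  refine ⟨h'.inv_of ?_ (Or.inr ⟨fun z hz _ => hl _ _ hv (hcl _ _ hu hz),
    fun z hz _ => hl _ _ hu (hcl _ _ hv hz)⟩) (hfo u hu) (hfo v hv) ?_
    (fun _ _ _ _ _ hc => h'.no_pendantSquare_of_full hq hquv' hc)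
    (fun _ _ _ _ _ hc => h'.no_bull_of_full hq (by tauto) hc)
    (fun _ _ _ _ _ hc => h'.no_polarTheta_of_full hq hquv' hc)
    (fun _ _ _ _ _ hc => h'.no_middleTheta_of_full hq (Or.inr ⟨hquv, hq3⟩) hc)
    (fun _ _ _ _ _ _ hc => h'.no_punctured_of_full hq hquv' hc), ?_⟩
  · intro p q b c ht
    rcases h'.threat_cases ht with h1 | ⟨w, z, h1, -⟩ | ⟨w, z, h1, -⟩
    · exact hl b c (hcl _ _ hu (h.of_adj h1.1)) (hcl _ _ hu (h.of_adj h1.2.1)) h1.2.2.2.2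
    · exact hl v z hv (hcl _ _ hu (h.of_adj h1.2.2.1)) h1.2.2.2.2
    · exact hl u z hu (hcl _ _ hv (h.of_adj h1.2.2.1)) h1.2.2.2.2
  · intro P Q B C α hc
    obtain ⟨P, Q, B, C, α, hc, he⟩ := h'.pendantDiamond_cases hc
    obtain ⟨a1, a2, a3, a4, a5, a6, n2, m1, m2, m3, c1⟩ := hc
    have hPQ : S Q := by
      rcases he with he | he | he | he
      · exact (hnew _ _ he).2
      · exact hcl _ _ (hnew _ _ he).1 a1
      · exact (hnew _ _ he).1
      · exact (hnew _ _ he).1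
    exact hl _ _ (hcl _ _ hPQ (hs1 _ _ a1)) (hcl _ _ hPQ a6) m1
  · intro a a' b b' c c' hc
    obtain ⟨h1, h2⟩ := OctThreat.located h' hno hc hcl hu
    exact hl _ _ h1 h2 hc.l

/-- Blocker's invariant: no `K₄` and no octahedron is present or can be completed by one edge, and
the configurations that lead to two threats of `K₄` are absent. -/
structure Safe (A L : V → V → Prop) : Prop where
  inv : Inv A L
  oct : ∀ x x' y y' z z', ¬ OctThreat A L x x' y y' z z'
  no_oct : ∀ x x' y y' z z', ¬ Octahedron A x x' y y' z z'

theorem OctThreat.mono (hle : ∀ x y, L' x y → L x y) {x x' y y' z z' : V}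
    (ho : OctThreat A L' x x' y y' z z') : OctThreat A L x x' y y' z z' := by
  obtain ⟨e1, e2, e3, e4, e5, e6, e7, e8, e9, e10, e11, nx, ny, nz, l⟩ := ho
  exact ⟨e1, e2, e3, e4, e5, e6, e7, e8, e9, e10, e11, nx, ny, nz, hle _ _ l⟩

/-- After every move Blocker can restore the invariant, possibly without using his move. -/
theorem Played.safe_reply (h : Played A L A₁ L₁ u v) (hs : Safe A L) :
    (∃ x y, L₁ x y ∧ Safe A₁ (Without L₁ x y)) ∨ Safe A₁ L₁ := by
  have hno := h.no_octahedron hs.oct hs.no_oct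
  by_cases ho : ∀ x x' y y' z z', ¬ OctThreat A₁ L₁ x x' y y' z z'
  · rcases h.reply with ⟨x, y, hl, hi⟩ | hi
    · exact Or.inl ⟨x, y, hl, hi, fun _ _ _ _ _ _ hc => ho _ _ _ _ _ _ (hc.mono Without.le), hno⟩
    · exact Or.inr ⟨hi, ho, hno⟩
  · push Not at ho
    obtain ⟨x, x', y, y', z, z', ho⟩ := ho
    obtain ⟨h1, h2⟩ := ho.inv h hs.oct
    exact Or.inl ⟨x, y, ho.l, h1, h2, hno⟩

end Invariant

/-! ### Vertices lying in many triangles -/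

section Discharging

variable {V : Type*} [Fintype V] {A : V → V → Prop} [DecidableRel A]

/-- The neighbours of `v`, as a finite set. -/
def nbrs (A : V → V → Prop) [DecidableRel A] (v : V) : Finset V := Finset.univ.filter (A v)

/-- The ordered pairs `(a, b)` such that `v, a, b` is a triangle. -/
def wedge (A : V → V → Prop) [DecidableRel A] (v : V) : Finset (V × V) :=
  (nbrs A v ×ˢ nbrs A v).filter fun p => A p.1 p.2

theorem mem_nbrs {v w : V} : w ∈ nbrs A v ↔ A v w := by simp [nbrs]

theorem mem_wedge {v : V} {p : V × V} : p ∈ wedge A v ↔ A v p.1 ∧ A v p.2 ∧ A p.1 p.2 := by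
  simp [wedge, mem_nbrs, and_assoc]

/-- The properties of Constructor's graph that Blocker's strategy ensures: maximum degree at most
four, no `K₄` and no octahedron. -/
structure Sparse (A : V → V → Prop) [DecidableRel A] : Prop where
  symm : ∀ x y, A x y → A y x
  ne : ∀ x y, A x y → x ≠ y
  deg : ∀ v, (nbrs A v).card ≤ 4
  k4 : ∀ p q b c, A p q → A p b → A p c → A q b → A q c → ¬ A b c
  oct : ∀ x x' y y' z z', ¬ Octahedron A x x' y y' z z'

theorem Sparse.exact [DecidableEq V] (h : Sparse A) {v a b c d : V} (ha : A v a) (hb : A v b)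
    (hc : A v c)
    (hd : A v d) (h1 : a ≠ b) (h2 : a ≠ c) (h3 : a ≠ d) (h4 : b ≠ c) (h5 : b ≠ d) (h6 : c ≠ d) :
    ∀ w, A v w → w = a ∨ w = b ∨ w = c ∨ w = d := by
  have hs : ({a, b, c, d} : Finset V) ⊆ nbrs A v := by
    intro x hx
    simp only [Finset.mem_insert, Finset.mem_singleton] at hx
    rw [mem_nbrs]
    rcases hx with rfl | rfl | rfl | rfl <;> assumption
  have hc : ({a, b, c, d} : Finset V).card = 4 := by
    rw [Finset.card_insert_of_notMem (by simp [*]), Finset.card_insert_of_notMem (by simp [*]),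
      Finset.card_insert_of_notMem (by simp [*]), Finset.card_singleton]
  have he := Finset.eq_of_subset_of_card_le hs (by rw [hc]; exact h.deg v)
  intro w hw
  have := mem_nbrs.2 hw
  rw [← he] at this
  simpa using this

/-- The neighbourhood of `v` contains the induced four-cycle `a b c d`; in a graph of maximum degree
four it equals it. -/
structure Wheel (A : V → V → Prop) (v a b c d : V) : Prop where
  va : A v a
  vb : A v b
  vc : A v c
  vd : A v d
  ab : A a b
  bc : A b c
  cd : A c d
  da : A d a
  ac : ¬ A a c
  bd : ¬ A b d
  nac : a ≠ c
  nbd : b ≠ d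

theorem Wheel.rot (h : Sparse A) {v a b c d : V} (hw : Wheel A v a b c d) :
    Wheel A v b c d a :=
  ⟨hw.vb, hw.vc, hw.vd, hw.va, hw.bc, hw.cd, hw.da, hw.ab, hw.bd, fun h' => hw.ac (h.symm _ _ h'),
    hw.nbd, hw.nac.symm⟩

theorem card_wedge_le [DecidableEq V] (h : Sparse A) {v : V} (hv : (nbrs A v).card ≤ 3) :
    (wedge A v).card ≤ 6 := by
  have h1 : wedge A v ⊆ (nbrs A v).offDiag := by
    intro p hp
    rw [mem_wedge] at hp
    rw [Finset.mem_offDiag, mem_nbrs, mem_nbrs]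
    exact ⟨hp.1, hp.2.1, h.ne _ _ hp.2.2⟩
  have h2 := Finset.card_le_card h1
  rw [Finset.offDiag_card] at h2
  have : (nbrs A v).card * (nbrs A v).card - (nbrs A v).card ≤ 6 := by
    interval_cases (nbrs A v).card <;> simp
  omega

/-- A vertex lies in at most three triangles (six ordered pairs), or else its neighbourhood is a
four-cycle and it lies in four. -/
theorem wheel_or_le [DecidableEq V] (h : Sparse A) (v : V) :
    (wedge A v).card ≤ 6 ∨ (wedge A v).card ≤ 8 ∧ ∃ a b c d, Wheel A v a b c d := by
  by_cases hv : (nbrs A v).card ≤ 3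
  · exact Or.inl (card_wedge_le h hv)
  have hv4 : (nbrs A v).card = 4 := le_antisymm (h.deg v) (by omega)
  obtain ⟨a, ha⟩ : (nbrs A v).Nonempty := by
    rw [← Finset.card_pos]; omega
  obtain ⟨b, c, d, hbc, hbd, hcd, he⟩ := Finset.card_eq_three.1
    (show ((nbrs A v).erase a).card = 3 by rw [Finset.card_erase_of_mem ha, hv4])
  have hN : nbrs A v = {a, b, c, d} := by rw [← Finset.insert_erase ha, he]
  have hab : a ≠ b := by
    rintro rfl
    have : a ∈ (nbrs A v).erase a := by rw [he]; simp
    simp at this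
  have hac : a ≠ c := by
    rintro rfl
    have : a ∈ (nbrs A v).erase a := by rw [he]; simp
    simp at this
  have had : a ≠ d := by
    rintro rfl
    have : a ∈ (nbrs A v).erase a := by rw [he]; simp
    simp at this
  have hA : A v a ∧ A v b ∧ A v c ∧ A v d := by
    simp only [← mem_nbrs, hN]
    simp
  obtain ⟨va, vb, vc, vd⟩ := hA
  have hirr : ∀ x, ¬ A x x := fun x hx => h.ne _ _ hx rfl
  have hsy : ∀ x y, A x y ↔ A y x := fun x y => ⟨h.symm _ _, h.symm _ _⟩
  have na : a ∉ ({b, c, d} : Finset V) := by simp [*]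
  have nb : b ∉ ({c, d} : Finset V) := by simp [*]
  have nc : c ∉ ({d} : Finset V) := by simp [*]
  have hcard : (wedge A v).card = 2 * ((decide (A a b)).toNat + (decide (A a c)).toNat +
      (decide (A a d)).toNat + (decide (A b c)).toNat + (decide (A b d)).toNat +
      (decide (A c d)).toNat) := by
    rw [wedge, Finset.card_filter, Finset.sum_product, hN]
    simp only [Finset.sum_insert na, Finset.sum_insert nb, Finset.sum_insert nc,
      Finset.sum_singleton, hirr, hsy b a, hsy c a, hsy d a, hsy c b, hsy d b, hsy d c, if_false,
      Bool.toNat, Bool.cond_decide]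
    ring
  have k1 := h.k4 v a b c va vb vc
  have k2 := h.k4 v a b d va vb vd
  have k3 := h.k4 v a c d va vc vd
  have k4 := h.k4 v b c d vb vc vd
  have key : ∀ p q r s t u : Bool, (p → q → ¬ s) → (p → r → ¬ t) → (q → r → ¬ u) →
      (s → t → ¬ u) → 2 * (p.toNat + q.toNat + r.toNat + s.toNat + t.toNat + u.toNat) ≤ 6 ∨
      2 * (p.toNat + q.toNat + r.toNat + s.toNat + t.toNat + u.toNat) ≤ 8 ∧
      (p ∧ s ∧ u ∧ r ∧ ¬ q ∧ ¬ t ∨ p ∧ t ∧ u ∧ q ∧ ¬ r ∧ ¬ s ∨ q ∧ s ∧ t ∧ r ∧ ¬ p ∧ ¬ u) := by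
    intro p q r s t u
    cases p <;> cases q <;> cases r <;> cases s <;> cases t <;> cases u <;> simp
  rw [hcard]
  have := key (A a b) (A a c) (A a d) (A b c) (A b d) (A c d)
  simp only [decide_eq_true_eq] at this
  rcases this k1 k2 k3 k4 with h0 | ⟨h0, ⟨h1, h2, h3, h4, h5, h6⟩ | ⟨h1, h2, h3, h4, h5, h6⟩ |
    ⟨h1, h2, h3, h4, h5, h6⟩⟩
  · exact Or.inl h0
  · exact Or.inr ⟨h0, a, b, c, d, va, vb, vc, vd, h1, h2, h3, h.symm _ _ h4, h5, h6, hac, hbd⟩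
  · exact Or.inr ⟨h0, a, b, d, c, va, vb, vd, vc, h1, h2, h.symm _ _ h3, h.symm _ _ h4, h5, h6,
      had, hbc⟩
  · exact Or.inr ⟨h0, a, c, b, d, va, vc, vb, vd, h1, h.symm _ _ h2, h3, h.symm _ _ h4, h5, h6,
      hab, hcd⟩

end Discharging

/-! ### Discharging: at most as many triangles as vertices -/

section Tokens

variable {V : Type*} [Fintype V] {A : V → V → Prop} [DecidableRel A]

/-- A vertex lying in at least four triangles (each gives two ordered pairs); by `Rich.wheel` its
neighbourhood is a four-cycle. -/
def Rich (A : V → V → Prop) [DecidableRel A] (v : V) : Prop := 7 ≤ (wedge A v).card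

/-- A vertex lying in at most two triangles (each gives two ordered pairs). -/
def Poor (A : V → V → Prop) [DecidableRel A] (v : V) : Prop := (wedge A v).card ≤ 4

/-- The rich vertex `v` may use the token `(u, a, b)`, an ordered triangle at the vertex `u`: either
`v` is one of `a`, `b`, or neither `a` nor `b` is rich, and `v` forms a triangle with `ab` and is
not adjacent to `u`. -/
def Uses (A : V → V → Prop) [DecidableRel A] (v : V) (s : V × V × V) : Prop :=
  Rich A v ∧ (v = s.2.1 ∨ v = s.2.2 ∨ (¬ Rich A s.2.1 ∧ ¬ Rich A s.2.2 ∧ v ≠ s.1 ∧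
    A v s.2.1 ∧ A v s.2.2 ∧ ¬ A v s.1))

variable [DecidableEq V]

theorem Wheel.nbr (h : Sparse A) {v a b c d : V} (hw : Wheel A v a b c d) :
    ∀ w, A v w → w = a ∨ w = b ∨ w = c ∨ w = d :=
  h.exact hw.va hw.vb hw.vc hw.vd (h.ne _ _ hw.ab) hw.nac (h.ne _ _ hw.da).symm
    (h.ne _ _ hw.bc) hw.nbd (h.ne _ _ hw.cd)

theorem Rich.wheel (h : Sparse A) {v : V} (hv : Rich A v) : ∃ a b c d, Wheel A v a b c d := by
  rcases wheel_or_le h v with h' | ⟨-, h'⟩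
  · exact absurd hv (by simp only [Rich]; omega)
  · exact h'

/-- Every neighbour of a rich vertex `v` forms triangles with at least two others at `v`. -/
theorem Rich.two (h : Sparse A) {v : V} (hv : Rich A v) {p : V} (hp : A v p) :
    ∃ q r, A v q ∧ A v r ∧ A p q ∧ A p r ∧ q ≠ r := by
  obtain ⟨a, b, c, d, hw⟩ := hv.wheel h
  have hs := h.symm
  rcases hw.nbr h p hp with rfl | rfl | rfl | rfl
  · exact ⟨b, d, hw.vb, hw.vd, hw.ab, hs _ _ hw.da, hw.nbd⟩
  · exact ⟨a, c, hw.va, hw.vc, hs _ _ hw.ab, hw.bc, hw.nac⟩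
  · exact ⟨b, d, hw.vb, hw.vd, hs _ _ hw.bc, hw.cd, hw.nbd⟩
  · exact ⟨a, c, hw.va, hw.vc, hw.da, hs _ _ hw.cd, hw.nac⟩

/-- If the rim vertex `a` lies in more than two triangles, then one of its rim edges forms a
triangle with a vertex outside the wheel. -/
theorem Wheel.exists_cap (h : Sparse A) {v a b c d : V} (hw : Wheel A v a b c d)
    (ha : ¬ Poor A a) : ∃ y, A a y ∧ y ≠ v ∧ y ≠ b ∧ y ≠ d ∧ (A y b ∨ A y d) := by
  by_contra! hno
  apply ha
  have hsub : wedge A a ⊆ {(v, b), (b, v), (v, d), (d, v)} := by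
    rintro ⟨p, q⟩ hp
    rw [mem_wedge] at hp
    obtain ⟨h1, h2, h3⟩ := hp
    have hN := hw.nbr h
    have hs := h.symm
    have hne := h.ne
    have := hw.ac
    have := hw.bd
    have := hno p h1
    have := hno q h2
    simp only [Finset.mem_insert, Finset.mem_singleton, Prod.mk.injEq]
    simp only at h1 h2 h3
    have h4 : p = v ∨ p = b ∨ p = d ∨ q = v ∨ q = b ∨ q = d := by
      by_contra! hc
      have := h.exact (hs _ _ hw.va) hw.ab (hs _ _ hw.da) h1 (hne _ _ hw.vb) (hne _ _ hw.vd)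
        hc.1.symm hw.nbd hc.2.1.symm hc.2.2.1.symm q h2
      have := hne _ _ h3
      grind
    have := hs _ _ h3
    have := hN p
    have := hN q
    have := hne _ _ h1
    have := hne _ _ h2
    have : p = v → A v q := fun h' => h' ▸ h3
    have : q = v → A v p := fun h' => h' ▸ hs _ _ h3
    grind
  exact (Finset.card_le_card hsub).trans Finset.card_le_four

/-- If the edge `ab` meets no other edge inside the neighbourhood of `y`, then that neighbourhood
contains at most one further edge, and `y` lies in at most two triangles. -/
theorem poor_of_isolated_edge (h : Sparse A) {y a b : V} (ha : A y a) (hb : A y b) (hab : a ≠ b)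
    (h1 : ∀ w, A y w → A a w → w = b) (h2 : ∀ w, A y w → A b w → w = a) : Poor A y := by
  have hcard : (((nbrs A y).erase a).erase b).card ≤ 2 := by
    rw [Finset.card_erase_of_mem, Finset.card_erase_of_mem (mem_nbrs.2 ha)]
    · have := h.deg y
      omega
    · simp [mem_nbrs, hb, hab.symm]
  have hsub : wedge A y ⊆ {(a, b), (b, a)} ∪ (((nbrs A y).erase a).erase b).offDiag := by
    rintro ⟨p, q⟩ hp
    rw [mem_wedge] at hp
    obtain ⟨h3, h4, h5⟩ := hp
    have := h.ne _ _ h5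
    have := h.symm _ _ h5
    simp only [Finset.mem_union, Finset.mem_insert, Finset.mem_singleton, Prod.mk.injEq,
      Finset.mem_offDiag, Finset.mem_erase, mem_nbrs]
    simp only at h3 h4 h5
    grind
  have h6 := (Finset.card_le_card hsub).trans (Finset.card_union_le _ _)
  rw [Finset.offDiag_card] at h6
  have h7 : ({(a, b), (b, a)} : Finset (V × V)).card ≤ 2 := Finset.card_le_two
  have h8 : ∀ k : ℕ, k ≤ 2 → k * k - k ≤ 2 := by
    intro k hk
    interval_cases k <;> simp
  have := h8 _ hcard
  simp only [Poor]
  omega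

/-- Every token at a poor vertex is used by at most one rich vertex. -/
theorem Uses.unique (h : Sparse A) {v v' u a b : V} (hu : Poor A u) (hua : A u a) (hub : A u b)
    (hab : A a b) (h1 : Uses A v (u, a, b)) (h2 : Uses A v' (u, a, b)) : v = v' := by
  have hs := h.symm
  have hne := h.ne
  have key : Rich A a → Rich A b → False := by
    intro ra rb
    obtain ⟨c, hc⟩ : ∃ c, A a c ∧ A u c ∧ c ≠ b := by
      obtain ⟨q, r, h3, h4, h5, h6, h7⟩ := ra.two h (hs _ _ hua)
      by_cases hq : q = b
      · exact ⟨r, h4, h6, fun hr => h7 (hq.trans hr.symm)⟩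
      · exact ⟨q, h3, h5, hq⟩
    obtain ⟨d, hd⟩ : ∃ d, A b d ∧ A u d ∧ d ≠ a := by
      obtain ⟨q, r, h3, h4, h5, h6, h7⟩ := rb.two h (hs _ _ hub)
      by_cases hq : q = a
      · exact ⟨r, h4, h6, fun hr => h7 (hq.trans hr.symm)⟩
      · exact ⟨q, h3, h5, hq⟩
    have hcd : c ≠ d := by
      rintro rfl
      exact h.k4 u a b c hua hub hc.2.1 hab hc.1 hd.1
    have hsub : ({(a, b), (b, a), (a, c), (c, a), (b, d)} : Finset (V × V)) ⊆ wedge A u := by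
      intro p hp
      simp only [Finset.mem_insert, Finset.mem_singleton] at hp
      rw [mem_wedge]
      rcases hp with rfl | rfl | rfl | rfl | rfl
      · exact ⟨hua, hub, hab⟩
      · exact ⟨hub, hua, hs _ _ hab⟩
      · exact ⟨hua, hc.2.1, hc.1⟩
      · exact ⟨hc.2.1, hua, hs _ _ hc.1⟩
      · exact ⟨hub, hd.2.1, hd.1⟩
    have h5 := Finset.card_le_card hsub
    have n1 := hne _ _ hab
    have n2 := hne _ _ hc.1
    have n3 := hc.2.2
    have n4 := hd.2.2
    rw [Finset.card_insert_of_notMem, Finset.card_insert_of_notMem, Finset.card_insert_of_notMem,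
      Finset.card_insert_of_notMem, Finset.card_singleton] at h5
    · simp only [Poor] at hu
      omega
    all_goals
      simp only [Finset.mem_insert, Finset.mem_singleton, Prod.mk.injEq]
      grind
  obtain ⟨r, h1⟩ := h1
  obtain ⟨r', h2⟩ := h2
  simp only at h1 h2
  rcases h1 with rfl | rfl | ⟨h11, h12, h13, h14, h15, h16⟩
  · rcases h2 with h2 | rfl | ⟨h21, h22, h23, h24, h25, h26⟩
    · exact h2.symm
    · exact (key r r').elim
    · exact absurd r h21
  · rcases h2 with rfl | h2 | ⟨h21, h22, h23, h24, h25, h26⟩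
    · exact (key r' r).elim
    · exact h2.symm
    · exact absurd r h22
  · rcases h2 with rfl | rfl | ⟨h21, h22, h23, h24, h25, h26⟩
    · exact absurd r' h11
    · exact absurd r' h12
    by_contra hvv
    have hN := h.exact (hs _ _ h14) (hs _ _ h24) hab (hs _ _ hua) hvv (hne _ _ h15) h13
      (hne _ _ h25) h23 (hne _ _ hub).symm
    obtain ⟨q, s, h3, h4, h5, h6, h7⟩ := r.two h h14
    have hk := h.k4 v v' a b
    have hq := hN q h5
    have hr := hN s h6
    grind

/-- A poor rim vertex `a` of the wheel of `v` provides four tokens, from its two triangles with `v`.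
-/
theorem exists_tokens_of_poor {v a b d : V} (h : Sparse A) (hv : Rich A v) (ha : Poor A a)
    (hva : A v a) (hab : A a b) (had : A a d) (hvb : A v b) (hvd : A v d) (hbd : b ≠ d) :
    ∃ S : Finset (V × V × V), S.card = 4 ∧
      ∀ s ∈ S, Poor A s.1 ∧ s.2 ∈ wedge A s.1 ∧ Uses A v s := by
  have hs := h.symm
  have n1 := h.ne _ _ hvb
  have n2 := h.ne _ _ hvd
  refine ⟨{(a, v, b), (a, b, v), (a, v, d), (a, d, v)}, ?_, ?_⟩
  · rw [Finset.card_insert_of_notMem, Finset.card_insert_of_notMem, Finset.card_insert_of_notMem,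
      Finset.card_singleton]
    all_goals
      simp only [Finset.mem_insert, Finset.mem_singleton, Prod.mk.injEq]
      grind
  · intro s hs'
    simp only [Finset.mem_insert, Finset.mem_singleton] at hs'
    simp only [mem_wedge, Uses]
    rcases hs' with rfl | rfl | rfl | rfl
    · exact ⟨ha, ⟨hs _ _ hva, hab, hvb⟩, hv, Or.inl rfl⟩
    · exact ⟨ha, ⟨hab, hs _ _ hva, hs _ _ hvb⟩, hv, Or.inr (Or.inl rfl)⟩
    · exact ⟨ha, ⟨hs _ _ hva, had, hvd⟩, hv, Or.inl rfl⟩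
    · exact ⟨ha, ⟨had, hs _ _ hva, hs _ _ hvd⟩, hv, Or.inr (Or.inl rfl)⟩

theorem not_rich_of_pendant (h : Sparse A) {a y b : V} (hay : A a y)
    (hy : ∀ w, A a w → A y w → w = b) : ¬ Rich A a := by
  intro r
  obtain ⟨q, s, h3, h4, h5, h6, h7⟩ := r.two h hay
  exact h7 ((hy q h3 h5).trans (hy s h4 h6).symm)

/-- If two opposite rim edges are capped by outer vertices `y` and `y'`, these are distinct, because
there is no octahedron, and poor; their triangles with the rim edges provide four tokens. -/
theorem Wheel.tokens_of_caps (h : Sparse A) {v a b c d y y' : V} (hw : Wheel A v a b c d)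
    (hv : Rich A v) (hay : A a y) (hby : A b y) (hcy : A c y') (hdy : A d y')
    (hyv : y ≠ v) (hyv' : y' ≠ v) (hyd : y ≠ d) (hyb : y' ≠ b) :
    ∃ S : Finset (V × V × V), S.card = 4 ∧
      ∀ s ∈ S, Poor A s.1 ∧ s.2 ∈ wedge A s.1 ∧ Uses A v s := by
  have hs := h.symm
  have hne := h.ne
  obtain ⟨va, vb, vc, vd, ab, bc, cd, da, ac, bd, nac, nbd⟩ := hw
  have hyc : y ≠ c := by rintro rfl; exact ac hay
  have hya : y' ≠ a := by rintro rfl; exact ac (hs _ _ hcy)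
  have hyy : y ≠ y' := by
    rintro rfl
    exact h.oct v y a c b d ⟨vc, vb, vd, hs _ _ hay, hs _ _ hcy, hs _ _ hby, hs _ _ hdy, ab,
      hs _ _ da, hs _ _ bc, cd, hyv.symm, nac, nbd, va⟩
  have n1 := hne _ _ va
  have n2 := hne _ _ vb
  have n3 := hne _ _ vc
  have n4 := hne _ _ vd
  have n5 := hne _ _ ab
  have n6 := hne _ _ bc
  have n7 := hne _ _ cd
  have n8 := hne _ _ da
  have m1 := hne _ _ hay
  have m2 := hne _ _ hby
  have m3 := hne _ _ hcy
  have m4 := hne _ _ hdy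
  have Nv := h.exact va vb vc vd n5 nac n8.symm n6 nbd n7
  have Na := h.exact (hs _ _ va) ab (hs _ _ da) hay n2 n4 hyv.symm nbd m2 hyd.symm
  have Nb := h.exact (hs _ _ vb) (hs _ _ ab) bc hby n1 n3 hyv.symm nac m1 hyc.symm
  have Nc := h.exact (hs _ _ vc) (hs _ _ bc) cd hcy n2 n4 hyv'.symm nbd hyb.symm m4
  have Nd := h.exact (hs _ _ vd) da (hs _ _ cd) hdy n1 n3 hyv'.symm nac hya.symm m3
  have c1 : ∀ w, A y w → A a w → w = b := by
    intro w h1 h2; have := Na w h2; grind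
  have c2 : ∀ w, A y w → A b w → w = a := by
    intro w h1 h2; have := Nb w h2; grind
  have c3 : ∀ w, A y' w → A c w → w = d := by
    intro w h1 h2; have := Nc w h2; grind
  have c4 : ∀ w, A y' w → A d w → w = c := by
    intro w h1 h2; have := Nd w h2; grind
  have py := poor_of_isolated_edge h (hs _ _ hay) (hs _ _ hby) n5 c1 c2
  have py' := poor_of_isolated_edge h (hs _ _ hcy) (hs _ _ hdy) n7 c3 c4
  have ra := not_rich_of_pendant h hay fun w h1 h2 => c1 w h2 h1
  have rb := not_rich_of_pendant h hby fun w h1 h2 => c2 w h2 h1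
  have rc := not_rich_of_pendant h hcy fun w h1 h2 => c3 w h2 h1
  have rd := not_rich_of_pendant h hdy fun w h1 h2 => c4 w h2 h1
  have vy : ¬ A v y := fun h' => by have := Nv y h'; grind
  have vy' : ¬ A v y' := fun h' => by have := Nv y' h'; grind
  refine ⟨{(y, a, b), (y, b, a), (y', c, d), (y', d, c)}, ?_, ?_⟩
  · rw [Finset.card_insert_of_notMem, Finset.card_insert_of_notMem, Finset.card_insert_of_notMem,
      Finset.card_singleton]
    all_goals
      simp only [Finset.mem_insert, Finset.mem_singleton, Prod.mk.injEq]
      grind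
  · intro s hs'
    simp only [Finset.mem_insert, Finset.mem_singleton] at hs'
    simp only [mem_wedge, Uses]
    rcases hs' with rfl | rfl | rfl | rfl
    · exact ⟨py, ⟨hs _ _ hay, hs _ _ hby, ab⟩, hv, .inr (.inr ⟨ra, rb, hyv.symm, va, vb, vy⟩)⟩
    · exact ⟨py, ⟨hs _ _ hby, hs _ _ hay, hs _ _ ab⟩, hv,
        .inr (.inr ⟨rb, ra, hyv.symm, vb, va, vy⟩)⟩
    · exact ⟨py', ⟨hs _ _ hcy, hs _ _ hdy, cd⟩, hv,
        .inr (.inr ⟨rc, rd, hyv'.symm, vc, vd, vy'⟩)⟩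
    · exact ⟨py', ⟨hs _ _ hdy, hs _ _ hcy, hs _ _ cd⟩, hv,
        .inr (.inr ⟨rd, rc, hyv'.symm, vd, vc, vy'⟩)⟩

/-- Every rich vertex uses four tokens at poor vertices: a poor rim vertex provides them, and if
there is none, then every rim vertex has a cap, and the caps of consecutive rim edges fit together
so that two opposite rim edges are capped. -/
theorem Rich.exists_tokens (h : Sparse A) {v : V} (hv : Rich A v) :
    ∃ S : Finset (V × V × V), S.card = 4 ∧
      ∀ s ∈ S, Poor A s.1 ∧ s.2 ∈ wedge A s.1 ∧ Uses A v s := by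
  obtain ⟨a, b, c, d, hw⟩ := hv.wheel h
  have hs := h.symm
  by_cases pa : Poor A a
  · exact exists_tokens_of_poor h hv pa hw.va hw.ab (hs _ _ hw.da) hw.vb hw.vd hw.nbd
  by_cases pb : Poor A b
  · exact exists_tokens_of_poor h hv pb hw.vb hw.bc (hs _ _ hw.ab) hw.vc hw.va hw.nac.symm
  by_cases pc : Poor A c
  · exact exists_tokens_of_poor h hv pc hw.vc hw.cd (hs _ _ hw.bc) hw.vd hw.vb hw.nbd.symm
  by_cases pd : Poor A d
  · exact exists_tokens_of_poor h hv pd hw.vd hw.da (hs _ _ hw.cd) hw.va hw.vc hw.nac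
  have hwb := hw.rot h
  have hwc := hwb.rot h
  have hwd := hwc.rot h
  obtain ⟨ya, a1, a2, a3, a4, a5⟩ := hw.exists_cap h pa
  obtain ⟨yb, b1, b2, b3, b4, b5⟩ := hwb.exists_cap h pb
  obtain ⟨yc, c1, c2, c3, c4, c5⟩ := hwc.exists_cap h pc
  obtain ⟨yd, d1, d2, d3, d4, d5⟩ := hwd.exists_cap h pd
  have hne := h.ne
  -- two consecutive rim vertices with a common outer neighbour have the same outer neighbour
  have key : ∀ {a b c d : V}, Wheel A v a b c d → ∀ {y z : V}, A a y → y ≠ v → A b z → z ≠ v →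
      z ≠ c → z ≠ a → A y b → y = z := by
    intro a b c d hw y z h1 h2 h3 h4 h5 h6 h7
    have hya := hne _ _ h1
    have hyc : y ≠ c := by rintro rfl; exact hw.ac h1
    have := h.exact (hs _ _ hw.vb) (hs _ _ hw.ab) hw.bc h3 (hne _ _ hw.va) (hne _ _ hw.vc)
      h4.symm hw.nac h6.symm h5.symm y (hs _ _ h7)
    grind
  have kab := key hw a1 a2 b1 b2 b3 b4
  have kbc := key hwb b1 b2 c1 c2 c3 c4
  have kcd := key hwc c1 c2 d1 d2 d3 d4
  have kda := key hwd d1 d2 a1 a2 a3 a4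
  have kad : A ya d → ya = yd := by
    intro h7
    have hyc : ya ≠ c := by rintro rfl; exact hw.ac a1
    have := h.exact (hs _ _ hw.vd) hw.da (hs _ _ hw.cd) d1 (hne _ _ hw.va) (hne _ _ hw.vc)
      d2.symm hw.nac d3.symm d4.symm ya (hs _ _ h7)
    have := hne _ _ a1
    grind
  have kba : A yb a → yb = ya := by
    intro h7
    have hyc : yb ≠ d := by rintro rfl; exact hw.bd b1
    have := h.exact (hs _ _ hw.va) hw.ab (hs _ _ hw.da) a1 (hne _ _ hw.vb) (hne _ _ hw.vd)
      a2.symm hw.nbd a3.symm a4.symm yb (hs _ _ h7)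
    have := hne _ _ b1
    grind
  have kcb : A yc b → yc = yb := by
    intro h7
    have hyc : yc ≠ a := by rintro rfl; exact hw.ac (hs _ _ c1)
    have := h.exact (hs _ _ hw.vb) hw.bc (hs _ _ hw.ab) b1 (hne _ _ hw.vc) (hne _ _ hw.va)
      b2.symm hw.nac.symm b3.symm b4.symm yc (hs _ _ h7)
    have := hne _ _ c1
    grind
  have kdc : A yd c → yd = yc := by
    intro h7
    have hyc : yd ≠ b := by rintro rfl; exact hw.bd (hs _ _ d1)
    have := h.exact (hs _ _ hw.vc) hw.cd (hs _ _ hw.bc) c1 (hne _ _ hw.vd) (hne _ _ hw.vb)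
      c2.symm hw.nbd.symm c3.symm c4.symm yd (hs _ _ h7)
    have := hne _ _ d1
    grind
  have hor : (ya = yb ∧ yc = yd) ∨ (yb = yc ∧ yd = ya) := by
    have e1 : ya = yb ∨ ya = yd := a5.imp kab kad
    have e2 : yb = yc ∨ yb = ya := b5.imp kbc kba
    have e3 : yc = yd ∨ yc = yb := c5.imp kcd kcb
    have e4 : yd = ya ∨ yd = yc := d5.imp kda kdc
    clear kab kbc kcd kda kad kba kcb kdc key
    grind
  rcases hor with ⟨rfl, rfl⟩ | ⟨rfl, rfl⟩
  · exact hw.tokens_of_caps h hv a1 b1 c1 d1 a2 c2 a4 c4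
  · exact hwb.tokens_of_caps h hv b1 c1 d1 a1 b2 d2 b4 d4

/-- In a graph of maximum degree at most four without `K₄` and without octahedra, the number of
triangles is at most the number of vertices. Each triangle is counted six times on the left. -/
theorem Sparse.sum_wedge_le (h : Sparse A) :
    ∑ v, (wedge A v).card ≤ 6 * Fintype.card V := by
  classical
  set T : Finset (V × V × V) :=
    Finset.univ.filter fun s => Poor A s.1 ∧ s.2 ∈ wedge A s.1 with hT
  set R : Finset V := Finset.univ.filter (Rich A) with hR
  have h1 : R.card * 4 ≤ T.card * 1 := by
    refine Finset.card_mul_le_card_mul (Uses A) ?_ ?_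
    · intro v hv
      obtain ⟨S, hS, hS'⟩ := Rich.exists_tokens h (Finset.mem_filter.1 hv).2
      rw [← hS]
      refine Finset.card_le_card fun s hs => ?_
      obtain ⟨s1, s2, s3⟩ := hS' s hs
      simp [Finset.bipartiteAbove, hT, s1, s2, s3]
    · rintro ⟨u, a, b⟩ hs
      rw [hT, Finset.mem_filter, mem_wedge] at hs
      obtain ⟨-, h3, h4, h5, h6⟩ := hs
      rw [Finset.card_le_one]
      intro v hv v' hv'
      exact Uses.unique h h3 h4 h5 h6 (Finset.mem_bipartiteBelow _ |>.1 hv).2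
        (Finset.mem_bipartiteBelow _ |>.1 hv').2
  have h2 : T.card = ∑ v, if Poor A v then (wedge A v).card else 0 := by
    rw [hT, Finset.card_filter, ← Finset.univ_product_univ, Finset.sum_product]
    refine Finset.sum_congr rfl fun v _ => ?_
    by_cases hp : Poor A v <;> simp [hp]
  have h3 : R.card = ∑ v, if Rich A v then 1 else 0 := by rw [hR, Finset.card_filter]
  -- per vertex: `3 * 4 ≤ 12` if poor, `2 * 8 ≤ 12 + 4` if rich, and `2 * 6 ≤ 12` otherwise
  have h4 : ∑ v, (2 * (wedge A v).card + if Poor A v then (wedge A v).card else 0) ≤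
      ∑ v, (12 + 4 * if Rich A v then 1 else 0) := by
    refine Finset.sum_le_sum fun v _ => ?_
    have h8 := wheel_or_le h v
    by_cases hp : Poor A v <;> by_cases hr : Rich A v <;> simp only [hp, hr, if_true, if_false] <;>
      simp only [Poor, Rich] at hp hr <;> omega
  rw [Finset.sum_add_distrib, Finset.sum_add_distrib, ← Finset.mul_sum, ← Finset.mul_sum, ← h2,
    ← h3, Finset.sum_const, Finset.card_univ, smul_eq_mul] at h4
  omega

end Tokens

/-! ### Counting triangles and detecting stars -/

section Counting

variable {V : Type*} [Fintype V]

/-- Copies of the triangle, counted as subgraphs, correspond to cliques with three vertices. -/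
theorem copyCount_completeGraph_three (G : SimpleGraph V) [DecidableEq V] [DecidableRel G.Adj] :
    G.copyCount (SimpleGraph.completeGraph (Fin 3)) = (G.cliqueFinset 3).card := by
  classical
  rw [SimpleGraph.copyCount]
  symm
  refine Finset.card_bij (fun s _ => (⊤ : G.Subgraph).induce (s : Set V)) ?_ ?_ ?_
  · intro s hs
    rw [SimpleGraph.mem_cliqueFinset_iff, SimpleGraph.isNClique_iff] at hs
    simp only [Finset.mem_filter, Finset.mem_univ, true_and]
    have e : Fin 3 ≃ (s : Set V) := (finCongr hs.2.symm).trans s.equivFin.symm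
    refine ⟨⟨e, ?_⟩⟩
    intro a b
    simp only [SimpleGraph.Subgraph.coe_adj, SimpleGraph.Subgraph.induce_adj,
      SimpleGraph.Subgraph.top_adj, SimpleGraph.completeGraph, SimpleGraph.top_adj]
    constructor
    · rintro ⟨-, -, h⟩ rfl
      exact h.ne rfl
    · intro h
      refine ⟨(e a).2, (e b).2, hs.1 (e a).2 (e b).2 ?_⟩
      intro h'
      exact h (e.injective (Subtype.ext h'))
  · intro s _ t _ h
    have := congrArg SimpleGraph.Subgraph.verts h
    simpa using this
  · intro G' hG'
    simp only [Finset.mem_filter, Finset.mem_univ, true_and] at hG'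
    obtain ⟨φ⟩ := hG'
    have hadj : ∀ a b, a ∈ G'.verts → b ∈ G'.verts → a ≠ b → G'.Adj a b := by
      intro a b ha hb hab
      have h1 : (SimpleGraph.completeGraph (Fin 3)).Adj (φ.symm ⟨a, ha⟩) (φ.symm ⟨b, hb⟩) := by
        simp only [SimpleGraph.completeGraph, SimpleGraph.top_adj]
        intro h
        exact hab (congrArg Subtype.val (φ.symm.injective h))
      have h2 := φ.map_adj_iff.2 h1
      simpa using h2
    refine ⟨G'.verts.toFinset, ?_, ?_⟩
    · rw [SimpleGraph.mem_cliqueFinset_iff, SimpleGraph.isNClique_iff]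
      refine ⟨?_, ?_⟩
      · intro a ha b hb hab
        exact (hadj a b (by simpa using ha) (by simpa using hb) hab).adj_sub
      · have := Fintype.card_congr φ.toEquiv
        rw [Set.toFinset_card, ← this, Fintype.card_fin]
    · ext a b
      · simp
      · simp only [SimpleGraph.Subgraph.induce_adj, Set.coe_toFinset, SimpleGraph.Subgraph.top_adj]
        constructor
        · rintro ⟨ha, hb, h⟩
          exact hadj a b ha hb h.ne
        · intro h
          exact ⟨h.fst_mem, h.snd_mem, h.adj_sub⟩

theorem six_mul_copyCount_le (G : SimpleGraph V) [DecidableEq V] [DecidableRel G.Adj] :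
    6 * G.copyCount (SimpleGraph.completeGraph (Fin 3)) ≤ ∑ v, (wedge G.Adj v).card := by
  have h1 : ∑ v, (wedge G.Adj v).card =
      (Finset.univ.filter fun s : V × V × V => s.2 ∈ wedge G.Adj s.1).card := by
    rw [Finset.card_filter, ← Finset.univ_product_univ, Finset.sum_product]
    refine Finset.sum_congr rfl fun v _ => ?_
    simp
  rw [copyCount_completeGraph_three, h1, mul_comm, ← mul_one (Finset.card _)]
  rw [mul_one, ← mul_one (Finset.card (Finset.filter _ _))]
  refine Finset.card_mul_le_card_mul (fun (t : Finset V) (s : V × V × V) => {s.1, s.2.1, s.2.2} = t)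
    ?_ ?_
  · intro t ht
    rw [SimpleGraph.mem_cliqueFinset_iff, SimpleGraph.is3Clique_iff] at ht
    obtain ⟨a, b, c, hab, hac, hbc, rfl⟩ := ht
    have n1 := hab.ne
    have n2 := hac.ne
    have n3 := hbc.ne
    have hsub : ({(a, b, c), (a, c, b), (b, a, c), (b, c, a), (c, a, b), (c, b, a)} :
        Finset (V × V × V)) ⊆ Finset.bipartiteAbove
          (fun (t : Finset V) (s : V × V × V) => {s.1, s.2.1, s.2.2} = t)
          (Finset.univ.filter fun s : V × V × V => s.2 ∈ wedge G.Adj s.1) {a, b, c} := by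
      intro s hs
      simp only [Finset.mem_insert, Finset.mem_singleton] at hs
      simp only [Finset.mem_bipartiteAbove, Finset.mem_filter, Finset.mem_univ, true_and, mem_wedge]
      rcases hs with rfl | rfl | rfl | rfl | rfl | rfl <;>
        simp only [hab, hac, hbc, hab.symm, hac.symm, hbc.symm, true_and] <;>
        (ext x; simp only [Finset.mem_insert, Finset.mem_singleton]; tauto)
    refine le_trans (le_of_eq ?_) (Finset.card_le_card hsub)
    rw [Finset.card_insert_of_notMem, Finset.card_insert_of_notMem, Finset.card_insert_of_notMem,
      Finset.card_insert_of_notMem, Finset.card_insert_of_notMem, Finset.card_singleton]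
    all_goals
      simp only [Finset.mem_insert, Finset.mem_singleton, Prod.mk.injEq]
      grind
  · intro s _
    rw [Finset.card_le_one]
    intro t ht t' ht'
    exact ((Finset.mem_bipartiteBelow _).1 ht).2.symm.trans ((Finset.mem_bipartiteBelow _).1 ht').2

/-- Being free of the star with five leaves means having maximum degree at most four. -/
theorem free_star_iff (G : SimpleGraph V) [DecidableRel G.Adj] :
    (starWithLeaves 5).Free G ↔ ∀ v, (nbrs G.Adj v).card ≤ 4 := by
  classical
  constructor
  · intro h v
    by_contra! hv
    apply h
    obtain ⟨s, hs, hcard⟩ := Finset.exists_subset_card_eq (show 5 ≤ (nbrs G.Adj v).card by omega)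
    let e : Fin 5 ≃ s := (finCongr hcard.symm).trans s.equivFin.symm
    have hadj : ∀ i, G.Adj v (e i) := fun i => mem_nbrs.1 (hs (e i).2)
    refine ⟨⟨⟨Fin.cons v fun i => (e i : V), ?_⟩, ?_⟩⟩
    · intro a b hab
      simp only [starWithLeaves, SimpleGraph.starGraph_adj] at hab
      obtain ⟨hne, rfl | rfl⟩ := hab
      · obtain ⟨j, rfl⟩ := Fin.exists_succ_eq.2 hne.symm
        simpa using hadj j
      · obtain ⟨j, rfl⟩ := Fin.exists_succ_eq.2 hne
        simpa using (hadj j).symm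
    · change Function.Injective (Fin.cons v fun i => (e i : V) : Fin 6 → V)
      rw [Fin.cons_injective_iff]
      refine ⟨?_, fun a b hab => e.injective (Subtype.ext hab)⟩
      rintro ⟨i, hi⟩
      exact (hadj i).ne hi.symm
  · rintro h ⟨f⟩
    have hsub : (Finset.univ : Finset (Fin 5)).image (fun i => f i.succ) ⊆ nbrs G.Adj (f 0) := by
      intro x hx
      obtain ⟨i, -, rfl⟩ := Finset.mem_image.1 hx
      rw [mem_nbrs]
      exact f.toHom.map_adj (by
        rw [starWithLeaves, SimpleGraph.starGraph_adj]
        exact ⟨(Fin.succ_ne_zero i).symm, Or.inl rfl⟩)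
    have h1 := Finset.card_le_card hsub
    have hinj : Function.Injective fun i : Fin 5 => f i.succ :=
      f.injective.comp (Fin.succ_injective 5)
    rw [Finset.card_image_of_injective _ hinj,
      Finset.card_univ, Fintype.card_fin] at h1
    have := h (f 0)
    omega

end Counting

/-! ### Upper bounds for the game -/

section Monotonicity

variable {V : Type*} {A L L' : V → V → Prop}

/-- The invariant is preserved when legal pairs disappear, so an extra move never harms Blocker. -/
theorem Inv.mono (hle : ∀ x y, L' x y → L x y) (h : Inv A L) : Inv A L' where
  k4 := h.k4
  threat := fun _ _ _ _ ⟨h1, h2, h3, h4, h5, h6⟩ => h.threat _ _ _ _ ⟨h1, h2, h3, h4, h5,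
    hle _ _ h6⟩
  cherry := by
    have key : ∀ u v, Guard A L u v → Guard A L' u v := by
      rintro u v ⟨z, ⟨h1, h2, h3, h4⟩ | ⟨h1, h2, h3, h4⟩⟩
      · exact ⟨z, Or.inl ⟨h1, h2, h3, fun k => h4 (hle _ _ k)⟩⟩
      · exact ⟨z, Or.inr ⟨h1, h2, h3, fun k => h4 (hle _ _ k)⟩⟩
    exact fun u v w h1 h2 h3 => (h.cherry u v w h1 h2 (hle _ _ h3)).imp (key _ _) (key _ _)
  full := by
    intro q a b c d h1 h2 h3 h4 h5 h6 h7 h8 h9 h10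
    obtain ⟨x, y, k1, k2, k3, k4, k5⟩ := h.full q a b c d h1 h2 h3 h4 h5 h6 h7 h8 h9 h10
    exact ⟨x, y, k1, k2, k3, k4, fun k => k5 (hle _ _ k)⟩
  pendantDiamond := fun _ _ _ _ _ hc => h.pendantDiamond _ _ _ _ _ (hc.mono hle)
  pendantSquare := fun _ _ _ _ _ hc => h.pendantSquare _ _ _ _ _ (hc.mono hle)
  bull := fun _ _ _ _ _ hc => h.bull _ _ _ _ _ (hc.mono hle)
  polarTheta := fun _ _ _ _ _ hc => h.polarTheta _ _ _ _ _ (hc.mono hle)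
  middleTheta := fun _ _ _ _ _ hc => h.middleTheta _ _ _ _ _ (hc.mono hle)
  punctured := fun _ _ _ _ _ _ hc => h.punctured _ _ _ _ _ _ (hc.mono hle)

theorem Safe.mono (hle : ∀ x y, L' x y → L x y) (h : Safe A L) : Safe A L' :=
  ⟨h.inv.mono hle, fun _ _ _ _ _ _ hc => h.oct _ _ _ _ _ _ (hc.mono hle), h.no_oct⟩

theorem Safe.of_forall_not (h : ∀ x y, ¬ A x y) : Safe A L where
  inv :=
    { k4 := fun _ _ _ _ h1 => absurd h1 (h _ _)
      threat := fun _ _ _ _ hc => h _ _ hc.1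
      cherry := fun _ _ _ h1 => absurd h1 (h _ _)
      full := fun _ _ _ _ _ h1 => absurd h1 (h _ _)
      pendantDiamond := fun _ _ _ _ _ hc => h _ _ hc.1
      pendantSquare := fun _ _ _ _ _ hc => h _ _ hc.1
      bull := fun _ _ _ _ _ hc => h _ _ hc.1
      polarTheta := fun _ _ _ _ _ hc => h _ _ hc.1
      middleTheta := fun _ _ _ _ _ hc => h _ _ hc.1
      punctured := fun _ _ _ _ _ _ hc => h _ _ hc.1 }
  oct := fun _ _ _ _ _ _ hc => h _ _ hc.e1
  no_oct := fun _ _ _ _ _ _ hc => h _ _ hc.e1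

end Monotonicity

section Positions

variable {n : ℕ} {C B : Finset (Sym2 (Fin n))}

theorem graphOf_adj {x y : Fin n} : (graphOf C).Adj x y ↔ s(x, y) ∈ C ∧ x ≠ y := by
  simp [graphOf]

theorem mem_unclaimed {x y : Fin n} :
    s(x, y) ∈ unclaimed C B ↔ x ≠ y ∧ s(x, y) ∉ C ∧ s(x, y) ∉ B := by
  simp [unclaimed]

theorem graphOf_mono {C' : Finset (Sym2 (Fin n))} (h : C ⊆ C') : graphOf C ≤ graphOf C' := by
  intro x y hxy
  rw [graphOf_adj] at hxy ⊢
  exact ⟨h hxy.1, hxy.2⟩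

theorem mem_constructorMoves {W' : Type} {F : SimpleGraph W'} {e : Sym2 (Fin n)} :
    e ∈ constructorMoves F C B ↔ e ∈ unclaimed C B ∧ F.Free (graphOf (insert e C)) := by
  classical
  simp [constructorMoves]

theorem graphOf_insert_adj {u v x y : Fin n} (huv : u ≠ v) :
    (graphOf (insert s(u, v) C)).Adj x y ↔
      (graphOf C).Adj x y ∨ (x = u ∧ y = v) ∨ (x = v ∧ y = u) := by
  simp only [graphOf_adj, Finset.mem_insert, Sym2.eq_iff]
  grind

/-- The pairs of vertices that Constructor may join in the game with maximum degree four. -/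
def Legal (C B : Finset (Sym2 (Fin n))) (x y : Fin n) : Prop :=
  s(x, y) ∈ constructorMoves (starWithLeaves 5) C B

theorem free_star_iff_le_four {G : SimpleGraph (Fin n)} : (starWithLeaves 5).Free G ↔
    ∀ x a b c d w, G.Adj x a → G.Adj x b → G.Adj x c → G.Adj x d → G.Adj x w →
    a ≠ b → a ≠ c → a ≠ d → b ≠ c → b ≠ d → c ≠ d → w = a ∨ w = b ∨ w = c ∨ w = d := by
  classical
  rw [free_star_iff]
  constructor
  · intro h x a b c d w ha hb hc hd hw h1 h2 h3 h4 h5 h6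
    by_contra! hne
    have hs : ({a, b, c, d, w} : Finset (Fin n)) ⊆ nbrs G.Adj x := by
      intro z hz
      simp only [Finset.mem_insert, Finset.mem_singleton] at hz
      rw [mem_nbrs]
      rcases hz with rfl | rfl | rfl | rfl | rfl <;> assumption
    have h7 := (Finset.card_le_card hs).trans (h x)
    obtain ⟨k1, k2, k3, k4⟩ := hne
    rw [Finset.card_insert_of_notMem, Finset.card_insert_of_notMem, Finset.card_insert_of_notMem,
      Finset.card_insert_of_notMem, Finset.card_singleton] at h7
    · omega
    all_goals
      simp only [Finset.mem_insert, Finset.mem_singleton]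
      grind
  · intro h x
    by_contra! hv
    obtain ⟨s, hs, hcard⟩ := Finset.exists_subset_card_eq (show 5 ≤ (nbrs G.Adj x).card by omega)
    obtain ⟨a, t, hat, rfl, ht⟩ := Finset.card_eq_succ.1 hcard
    obtain ⟨b, t', hbt, rfl, ht'⟩ := Finset.card_eq_succ.1 ht
    obtain ⟨c, d, w, hcd, hcw, hdw, rfl⟩ := Finset.card_eq_three.1 ht'
    have hm : ∀ z ∈ insert a (insert b ({c, d, w} : Finset (Fin n))), G.Adj x z :=
      fun z hz => mem_nbrs.1 (hs hz)
    simp only [Finset.mem_insert, Finset.mem_singleton, forall_eq_or_imp, forall_eq] at hm hat hbt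
    obtain ⟨ha, hb, hc, hd, hw⟩ := hm
    have := h x a b c d w ha hb hc hd hw
    grind

theorem board (h : (starWithLeaves 5).Free (graphOf C)) : Board (graphOf C).Adj (Legal C B) where
  symm := fun _ _ h => h.symm
  ne := fun _ _ h => h.ne
  lsymm := fun _ _ h => by rwa [Legal, Sym2.eq_swap]
  lne := fun _ _ h => (mem_unclaimed.1 (mem_constructorMoves.1 h).1).1
  notAdj := fun _ _ h h' => (mem_unclaimed.1 (mem_constructorMoves.1 h).1).2.1 (graphOf_adj.1 h').1
  le_three := by
    intro x y hl a b c d ha hb hc hd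
    obtain ⟨h1, h2⟩ := mem_constructorMoves.1 hl
    rw [mem_unclaimed] at h1
    rw [free_star_iff_le_four] at h2
    have h3 := h2 x a b c d y
    simp only [graphOf_insert_adj h1.1] at h3
    have h4 : ∀ z, (graphOf C).Adj x z → z ≠ y := by
      rintro z hz rfl
      exact h1.2.1 (graphOf_adj.1 hz).1
    have := h4 a ha
    have := h4 b hb
    have := h4 c hc
    have := h4 d hd
    grind
  le_four := free_star_iff_le_four.1 h

theorem Legal.of_insert_left {e : Sym2 (Fin n)} {x y : Fin n} (h : Legal (insert e C) B x y) :
    Legal C B x y := by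
  obtain ⟨h1, h2⟩ := mem_constructorMoves.1 h
  rw [mem_unclaimed, Finset.mem_insert] at h1
  refine mem_constructorMoves.2 ⟨mem_unclaimed.2 ⟨h1.1, fun k => h1.2.1 (Or.inr k), h1.2.2⟩, ?_⟩
  intro hc
  exact h2 (hc.mono_right (graphOf_mono (Finset.insert_subset_insert _ (Finset.subset_insert _ _))))

theorem Legal.of_insert_right {u v : Fin n} {x y : Fin n} (h : Legal C (insert s(u, v) B) x y) :
    Without (Legal C B) u v x y := by
  obtain ⟨h1, h2⟩ := mem_constructorMoves.1 h
  rw [mem_unclaimed, Finset.mem_insert, not_or, Sym2.eq_iff] at h1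
  exact ⟨mem_constructorMoves.2 ⟨mem_unclaimed.2 ⟨h1.1, h1.2.1, h1.2.2.2⟩, h2⟩, h1.2.2.1⟩

theorem Legal.played {u v : Fin n} (h : (starWithLeaves 5).Free (graphOf C))
    (hs : Safe (graphOf C).Adj (Legal C B)) (huv : Legal C B u v) :
    Played (graphOf C).Adj (Legal C B) (graphOf (insert s(u, v) C)).Adj
      (Legal (insert s(u, v) C) B) u v where
  b := board h
  b₁ := board (mem_constructorMoves.1 huv).2
  inv := hs.inv
  huv := huv
  adj := fun _ _ => graphOf_insert_adj (mem_unclaimed.1 (mem_constructorMoves.1 huv).1).1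
  le := fun _ _ hl => hl.of_insert_left

/-- Blocker's strategy keeps the position safe, so the final graph of Constructor is `K₄`-free and
contains no octahedron. -/
theorem constructorTurn_le {W : Type} {H : SimpleGraph W} {k : ℕ}
    (hk : ∀ C : Finset (Sym2 (Fin n)), (starWithLeaves 5).Free (graphOf C) →
      (∀ p q b c, (graphOf C).Adj p q → (graphOf C).Adj p b → (graphOf C).Adj p c →
        (graphOf C).Adj q b → (graphOf C).Adj q c → ¬ (graphOf C).Adj b c) →
      (∀ x x' y y' z z', ¬ Octahedron (graphOf C).Adj x x' y y' z z') →
      (graphOf C).copyCount H ≤ k)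
    (h : (starWithLeaves 5).Free (graphOf C)) (hs : Safe (graphOf C).Adj (Legal C B)) :
    constructorTurn H (starWithLeaves 5) C B ≤ k := by
  induction hm : (unclaimed C B).card using Nat.strong_induction_on generalizing C B with
  | _ m ih =>
  subst hm
  rw [constructorTurn]
  split_ifs with hmv
  · refine Finset.sup'_le _ _ fun e _ => ?_
    obtain ⟨e, he⟩ := e
    induction e using Sym2.ind with
    | _ u v =>
    have hp := Legal.played h hs he
    have hfree := (mem_constructorMoves.1 he).2
    rw [blockerTurn]
    split_ifs with hmv'
    · obtain ⟨x, y, hxy, hs'⟩ : ∃ x y, s(x, y) ∈ unclaimed (insert s(u, v) C) B ∧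
          Safe (graphOf (insert s(u, v) C)).Adj (Legal (insert s(u, v) C) (insert s(x, y) B)) := by
        rcases hp.safe_reply hs with ⟨x, y, hl, hs'⟩ | hs'
        · exact ⟨x, y, (mem_constructorMoves.1 hl).1, hs'.mono fun _ _ h' => h'.of_insert_right⟩
        -- no reply is needed, and an arbitrary one does no harm
        · obtain ⟨e, he'⟩ := hmv'
          induction e using Sym2.ind with
          | _ x y =>
          exact ⟨x, y, (mem_constructorMoves.1 he').1, hs'.mono fun _ _ h' => h'.of_insert_right.1⟩
      refine (Finset.inf'_le _ (Finset.mem_attach _ ⟨s(x, y), hxy⟩)).trans ?_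
      exact ih _ ((card_unclaimed_insert_right hxy).trans
        (card_unclaimed_insert_left (mem_constructorMoves.1 he).1)) hfree hs' rfl
    · exact hk _ hfree hp.k4 (hp.no_octahedron hs.oct hs.no_oct)
  · exact hk _ h hs.inv.k4 hs.no_oct

/-- A bound for the number of copies of `H` in all graphs without `K₄` and octahedra of maximum
degree four is a bound for the value of the game. -/
theorem g_le {W : Type} {H : SimpleGraph W} {k : ℕ}
    (hk : ∀ C : Finset (Sym2 (Fin n)), (starWithLeaves 5).Free (graphOf C) →
      (∀ p q b c, (graphOf C).Adj p q → (graphOf C).Adj p b → (graphOf C).Adj p c →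
        (graphOf C).Adj q b → (graphOf C).Adj q c → ¬ (graphOf C).Adj b c) →
      (∀ x x' y y' z z', ¬ Octahedron (graphOf C).Adj x x' y y' z z') →
      (graphOf C).copyCount H ≤ k) : g n H (starWithLeaves 5) ≤ k := by
  have hno : ∀ x y, ¬ (graphOf (∅ : Finset (Sym2 (Fin n)))).Adj x y := by
    intro x y h
    simp [graphOf_adj] at h
  refine constructorTurn_le hk ?_ (Safe.of_forall_not hno)
  rw [free_star_iff_le_four]
  intro x a b c d w h
  exact absurd h (hno _ _)

theorem g_completeGraph_four_eq_zero (n : ℕ) :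
    g n (SimpleGraph.completeGraph (Fin 4)) (starWithLeaves 5) = 0 := by
  rw [← Nat.le_zero]
  refine g_le fun C _ hk4 _ => ?_
  rw [Nat.le_zero, SimpleGraph.copyCount_eq_zero]
  rintro ⟨f⟩
  have hadj : ∀ i j : Fin 4, i ≠ j → (graphOf C).Adj (f i)
    (f j) := fun i j hij => f.toHom.map_adj hij
  exact hk4 (f 0) (f 1) (f 2) (f 3) (hadj _ _ (by decide)) (hadj _ _ (by decide))
    (hadj _ _ (by decide)) (hadj _ _ (by decide)) (hadj _ _ (by decide)) (hadj _ _ (by decide))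

theorem g_completeGraph_three_le (n : ℕ) :
    g n (SimpleGraph.completeGraph (Fin 3)) (starWithLeaves 5) ≤ n := by
  classical
  refine g_le fun C h hk4 hoct => ?_
  have hsp : Sparse (graphOf C).Adj :=
    ⟨fun _ _ h => h.symm, fun _ _ h => h.ne, (free_star_iff _).1 h, hk4, hoct⟩
  have h1 := hsp.sum_wedge_le
  have h2 := six_mul_copyCount_le (graphOf C)
  rw [Fintype.card_fin] at h1
  omega

end Positions

/-! ### Moves of Constructor -/

section Strategy

variable {n : ℕ} {C B : Finset (Sym2 (Fin n))} {k : ℕ}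

/-- The number of triangles in Constructor's graph. -/
noncomputable def triangles (C : Finset (Sym2 (Fin n))) : ℕ :=
  (graphOf C).copyCount (SimpleGraph.completeGraph (Fin 3))

/-- The value, at Constructor's turn, of the triangle game with maximum degree four. -/
noncomputable def value (C B : Finset (Sym2 (Fin n))) : ℕ :=
  constructorTurn (SimpleGraph.completeGraph (Fin 3)) (starWithLeaves 5) C B

theorem triangles_mono {C' : Finset (Sym2 (Fin n))} (h : C ⊆ C') : triangles C ≤ triangles C' := by
  classical
  rw [triangles, triangles, copyCount_completeGraph_three, copyCount_completeGraph_three]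
  exact Finset.card_le_card (SimpleGraph.cliqueFinset_mono _ (graphOf_mono h))

theorem triangles_insert {u v w : Fin n} (hu : (graphOf C).Adj u w) (hv : (graphOf C).Adj v w)
    (huv : u ≠ v) (hC : s(u, v) ∉ C) : triangles C + 1 ≤ triangles (insert s(u, v) C) := by
  classical
  rw [triangles, triangles, copyCount_completeGraph_three, copyCount_completeGraph_three]
  refine Finset.card_lt_card ⟨SimpleGraph.cliqueFinset_mono _
    (graphOf_mono (Finset.subset_insert _ _)), fun h => ?_⟩
  have h1 : {u, v, w} ∈ (graphOf (insert s(u, v) C)).cliqueFinset 3 := by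
    rw [SimpleGraph.mem_cliqueFinset_iff, SimpleGraph.is3Clique_triple_iff]
    exact ⟨graphOf_adj.2 ⟨Finset.mem_insert_self _ _, huv⟩,
      graphOf_mono (Finset.subset_insert _ _) hu, graphOf_mono (Finset.subset_insert _ _) hv⟩
  have h2 := h h1
  rw [SimpleGraph.mem_cliqueFinset_iff, SimpleGraph.is3Clique_triple_iff] at h2
  exact hC (graphOf_adj.1 h2.1).1

/-- Constructor's score never decreases: whatever is played, she keeps the triangles she has. -/
theorem triangles_le_value : triangles C ≤ value C B := by
  induction hm : (unclaimed C B).card using Nat.strong_induction_on generalizing C B with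
  | _ m ih =>
  subst hm
  rw [value, constructorTurn]
  split_ifs with hmv
  · obtain ⟨e, he⟩ := hmv
    refine le_trans ?_ (Finset.le_sup' _ (Finset.mem_attach _ ⟨e, he⟩))
    refine (triangles_mono (Finset.subset_insert e C)).trans ?_
    simp only
    rw [blockerTurn]
    split_ifs with hmv'
    · refine Finset.le_inf' _ _ fun b _ => ih _ ?_ rfl
      exact (card_unclaimed_insert_right b.2).trans
        (card_unclaimed_insert_left (constructorMoves_subset _ _ _ he))
    · exact le_rfl
  · exact le_rfl

/-- A lower bound for the value through a move `e` of Constructor. The case in which Blocker does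
not move is included because the game may end after `e`. -/
theorem le_value_of_move {e : Sym2 (Fin n)} (he : e ∈ constructorMoves (starWithLeaves 5) C B)
    (h : k ≤ value (insert e C) B) (h' : ∀ b, k ≤ value (insert e C) (insert b B)) :
    k ≤ value C B := by
  rw [value, constructorTurn, dif_pos ⟨e, he⟩]
  refine le_trans ?_ (Finset.le_sup' _ (Finset.mem_attach _ ⟨e, he⟩))
  simp only
  rw [blockerTurn]
  split_ifs with hmv
  · exact Finset.le_inf' _ _ fun b _ => h' b
  · rwa [value, constructorTurn, dif_neg hmv] at h

/-- The number of Constructor's edges at `v`. -/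
def degreeIn (C : Finset (Sym2 (Fin n))) (v : Fin n) : ℕ := (C.filter (v ∈ ·)).card

theorem degreeIn_insert_le (u v w : Fin n) :
    degreeIn (insert s(u, v) C) w ≤ degreeIn C w + if w = u ∨ w = v then 1 else 0 := by
  rw [degreeIn, degreeIn, Finset.filter_insert]
  simp only [Sym2.mem_iff]
  split_ifs
  · exact Finset.card_insert_le _ _
  · exact le_rfl

theorem notMem_of_degreeIn_eq_zero {v w : Fin n} (h : degreeIn C v = 0) : s(v, w) ∉ C := by
  intro hm
  rw [degreeIn, Finset.card_eq_zero, Finset.filter_eq_empty_iff] at h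
  exact h hm (Sym2.mem_mk_left _ _)

theorem free_of_degreeIn_le (h : ∀ v, degreeIn C v ≤ 4) : (starWithLeaves 5).Free (graphOf C) := by
  classical
  rw [free_star_iff]
  intro v
  refine le_trans ?_ (h v)
  refine Finset.card_le_card_of_injOn (fun w => s(v, w)) ?_ ?_
  · intro w hw
    have := mem_nbrs.1 hw
    simp [(graphOf_adj.1 this).1]
  · intro w _ w' _ hww
    exact Sym2.congr_right.1 hww

/-- The positions at Constructor's turn that arise in a game in which Constructor moves first. -/
structure Position (C B : Finset (Sym2 (Fin n))) : Prop where
  deg : ∀ v, degreeIn C v ≤ 4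
  diag : ∀ e ∈ C, ¬ e.IsDiag
  card : B.card ≤ C.card

/-- By the bound on the degrees, Constructor claims at most `2 * n` edges in the whole game. -/
theorem Position.card_le (h : Position C B) : C.card ≤ 2 * n := by
  have h1 : C.card * 2 ≤ (Finset.univ : Finset (Fin n)).card * 4 := by
    refine Finset.card_mul_le_card_mul (fun (e : Sym2 (Fin n)) v => v ∈ e) ?_ ?_
    · intro e he
      rw [← Sym2.card_toFinset_of_not_isDiag e (h.diag e he)]
      refine Finset.card_le_card fun v hv => ?_
      simpa [Finset.bipartiteAbove] using hv
    · intro v _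
      exact h.deg v
  rw [Finset.card_univ, Fintype.card_fin] at h1
  omega

/-- A move of Constructor together with Blocker's reply `b`, if there is one. -/
theorem Position.play (h : Position C B) {u v : Fin n} (huv : u ≠ v) (hC : s(u, v) ∉ C)
    (hB : s(u, v) ∉ B) (hu : degreeIn C u ≤ 3) (hv : degreeIn C v ≤ 3)
    (hk : ∀ B' b, (∀ e ∈ B', e ∈ B ∨ e = b) → Position (insert s(u, v) C) B' →
      k ≤ value (insert s(u, v) C) B') : k ≤ value C B := by
  have hdeg : ∀ w, degreeIn (insert s(u, v) C) w ≤ 4 := by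
    intro w
    have h1 := degreeIn_insert_le (C := C) u v w
    have h2 := h.deg w
    split_ifs at h1 with hw
    · rcases hw with rfl | rfl <;> omega
    · omega
  have hdiag : ∀ e ∈ insert s(u, v) C, ¬ e.IsDiag := by
    intro e he
    rcases Finset.mem_insert.1 he with rfl | he
    · simpa using huv
    · exact h.diag e he
  have hcard := h.card
  refine le_value_of_move (e := s(u, v)) ?_ ?_ fun b => ?_
  · exact mem_constructorMoves.2 ⟨mem_unclaimed.2 ⟨huv, hC, hB⟩, free_of_degreeIn_le hdeg⟩
  · refine hk B s(u, v) (fun e he => Or.inl he) ⟨hdeg, hdiag, ?_⟩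
    rw [Finset.card_insert_of_notMem hC]
    omega
  · refine hk (insert b B) b (fun e he => (Finset.mem_insert.1 he).symm) ⟨hdeg, hdiag, ?_⟩
    rw [Finset.card_insert_of_notMem hC]
    exact (Finset.card_insert_le _ _).trans (by omega)

/-- If claiming `uv` makes two different pairs `ab` and `cd` available for Constructor, then she
can claim one of them at her next turn. -/
theorem Position.double (h : Position C B) {u v a b c d : Fin n} (huv : u ≠ v) (hC : s(u, v) ∉ C)
    (hB : s(u, v) ∉ B) (hu : degreeIn C u ≤ 3) (hv : degreeIn C v ≤ 3) (hab : a ≠ b) (hcd : c ≠ d)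
    (hne : s(a, b) ≠ s(c, d)) (hCab : s(a, b) ∉ insert s(u, v) C)
    (hCcd : s(c, d) ∉ insert s(u, v) C) (hBab : s(a, b) ∉ B) (hBcd : s(c, d) ∉ B)
    (ha : degreeIn (insert s(u, v) C) a ≤ 3) (hb : degreeIn (insert s(u, v) C) b ≤ 3)
    (hc : degreeIn (insert s(u, v) C) c ≤ 3) (hd : degreeIn (insert s(u, v) C) d ≤ 3)
    (hk : ∀ e, e = s(a, b) ∨ e = s(c, d) → ∀ B' b₁ b₂, (∀ f ∈ B', f ∈ B ∨ f = b₁ ∨ f = b₂) →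
      Position (insert e (insert s(u, v) C)) B' → k ≤ value (insert e (insert s(u, v) C)) B') :
    k ≤ value C B := by
  refine h.play huv hC hB hu hv fun B₁ b₁ hB₁ h₁ => ?_
  by_cases hb1 : b₁ = s(a, b)
  · refine h₁.play hcd hCcd (fun hm => ?_) hc hd fun B₂ b₂ hB₂ h₂ => ?_
    · rcases hB₁ _ hm with h3 | h3
      · exact hBcd h3
      · exact hne (hb1.symm.trans h3.symm)
    · refine hk _ (Or.inr rfl) B₂ b₁ b₂ (fun f hf => ?_) h₂
      rcases hB₂ f hf with h3 | h3
      · rcases hB₁ f h3 with h4 | h4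
        · exact Or.inl h4
        · exact Or.inr (Or.inl h4)
      · exact Or.inr (Or.inr h3)
  · refine h₁.play hab hCab (fun hm => ?_) ha hb fun B₂ b₂ hB₂ h₂ => ?_
    · rcases hB₁ _ hm with h3 | h3
      · exact hBab h3
      · exact hb1 h3.symm
    · refine hk _ (Or.inl rfl) B₂ b₁ b₂ (fun f hf => ?_) h₂
      rcases hB₂ f hf with h3 | h3
      · rcases hB₁ f h3 with h4 | h4
        · exact Or.inl h4
        · exact Or.inr (Or.inl h4)
      · exact Or.inr (Or.inr h3)

/-- A set of edges gives rise to at most twice as many ordered pairs. -/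
theorem card_ordered_le (D : Finset (Sym2 (Fin n))) :
    (Finset.univ.filter fun p : Fin n × Fin n => s(p.1, p.2) ∈ D).card ≤ 2 * D.card := by
  refine (Finset.card_le_mul_card_image_of_maps_to (f := fun p => s(p.1, p.2)) (t := D) ?_ 2 ?_)
  · intro p hp
    exact (Finset.mem_filter.1 hp).2
  · intro e _
    induction e using Sym2.ind with
    | _ x y =>
    have hsub : (Finset.univ.filter fun p : Fin n × Fin n => s(p.1, p.2) ∈ D).filter
        (fun p => s(p.1, p.2) = s(x, y)) ⊆ {(x, y), (y, x)} := by
      rintro ⟨a, b⟩ hp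
      have := (Finset.mem_filter.1 hp).2
      simpa using this
    exact (Finset.card_le_card hsub).trans Finset.card_le_two

end Strategy

/-! ### Live edges and pools -/

section Pools

variable {n : ℕ} {C B : Finset (Sym2 (Fin n))} {k q : ℕ} {Ls : Finset (Fin n × Fin n)}
  {Ts Ds : Finset (Fin n)}

/-- A set of vertex-disjoint live edges `(s, x)`: Constructor has claimed `sx`, she may claim two
more edges at `s` and one more at `x`. -/
structure LiveSet (C : Finset (Sym2 (Fin n))) (Ls : Finset (Fin n × Fin n)) : Prop where
  adj : ∀ p ∈ Ls, (graphOf C).Adj p.1 p.2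
  fst : ∀ p ∈ Ls, degreeIn C p.1 ≤ 2
  snd : ∀ p ∈ Ls, degreeIn C p.2 ≤ 3
  disj : ∀ p ∈ Ls, ∀ q ∈ Ls, p ≠ q → p.1 ≠ q.1 ∧ p.1 ≠ q.2 ∧ p.2 ≠ q.1 ∧ p.2 ≠ q.2

theorem degreeIn_insert_of_ne {u v w : Fin n} (hu : w ≠ u) (hv : w ≠ v) :
    degreeIn (insert s(u, v) C) w ≤ degreeIn C w := by
  have := degreeIn_insert_le (C := C) u v w
  rwa [if_neg (by tauto)] at this

theorem degreeIn_insert_le_add_one (u v w : Fin n) :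
    degreeIn (insert s(u, v) C) w ≤ degreeIn C w + 1 := by
  have := degreeIn_insert_le (C := C) u v w
  split_ifs at this <;> omega

theorem adj_insert {u v x y : Fin n} (h : (graphOf C).Adj x y) :
    (graphOf (insert s(u, v) C)).Adj x y :=
  graphOf_mono (Finset.subset_insert _ _) h

theorem LiveSet.mono (h : LiveSet C Ls) {Ls' : Finset (Fin n × Fin n)} (hs : Ls' ⊆ Ls) :
    LiveSet C Ls' :=
  ⟨fun p hp => h.adj p (hs hp), fun p hp => h.fst p (hs hp), fun p hp => h.snd p (hs hp),
    fun p hp q hq => h.disj p (hs hp) q (hs hq)⟩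

theorem LiveSet.insert_edge (h : LiveSet C Ls) {u v : Fin n} (hu : ∀ p ∈ Ls, p.1 ≠ u ∧ p.2 ≠ u)
    (hv : ∀ p ∈ Ls, p.1 ≠ v ∧ p.2 ≠ v) : LiveSet (insert s(u, v) C) Ls where
  adj := fun p hp => adj_insert (h.adj p hp)
  fst := fun p hp => (degreeIn_insert_of_ne (hu p hp).1 (hv p hp).1).trans (h.fst p hp)
  snd := fun p hp => (degreeIn_insert_of_ne (hu p hp).2 (hv p hp).2).trans (h.snd p hp)
  disj := h.disj

theorem LiveSet.insert_pair (h : LiveSet C Ls) {s x : Fin n} (hsx : (graphOf C).Adj s x)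
    (hs : degreeIn C s ≤ 2) (hx : degreeIn C x ≤ 3) (hs' : ∀ p ∈ Ls, p.1 ≠ s ∧ p.2 ≠ s)
    (hx' : ∀ p ∈ Ls, p.1 ≠ x ∧ p.2 ≠ x) : LiveSet C (insert (s, x) Ls) where
  adj := by simpa [hsx] using h.adj
  fst := by simpa [hs] using h.fst
  snd := by simpa [hx] using h.snd
  disj := by
    intro p hp q hq hpq
    rw [Finset.mem_insert] at hp hq
    rcases hp with rfl | hp <;> rcases hq with rfl | hq
    · exact absurd rfl hpq
    · have := hs' q hq
      have := hx' q hq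
      tauto
    · have := hs' p hp
      have := hx' p hp
      tauto
    · exact h.disj p hp q hq hpq

/-- If the set `D` of claimed edges is small compared to the number of pairs of live edges, then for
two of the live edges the three connecting pairs that are needed are unclaimed. -/
theorem LiveSet.exists_pair (h : LiveSet C Ls) (D : Finset (Sym2 (Fin n)))
    (hD : 2 * D.card < Ls.card * Ls.card - Ls.card) :
    ∃ p ∈ Ls, ∃ q ∈ Ls, p ≠ q ∧ s(p.1, q.1) ∉ D ∧ s(p.1, q.2) ∉ D ∧ s(q.1, p.2) ∉ D := by
  by_contra! hno
  have key : ∀ r : (Fin n × Fin n) × (Fin n × Fin n), ∃ e : Fin n × Fin n, r ∈ Ls.offDiag →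
      s(e.1, e.2) ∈ D ∧ (e.1 = r.1.1 ∨ e.1 = r.1.2) ∧ (e.2 = r.2.1 ∨ e.2 = r.2.2) := by
    intro r
    by_cases hr : r ∈ Ls.offDiag
    · obtain ⟨h1, h2, h3⟩ := Finset.mem_offDiag.1 hr
      have h4 := hno r.1 h1 r.2 h2 h3
      by_cases h5 : s(r.1.1, r.2.1) ∈ D
      · exact ⟨(r.1.1, r.2.1), fun _ => ⟨h5, Or.inl rfl, Or.inl rfl⟩⟩
      by_cases h6 : s(r.1.1, r.2.2) ∈ D
      · exact ⟨(r.1.1, r.2.2), fun _ => ⟨h6, Or.inl rfl, Or.inr rfl⟩⟩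
      have h7 := h4 h5 h6
      rw [Sym2.eq_swap] at h7
      exact ⟨(r.1.2, r.2.1), fun _ => ⟨h7, Or.inr rfl, Or.inl rfl⟩⟩
    · exact ⟨r.1, fun h => absurd h hr⟩
  choose f hf using key
  have hle : Ls.offDiag.card ≤
      (Finset.univ.filter fun p : Fin n × Fin n => s(p.1, p.2) ∈ D).card := by
    refine Finset.card_le_card_of_injOn f ?_ ?_
    · intro r hr
      simpa using (hf r hr).1
    · intro r hr r' hr' hrr
      obtain ⟨a1, a2, -⟩ := Finset.mem_offDiag.1 hr
      obtain ⟨b1, b2, -⟩ := Finset.mem_offDiag.1 hr'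
      obtain ⟨-, c1, d1⟩ := hf r hr
      obtain ⟨-, c2, d2⟩ := hf r' hr'
      rw [hrr] at c1 d1
      refine Prod.ext ?_ ?_
      · by_contra hne
        have := h.disj _ a1 _ b1 hne
        clear hno hf hD
        grind
      · by_contra hne
        have := h.disj _ a2 _ b2 hne
        clear hno hf hD
        grind
  rw [Finset.offDiag_card] at hle
  have := card_ordered_le D
  omega

theorem Position.card_union_le (h : Position C B) : (C ∪ B).card ≤ 4 * n := by
  have h1 := Finset.card_union_le C B
  have h2 := h.card_le
  have h3 := h.card
  omega

/-- Joining two live edges gains a triangle, and this can be repeated until fewer than `4 * q` live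
edges are left, where `q` exceeds `√n`. -/
theorem LiveSet.le_value (hq : n < q * q) (h : LiveSet C Ls) (hp : Position C B)
    (hk : 2 * k + 4 * q ≤ 2 * triangles C + Ls.card) : k ≤ value C B := by
  induction hm : Ls.card using Nat.strong_induction_on generalizing Ls C B with
  | _ m ih =>
  subst hm
  by_cases hlt : Ls.card < 4 * q
  · exact le_trans (by omega) triangles_le_value
  rw [not_lt] at hlt
  have hD : 2 * (C ∪ B).card < Ls.card * Ls.card - Ls.card := by
    have h1 := hp.card_union_le
    have hq1 : 1 ≤ q := Nat.pos_of_ne_zero (by rintro rfl; omega)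
    have h2 : 2 * (C ∪ B).card + Ls.card < Ls.card * Ls.card := by nlinarith
    omega
  obtain ⟨⟨s, x⟩, hsx, ⟨t, y⟩, hty, hne, h1, h2, h3⟩ := h.exists_pair _ hD
  simp only at h1 h2 h3
  obtain ⟨n1, n2, n3, n4⟩ := h.disj _ hsx _ hty hne
  have asx := h.adj _ hsx
  have aty := h.adj _ hty
  have ds := h.fst _ hsx
  have dx := h.snd _ hsx
  have dt := h.fst _ hty
  have dy := h.snd _ hty
  simp only at n1 n2 n3 n4 asx aty ds dx dt dy
  have nsx := asx.ne
  have nty := aty.ne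
  rw [Finset.mem_union, not_or] at h1 h2 h3
  have ds' := degreeIn_insert_le_add_one (C := C) s t s
  have dt' := degreeIn_insert_le_add_one (C := C) s t t
  have dx' := degreeIn_insert_of_ne (C := C) nsx.symm n3
  have dy' := degreeIn_insert_of_ne (C := C) n2.symm nty.symm
  have hst : (graphOf (insert s(s, t) C)).Adj s t := by
    rw [graphOf_insert_adj n1]; simp
  have m1 : s(s, y) ∉ insert s(s, t) C := by
    rw [Finset.mem_insert, not_or, Sym2.eq_iff]
    exact ⟨by grind, h2.1⟩
  have m2 : s(t, x) ∉ insert s(s, t) C := by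
    rw [Finset.mem_insert, not_or, Sym2.eq_iff]
    exact ⟨by grind, h3.1⟩
  -- after `st`, each of `sy` and `tx` completes a triangle, and Blocker can claim only one of them
  refine hp.double n1 h1.1 h1.2 (by omega) (by omega) n2 n3.symm (by rw [Ne, Sym2.eq_iff]; grind)
    m1 m2 h2.2 h3.2 (by omega) (by omega) (by omega) (by omega) ?_
  intro e he B' b₁ b₂ hB' hp'
  have htri : triangles C + 1 ≤ triangles (insert e (insert s(s, t) C)) := by
    have h5 := triangles_mono (Finset.subset_insert s(s, t) C)
    rcases he with rfl | rfl
    · have := triangles_insert hst (adj_insert aty.symm) n2 m1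
      omega
    · have := triangles_insert hst.symm (adj_insert asx.symm) n3.symm m2
      omega
  have hL : LiveSet (insert e (insert s(s, t) C)) ((Ls.erase (s, x)).erase (t, y)) := by
    have hno : ∀ p ∈ (Ls.erase (s, x)).erase (t, y), (p.1 ≠ s ∧ p.2 ≠ s) ∧ (p.1 ≠ t ∧ p.2 ≠ t) ∧
        (p.1 ≠ x ∧ p.2 ≠ x) ∧ (p.1 ≠ y ∧ p.2 ≠ y) := by
      intro p hp
      simp only [Finset.mem_erase] at hp
      have h6 := h.disj _ hp.2.2 _ hsx hp.2.1
      have h7 := h.disj _ hp.2.2 _ hty hp.1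
      simp only at h6 h7
      tauto
    have h8 := ((h.mono ((Finset.erase_subset _ _).trans (Finset.erase_subset _ _))).insert_edge
      (fun p hp => (hno p hp).1) (fun p hp => (hno p hp).2.1))
    rcases he with rfl | rfl
    · exact h8.insert_edge (fun p hp => (hno p hp).1) (fun p hp => (hno p hp).2.2.2)
    · exact h8.insert_edge (fun p hp => (hno p hp).2.1) (fun p hp => (hno p hp).2.2.1)
  have hc : ((Ls.erase (s, x)).erase (t, y)).card + 2 = Ls.card := by
    have h6 : (t, y) ∈ Ls.erase (s, x) := Finset.mem_erase.2 ⟨hne.symm, hty⟩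
    rw [Finset.card_erase_of_mem h6, Finset.card_erase_of_mem hsx]
    have : 0 < (Ls.erase (s, x)).card := Finset.card_pos.2 ⟨_, h6⟩
    rw [Finset.card_erase_of_mem hsx] at this
    omega
  exact ih _ (by omega) hL hp' (by omega) rfl

/-- The material left over from finished units: live edges `Ls`, vertices `Ts` of degree at most one
and vertices `Ds` of degree at most two, all of them vertex-disjoint. -/
structure Pools (C : Finset (Sym2 (Fin n))) (Ts Ds : Finset (Fin n)) (Ls : Finset (Fin n × Fin n)) :
    Prop where
  live : LiveSet C Ls
  one : ∀ a ∈ Ts, degreeIn C a ≤ 1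
  two : ∀ a ∈ Ds, degreeIn C a ≤ 2
  disj : ∀ a ∈ Ts, a ∉ Ds
  disj_live : ∀ a, a ∈ Ts ∨ a ∈ Ds → ∀ p ∈ Ls, p.1 ≠ a ∧ p.2 ≠ a

theorem Pools.insert_edge (h : Pools C Ts Ds Ls) {u v : Fin n}
    (hu : u ∉ Ts ∧ u ∉ Ds ∧ ∀ p ∈ Ls, p.1 ≠ u ∧ p.2 ≠ u)
    (hv : v ∉ Ts ∧ v ∉ Ds ∧ ∀ p ∈ Ls, p.1 ≠ v ∧ p.2 ≠ v) : Pools (insert s(u, v) C) Ts Ds Ls where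
  live := h.live.insert_edge hu.2.2 hv.2.2
  one := fun a ha => (degreeIn_insert_of_ne (ne_of_mem_of_not_mem ha hu.1)
    (ne_of_mem_of_not_mem ha hv.1)).trans (h.one a ha)
  two := fun a ha => (degreeIn_insert_of_ne (ne_of_mem_of_not_mem ha hu.2.1)
    (ne_of_mem_of_not_mem ha hv.2.1)).trans (h.two a ha)
  disj := h.disj
  disj_live := h.disj_live

/-- Joining a vertex of `Ts` to a vertex of `Ds` creates a live edge, so that each element of `Ts`
is worth half a triangle, just as a live edge. -/
theorem Pools.le_value (hq : n < q * q) (h : Pools C Ts Ds Ls) (hp : Position C B)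
    (hcard : Ts.card = Ds.card)
    (hk : 2 * k + 6 * q ≤ 2 * triangles C + Ls.card + Ts.card) : k ≤ value C B := by
  induction hm : Ts.card using Nat.strong_induction_on generalizing Ts Ds Ls C B with
  | _ m ih =>
  subst hm
  by_cases hlt : Ts.card < 2 * q
  · exact h.live.le_value hq hp (by omega)
  rw [not_lt] at hlt
  obtain ⟨a, ha, b, hb, hab⟩ : ∃ a ∈ Ts, ∃ b ∈ Ds, s(a, b) ∉ C ∪ B := by
    by_contra! hno
    have h1 : (Ts ×ˢ Ds).card ≤ (C ∪ B).card := by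
      refine Finset.card_le_card_of_injOn (fun p => s(p.1, p.2)) ?_ ?_
      · rintro ⟨a, b⟩ hab
        rw [Finset.mem_coe, Finset.mem_product] at hab
        exact hno a hab.1 b hab.2
      · rintro ⟨a, b⟩ hab ⟨a', b'⟩ hab' heq
        simp only [Finset.mem_coe, Finset.mem_product] at hab hab'
        rcases Sym2.eq_iff.1 heq with ⟨h1, h2⟩ | ⟨h1, h2⟩
        · exact Prod.ext h1 h2
        · simp only at h1 h2
          exact absurd (h1 ▸ hab'.2) (h.disj a hab.1)
    rw [Finset.card_product, ← hcard] at h1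
    have h2 := hp.card_union_le
    nlinarith
  rw [Finset.mem_union, not_or] at hab
  have hne : a ≠ b := fun h' => h.disj a ha (h' ▸ hb)
  have da := h.one a ha
  have db := h.two b hb
  have hLa := h.disj_live a (Or.inl ha)
  have hLb := h.disj_live b (Or.inr hb)
  -- no triangle yet, but the new edge is live, whatever Blocker replies
  refine hp.play hne hab.1 hab.2 (by omega) (by omega) fun B' c _ hp' => ?_
  have hlive : LiveSet (insert s(a, b) C) (insert (a, b) Ls) := by
    refine (h.live.insert_edge hLa hLb).insert_pair ?_ ?_ ?_ hLa hLb
    · rw [graphOf_insert_adj hne]; simp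
    · exact (degreeIn_insert_le_add_one _ _ _).trans (by omega)
    · exact (degreeIn_insert_le_add_one _ _ _).trans (by omega)
  have hpool : Pools (insert s(a, b) C) (Ts.erase a) (Ds.erase b) (insert (a, b) Ls) := by
    refine ⟨hlive, fun x hx => ?_, fun x hx => ?_, fun x hx hx' => ?_, fun x hx p hp => ?_⟩
    · obtain ⟨h1, h2⟩ := Finset.mem_erase.1 hx
      exact (degreeIn_insert_of_ne h1 fun h' => h.disj x h2 (h' ▸ hb)).trans (h.one x h2)
    · obtain ⟨h1, h2⟩ := Finset.mem_erase.1 hx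
      exact (degreeIn_insert_of_ne (ne_of_mem_of_not_mem h2 (h.disj a ha)) h1).trans (h.two x h2)
    · exact h.disj x (Finset.mem_of_mem_erase hx) (Finset.mem_of_mem_erase hx')
    · rw [Finset.mem_insert] at hp
      rcases hp with rfl | hp
      · rcases hx with hx | hx
        · obtain ⟨h1, h2⟩ := Finset.mem_erase.1 hx
          exact ⟨h1.symm, fun h' => h.disj x h2 (h' ▸ hb)⟩
        · obtain ⟨h1, h2⟩ := Finset.mem_erase.1 hx
          exact ⟨(ne_of_mem_of_not_mem h2 (h.disj a ha)).symm, h1.symm⟩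
      · exact h.disj_live x (hx.imp Finset.mem_of_mem_erase Finset.mem_of_mem_erase) p hp
  have hnot : (a, b) ∉ Ls := fun h' => (hLa _ h').1 rfl
  have h5 := triangles_mono (Finset.subset_insert s(a, b) C)
  have h6 : (Ts.erase a).card + 1 = Ts.card := Finset.card_erase_add_one ha
  have h7 : (Ds.erase b).card + 1 = Ds.card := Finset.card_erase_add_one hb
  have h8 : (insert (a, b) Ls).card = Ls.card + 1 := Finset.card_insert_of_notMem hnot
  exact ih _ (by omega) hpool hp' (by omega) (by omega) rfl

end Pools

/-! ### Building units of six vertices -/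

section Building

variable {n : ℕ} {C B : Finset (Sym2 (Fin n))} {k q τ : ℕ} {Ls : Finset (Fin n × Fin n)}
  {Ts Ds F R S : Finset (Fin n)}

/-- The situation while Constructor builds a unit: `S` is the set of vertices of the current unit,
`F` consists of these and of the fresh vertices, and `Ts`, `Ds`, `Ls` are the pools of leftovers of
the earlier units. -/
structure Site (C : Finset (Sym2 (Fin n))) (F S Ts Ds : Finset (Fin n))
    (Ls : Finset (Fin n × Fin n)) : Prop where
  pools : Pools C Ts Ds Ls
  off : ∀ a ∈ F, a ∉ Ts ∧ a ∉ Ds ∧ ∀ p ∈ Ls, p.1 ≠ a ∧ p.2 ≠ a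
  subset : S ⊆ F
  fresh : ∀ a ∈ F, a ∉ S → degreeIn C a = 0

/-- A reserve `R` of fresh vertices such that Blocker has claimed no pair inside `R` or between `R`
and the current unit `S`. -/
structure Clean (B : Finset (Sym2 (Fin n))) (F R S : Finset (Fin n)) : Prop where
  subset : R ⊆ F
  disj : ∀ r ∈ R, r ∉ S
  clean : ∀ r ∈ R, ∀ w, w ∈ R ∨ w ∈ S → r ≠ w → s(r, w) ∉ B

theorem Site.insert_edge (h : Site C F S Ts Ds Ls) {u v : Fin n} (hu : u ∈ S) (hv : v ∈ F) :
    Site (insert s(u, v) C) F (insert v S) Ts Ds Ls where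
  pools := h.pools.insert_edge (h.off u (h.subset hu)) (h.off v hv)
  off := h.off
  subset := Finset.insert_subset hv h.subset
  fresh := by
    intro a ha haS
    rw [Finset.mem_insert, not_or] at haS
    have h1 := degreeIn_insert_of_ne (C := C) (ne_of_mem_of_not_mem hu haS.2).symm haS.1
    have h2 := h.fresh a ha haS.2
    omega

/-- One vertex of the reserve joins the unit, and at most four more are removed, namely the ends of
Blocker's two latest edges. -/
theorem Clean.reply (h : Clean B F R S) {B' : Finset (Sym2 (Fin n))} {b₁ b₂ : Sym2 (Fin n)}
    (hB : ∀ e ∈ B', e ∈ B ∨ e = b₁ ∨ e = b₂) {r : Fin n} (hr : r ∈ R) :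
    ∃ R', Clean B' F R' (insert r S) ∧ R.card ≤ R'.card + 5 := by
  have hsub : R \ insert r (b₁.toFinset ∪ b₂.toFinset) ⊆ R := Finset.sdiff_subset
  refine ⟨R \ insert r (b₁.toFinset ∪ b₂.toFinset), ⟨hsub.trans h.subset, ?_, ?_⟩, ?_⟩
  · intro a ha
    simp only [Finset.mem_sdiff, Finset.mem_insert, not_or] at ha ⊢
    exact ⟨ha.2.1, h.disj a ha.1⟩
  · intro a ha w hw haw he
    simp only [Finset.mem_sdiff, Finset.mem_insert, Finset.mem_union, Sym2.mem_toFinset,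
      not_or] at ha
    rcases hB _ he with h1 | rfl | rfl
    · refine h.clean a ha.1 w ?_ haw h1
      rcases hw with hw | hw
      · exact Or.inl (hsub hw)
      · rcases Finset.mem_insert.1 hw with rfl | hw
        · exact Or.inl hr
        · exact Or.inr hw
    · exact ha.2.2.1 (Sym2.mem_mk_left _ _)
    · exact ha.2.2.2 (Sym2.mem_mk_left _ _)
  · have h1 := Finset.le_card_sdiff (insert r (b₁.toFinset ∪ b₂.toFinset)) R
    have h2 := Finset.card_insert_le r (b₁.toFinset ∪ b₂.toFinset)
    have h3 := Finset.card_union_le b₁.toFinset b₂.toFinset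
    have h4 : ∀ b : Sym2 (Fin n), b.toFinset.card ≤ 2 := by
      intro b
      rw [Sym2.card_toFinset]
      split_ifs <;> omega
    have h5 := h4 b₁
    have h6 := h4 b₂
    omega

/-- Constructor joins a fresh vertex `r` to the vertex `y` of the unit. -/
theorem Site.attach (h : Site C F S Ts Ds Ls) (hp : Position C B) (hc : Clean B F R S)
    {y r : Fin n} (hy : y ∈ S) (hr : r ∈ R) (hdy : degreeIn C y ≤ 3)
    (hk : ∀ B' R', Position (insert s(y, r) C) B' → Site (insert s(y,
      r) C) F (insert r S) Ts Ds Ls →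
      Clean B' F R' (insert r S) → R.card ≤ R'.card + 5 → k ≤ value (insert s(y, r) C) B') :
    k ≤ value C B := by
  have hrF := hc.subset hr
  have hrS := hc.disj r hr
  have hr0 := h.fresh r hrF hrS
  have hne : y ≠ r := ne_of_mem_of_not_mem hy hrS
  refine hp.play hne ?_ ?_ hdy (by omega) fun B' b hB' hp' => ?_
  · rw [Sym2.eq_swap]
    exact notMem_of_degreeIn_eq_zero hr0
  · rw [Sym2.eq_swap]
    exact hc.clean r hr y (Or.inr hy) hne.symm
  · obtain ⟨R', h1, h2⟩ := hc.reply (b₁ := b) (b₂ := b) (fun e he => by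
      rcases hB' e he with h | h <;> simp [h]) hr
    exact hk B' R' hp' (h.insert_edge hy hrF) h1 h2

/-- The effect of attaching the fresh vertex `r` to the adjacent vertices `y` and `c`: one more
triangle, and degrees increase only at these three vertices. -/
structure Grown (C C' : Finset (Sym2 (Fin n))) (y c r : Fin n) : Prop where
  adj_c : (graphOf C').Adj c r
  adj_y : (graphOf C').Adj y r
  mono : ∀ {a b}, (graphOf C).Adj a b → (graphOf C').Adj a b
  deg_y : degreeIn C' y ≤ degreeIn C y + 1
  deg_c : degreeIn C' c ≤ degreeIn C c + 1
  deg_r : degreeIn C' r ≤ 2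
  deg_other : ∀ {w}, w ≠ y → w ≠ c → w ≠ r → degreeIn C' w ≤ degreeIn C w
  tri : triangles C + 1 ≤ triangles C'

/-- Constructor joins a fresh vertex `r` to `y`, and then to one of two neighbours `a`, `b` of `y`:
Blocker can prevent only one of the two triangles, so she gains one. It is Blocker who decides
which. -/
theorem Site.grow (h : Site C F S Ts Ds Ls) (hp : Position C B) (hc : Clean B F R S)
    {y a b r : Fin n} (hy : y ∈ S) (ha : a ∈ S) (hb : b ∈ S) (hr : r ∈ R) (hab : a ≠ b)
    (hya : (graphOf C).Adj y a) (hyb : (graphOf C).Adj y b)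
    (hdy : degreeIn C y ≤ 3) (hda : degreeIn C a ≤ 3) (hdb : degreeIn C b ≤ 3)
    (hk : ∀ c, c = a ∨ c = b → ∀ C' B' R', Position C' B' → Site C' F (insert r S) Ts Ds Ls →
      Clean B' F R' (insert r S) → R.card ≤ R'.card + 5 → Grown C C' y c r → k ≤ value C' B') :
    k ≤ value C B := by
  have hrF := hc.subset hr
  have hrS := hc.disj r hr
  have hr0 := h.fresh r hrF hrS
  have hC : ∀ w, s(w, r) ∉ C := fun w => by
    rw [Sym2.eq_swap]
    exact notMem_of_degreeIn_eq_zero hr0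
  have nyr : y ≠ r := ne_of_mem_of_not_mem hy hrS
  have hB : ∀ w ∈ S, s(w, r) ∉ B := fun w hw => by
    rw [Sym2.eq_swap]
    exact hc.clean r hr w (Or.inr hw) (ne_of_mem_of_not_mem hw hrS).symm
  have hC1 : ∀ w ∈ S, y ≠ w → s(w, r) ∉ insert s(y, r) C := by
    intro w hw hyw
    rw [Finset.mem_insert, not_or]
    exact ⟨fun h' => hyw (Sym2.congr_left.1 h').symm, hC w⟩
  have hdr : degreeIn (insert s(y,
    r) C) r ≤ 1 := (degreeIn_insert_le_add_one _ _ _).trans (by omega)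
  have nar : a ≠ r := ne_of_mem_of_not_mem ha hrS
  have nbr : b ≠ r := ne_of_mem_of_not_mem hb hrS
  refine hp.double nyr (hC y) (hB y hy) hdy (by omega) nar nbr (fun h' => hab
    (Sym2.congr_left.1 h'))
    (hC1 a ha hya.ne) (hC1 b hb hyb.ne) (hB a ha) (hB b hb)
    ((degreeIn_insert_of_ne hya.ne.symm nar).trans hda) (by omega)
    ((degreeIn_insert_of_ne hyb.ne.symm nbr).trans hdb) (by omega) ?_
  intro e he B' b₁ b₂ hB' hp'
  obtain ⟨c, hc', rfl⟩ : ∃ c, (c = a ∨ c = b) ∧ e = s(c, r) := by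
    rcases he with rfl | rfl
    · exact ⟨a, Or.inl rfl, rfl⟩
    · exact ⟨b, Or.inr rfl, rfl⟩
  have hyc : (graphOf C).Adj y c := by rcases hc' with rfl | rfl <;> assumption
  have hcS : c ∈ S := by rcases hc' with rfl | rfl <;> assumption
  have ncr : c ≠ r := ne_of_mem_of_not_mem hcS hrS
  obtain ⟨R', h1, h2⟩ := hc.reply hB' hr
  have hsite := (h.insert_edge hy hrF).insert_edge (u := c) (Finset.mem_insert_of_mem hcS) hrF
  rw [Finset.insert_idem] at hsite
  have hyr : (graphOf (insert s(y, r) C)).Adj y r := by rw [graphOf_insert_adj nyr]; simp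
  refine hk c hc' _ B' R' hp' hsite h1 h2 ⟨?_, adj_insert hyr, fun h => adj_insert (adj_insert h),
    ?_, ?_, ?_, ?_, ?_⟩
  · rw [graphOf_insert_adj ncr]; simp
  · exact (degreeIn_insert_of_ne hyc.ne nyr).trans (degreeIn_insert_le_add_one _ _ _)
  · have := degreeIn_insert_le_add_one (C := insert s(y, r) C) c r c
    have := degreeIn_insert_of_ne (C := C) hyc.ne.symm ncr
    omega
  · exact (degreeIn_insert_le_add_one _ _ _).trans (by omega)
  · intro w w1 w2 w3
    exact (degreeIn_insert_of_ne w2 w3).trans (degreeIn_insert_of_ne w1 w3)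
  · have := triangles_mono (Finset.subset_insert s(y, r) C)
    have := triangles_insert (adj_insert hyc.symm) hyr.symm ncr (hC1 c hcS hyc.ne)
    omega

/-- To prove `k ≤ value C B` it suffices to finish the current unit: it has at most six vertices,
Constructor has at least `τ` triangles, and the unit contains a vertex `t` of degree at most one, a
vertex `d` of degree at most two and a live edge `sx`, all disjoint. -/
def Suffices (k τ : ℕ) (F Ts Ds : Finset (Fin n)) (Ls : Finset (Fin n × Fin n)) : Prop :=
  ∀ C' B' S' t d s x, Position C' B' → Site C' F S' Ts Ds Ls → S'.card ≤ 6 → τ ≤ triangles C' →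
    t ∈ S' → d ∈ S' → s ∈ S' → x ∈ S' → t ≠ d → t ≠ s → t ≠ x → d ≠ s → d ≠ x →
    (graphOf C').Adj s x → degreeIn C' t ≤ 1 → degreeIn C' d ≤ 2 → degreeIn C' s ≤ 2 →
    degreeIn C' x ≤ 3 → k ≤ value C' B'

/-- The last triangle of a unit, over the path `x y t` whose ends `x` and `t` have degree at most
two. The new vertex and the end it has been joined to form the live edge, and the other end is the
vertex of degree at most two. -/
theorem Site.last_of_light (hs : Suffices k τ F Ts Ds Ls) (h : Site C F S Ts Ds Ls)
    (hp : Position C B) (hc : Clean B F R S) (hR : 1 ≤ R.card) (hS : S.card ≤ 5)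
    (ht : τ ≤ triangles C + 1) {y x t z : Fin n} (hy : y ∈ S) (hx : x ∈ S) (ht' : t ∈ S)
    (hz : z ∈ S) (hyx : (graphOf C).Adj y x) (hyt : (graphOf C).Adj y t) (hxt : x ≠ t)
    (hyz : y ≠ z) (hxz : x ≠ z) (htz : t ≠ z) (dy : degreeIn C y ≤ 3) (dx : degreeIn C x ≤ 2)
    (dt : degreeIn C t ≤ 2) (dz : degreeIn C z ≤ 1) : k ≤ value C B := by
  obtain ⟨r, hr⟩ := Finset.card_pos.1 hR
  have hrS := hc.disj r hr
  refine h.grow hp hc hy hx ht' hr hxt hyx hyt dy (by omega) (by omega) ?_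
  have nxr := ne_of_mem_of_not_mem hx hrS
  have ntr := ne_of_mem_of_not_mem ht' hrS
  have nzr := ne_of_mem_of_not_mem hz hrS
  have hcard : (insert r S).card ≤ 6 := (Finset.card_insert_le _ _).trans (by omega)
  have hm : ∀ w, w ∈ S → w ∈ insert r S := fun w => Finset.mem_insert_of_mem
  have hm' := Finset.mem_insert_self r S
  rintro c (rfl | rfl) C' B' R' hp' h' - - hg
  · have := hg.tri
    have := hg.deg_c
    have := hg.deg_other hyz.symm hxz.symm nzr
    have := hg.deg_other hyt.ne.symm hxt.symm ntr
    exact hs C' B' _ z t r c hp' h' hcard (by omega) (hm _ hz) (hm _ ht') hm' (hm _ hx) htz.symm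
      nzr hxz.symm ntr hxt.symm hg.adj_c.symm (by omega) (by omega) hg.deg_r (by omega)
  · have := hg.tri
    have := hg.deg_c
    have := hg.deg_other hyz.symm htz.symm nzr
    have := hg.deg_other hyx.ne.symm hxt nxr
    exact hs C' B' _ z x r c hp' h' hcard (by omega) (hm _ hz) (hm _ hx) hm' (hm _ ht') hxz.symm
      nzr htz.symm nxr hxt hg.adj_c.symm (by omega) (by omega) hg.deg_r (by omega)

/-- The last triangle of a unit which contains the four-cycle `u y t x`, over the path `y u x`. The
edge between `t` and the end of the path that has not been used is the live edge, and the new vertex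
is the vertex of degree at most two. -/
theorem Site.last_of_heavy (hs : Suffices k τ F Ts Ds Ls) (h : Site C F S Ts Ds Ls)
    (hp : Position C B) (hc : Clean B F R S) (hR : 1 ≤ R.card) (hS : S.card ≤ 5)
    (ht : τ ≤ triangles C + 1) {u y x t z : Fin n} (hu : u ∈ S) (hy : y ∈ S) (hx : x ∈ S)
    (ht' : t ∈ S) (hz : z ∈ S) (huy : (graphOf C).Adj u y) (hux : (graphOf C).Adj u x)
    (hty : (graphOf C).Adj t y) (htx : (graphOf C).Adj t x) (hyx : y ≠ x) (hut : u ≠ t)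
    (huz : u ≠ z) (hyz : y ≠ z) (hxz : x ≠ z) (htz : t ≠ z) (du : degreeIn C u ≤ 3)
    (dy : degreeIn C y ≤ 3) (dx : degreeIn C x ≤ 3) (dt : degreeIn C t ≤ 2)
    (dz : degreeIn C z ≤ 1) : k ≤ value C B := by
  obtain ⟨r, hr⟩ := Finset.card_pos.1 hR
  have hrS := hc.disj r hr
  refine h.grow hp hc hu hy hx hr hyx huy hux du dy dx ?_
  have nyr := ne_of_mem_of_not_mem hy hrS
  have nxr := ne_of_mem_of_not_mem hx hrS
  have ntr := ne_of_mem_of_not_mem ht' hrS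
  have nzr := ne_of_mem_of_not_mem hz hrS
  have hcard : (insert r S).card ≤ 6 := (Finset.card_insert_le _ _).trans (by omega)
  have hm : ∀ w, w ∈ S → w ∈ insert r S := fun w => Finset.mem_insert_of_mem
  have hm' := Finset.mem_insert_self r S
  rintro c (rfl | rfl) C' B' R' hp' h' - - hg
  · have := hg.tri
    have := hg.deg_other huz.symm hyz.symm nzr
    have := hg.deg_other hut.symm hty.ne ntr
    have := hg.deg_other hux.ne.symm hyx.symm nxr
    exact hs C' B' _ z r t x hp' h' hcard (by omega) (hm _ hz) hm' (hm _ ht') (hm _ hx) nzr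
      htz.symm hxz.symm ntr.symm nxr.symm (hg.mono htx) (by omega) hg.deg_r (by omega) (by omega)
  · have := hg.tri
    have := hg.deg_other huz.symm hxz.symm nzr
    have := hg.deg_other hut.symm htx.ne ntr
    have := hg.deg_other huy.ne.symm hyx nyr
    exact hs C' B' _ z r t y hp' h' hcard (by omega) (hm _ hz) hm' (hm _ ht') (hm _ hy) nzr
      htz.symm hyz.symm ntr.symm nyr.symm (hg.mono hty) (by omega) hg.deg_r (by omega) (by omega)

/-- Two more triangles from a triangle `uyx` and a vertex `z` of degree at most one (a leaf at `u`
when the lemma is used). A new vertex `t` is attached to `y` and then to `u` or `x`; both outcomes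
allow one further triangle. -/
theorem Site.of_paw (hs : Suffices k τ F Ts Ds Ls) (h : Site C F S Ts Ds Ls)
    (hp : Position C B) (hc : Clean B F R S) (hR : 6 ≤ R.card) (hS : S.card ≤ 4)
    (ht : τ ≤ triangles C + 2) {u y x z : Fin n} (hu : u ∈ S) (hy : y ∈ S) (hx : x ∈ S)
    (hz : z ∈ S) (huy : (graphOf C).Adj u y) (hux : (graphOf C).Adj u x)
    (hyx : (graphOf C).Adj y x) (huz : u ≠ z) (hyz : y ≠ z) (hxz : x ≠ z)
    (du : degreeIn C u ≤ 3) (dy : degreeIn C y ≤ 2) (dx : degreeIn C x ≤ 2)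
    (dz : degreeIn C z ≤ 1) : k ≤ value C B := by
  obtain ⟨t, ht'⟩ := Finset.card_pos.1 (show 0 < R.card by omega)
  have htS := hc.disj t ht'
  refine h.grow hp hc hy hu hx ht' hux.ne huy.symm hyx (by omega) du (by omega) ?_
  have nut := ne_of_mem_of_not_mem hu htS
  have nyt := ne_of_mem_of_not_mem hy htS
  have nxt := ne_of_mem_of_not_mem hx htS
  have nzt := ne_of_mem_of_not_mem hz htS
  have hcard : (insert t S).card ≤ 5 := (Finset.card_insert_le _ _).trans (by omega)
  have hm : ∀ w, w ∈ S → w ∈ insert t S := fun w => Finset.mem_insert_of_mem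
  have hm' := Finset.mem_insert_self t S
  rintro c (rfl | rfl) C' B' R' hp' h' hc' hR' hg
  · have := hg.tri
    have := hg.deg_y
    have := hg.deg_r
    have := hg.deg_other hyz.symm huz.symm nzt
    have := hg.deg_other hyx.ne.symm hux.ne.symm nxt
    exact h'.last_of_light hs hp' hc' (by omega) hcard (by omega) (hm _ hy) (hm _ hx) hm' (hm _ hz)
      (hg.mono hyx) hg.adj_y nxt hyz hxz nzt.symm (by omega) (by omega) (by omega) (by omega)
  · have := hg.tri
    have := hg.deg_y
    have := hg.deg_c
    have := hg.deg_r
    have := hg.deg_other hyz.symm hxz.symm nzt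
    have := hg.deg_other huy.ne hux.ne nut
    exact h'.last_of_heavy hs hp' hc' (by omega) hcard (by omega) (hm _ hu) (hm _ hy) (hm _ hx) hm'
      (hm _ hz) (hg.mono huy) (hg.mono hux) hg.adj_y.symm hg.adj_c.symm hyx.ne nut huz hyz hxz
      nzt.symm (by omega) (by omega) (by omega) (by omega) (by omega)

/-- Three triangles from the path `y u z`: a new vertex attached to `u` and to one of the ends gives
a triangle with a pendant edge. -/
theorem Site.of_path (hs : Suffices k τ F Ts Ds Ls) (h : Site C F S Ts Ds Ls)
    (hp : Position C B) (hc : Clean B F R S) (hR : 11 ≤ R.card) (hS : S.card ≤ 3)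
    (ht : τ ≤ triangles C + 3) {u y z : Fin n} (hu : u ∈ S) (hy : y ∈ S) (hz : z ∈ S)
    (huy : (graphOf C).Adj u y) (huz : (graphOf C).Adj u z) (hyz : y ≠ z)
    (du : degreeIn C u ≤ 2) (dy : degreeIn C y ≤ 1) (dz : degreeIn C z ≤ 1) : k ≤ value C B := by
  obtain ⟨x, hx⟩ := Finset.card_pos.1 (show 0 < R.card by omega)
  have hxS := hc.disj x hx
  refine h.grow hp hc hu hy hz hx hyz huy huz (by omega) (by omega) (by omega) ?_
  have nyx := ne_of_mem_of_not_mem hy hxS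
  have nzx := ne_of_mem_of_not_mem hz hxS
  have hcard : (insert x S).card ≤ 4 := (Finset.card_insert_le _ _).trans (by omega)
  have hm : ∀ w, w ∈ S → w ∈ insert x S := fun w => Finset.mem_insert_of_mem
  have hm' := Finset.mem_insert_self x S
  rintro c (rfl | rfl) C' B' R' hp' h' hc' hR' hg
  · have := hg.tri
    have := hg.deg_y
    have := hg.deg_c
    have := hg.deg_other huz.ne.symm hyz.symm nzx
    exact h'.of_paw hs hp' hc' (by omega) hcard (by omega) (hm _ hu) (hm _ hy) hm' (hm _ hz)
      (hg.mono huy) hg.adj_y hg.adj_c huz.ne hyz nzx.symm (by omega) (by omega) hg.deg_r (by omega)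
  · have := hg.tri
    have := hg.deg_y
    have := hg.deg_c
    have := hg.deg_other huy.ne.symm hyz nyx
    exact h'.of_paw hs hp' hc' (by omega) hcard (by omega) (hm _ hu) (hm _ hz) hm' (hm _ hy)
      (hg.mono huz) hg.adj_y hg.adj_c huy.ne hyz.symm nyx.symm (by omega) (by omega) hg.deg_r
      (by omega)

/-- A new unit with three triangles can be started from a reserve of `26 = 5 * 5 + 1` vertices: each
of the first five vertices of the unit uses up at most five vertices of the reserve, and one is
needed for the sixth. -/
theorem Site.of_empty (hs : Suffices k τ F Ts Ds Ls) (h : Site C F ∅ Ts Ds Ls)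
    (hp : Position C B) (hc : Clean B F R ∅) (hR : 26 ≤ R.card) (ht : τ ≤ triangles C + 3) :
    k ≤ value C B := by
  obtain ⟨u, hu⟩ := Finset.card_pos.1 (show 0 < R.card by omega)
  have du := h.fresh u (hc.subset hu) (Finset.notMem_empty _)
  -- no move is made for the first vertex `u`; the diagonal pair stands for an absent reply
  obtain ⟨R₁, hc₁, hR₁⟩ := hc.reply (B' := B) (b₁ := s(u, u)) (b₂ := s(u, u))
    (fun e he => Or.inl he) hu
  have h₁ : Site C F (insert u ∅) Ts Ds Ls :=
    ⟨h.pools, h.off, by simpa using hc.subset hu,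
      fun a ha _ => h.fresh a ha (Finset.notMem_empty _)⟩
  obtain ⟨y, hy⟩ := Finset.card_pos.1 (show 0 < R₁.card by omega)
  have hyS := hc₁.disj y hy
  have dy := h.fresh y (hc₁.subset hy) (Finset.notMem_empty _)
  have huS : u ∈ insert u (∅ : Finset (Fin n)) := Finset.mem_insert_self _ _
  have nuy := ne_of_mem_of_not_mem huS hyS
  refine h₁.attach hp hc₁ huS hy (by omega) fun B₂ R₂ hp₂ h₂ hc₂ hR₂ => ?_
  have huS₂ := Finset.mem_insert_of_mem (b := y) huS
  have hyS₂ := Finset.mem_insert_self y (insert u (∅ : Finset (Fin n)))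
  obtain ⟨z, hz⟩ := Finset.card_pos.1 (show 0 < R₂.card by omega)
  have hzS := hc₂.disj z hz
  have dz := h₂.fresh z (hc₂.subset hz) hzS
  have nuz := ne_of_mem_of_not_mem huS₂ hzS
  have nyz := ne_of_mem_of_not_mem hyS₂ hzS
  have du₂ := degreeIn_insert_le_add_one (C := C) u y u
  have dy₂ := degreeIn_insert_le_add_one (C := C) u y y
  refine h₂.attach hp₂ hc₂ huS₂ hz (by omega) fun B₃ R₃ hp₃ h₃ hc₃ hR₃ => ?_
  have du₃ := degreeIn_insert_le_add_one (C := insert s(u, y) C) u z u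
  have dz₃ := degreeIn_insert_le_add_one (C := insert s(u, y) C) u z z
  have dy₃ := degreeIn_insert_of_ne (C := insert s(u, y) C) nuy.symm nyz
  have ht₃ := triangles_mono ((Finset.subset_insert s(u, y) C).trans
    (Finset.subset_insert s(u, z) _))
  have a₁ : (graphOf (insert s(u, y) C)).Adj u y := by rw [graphOf_insert_adj nuy]; simp
  have a₂ : (graphOf (insert s(u, z) (insert s(u, y) C))).Adj u z := by
    rw [graphOf_insert_adj nuz]; simp
  exact h₃.of_path hs hp₃ hc₃ (by omega) Finset.card_le_three (by omega)
    (Finset.mem_insert_of_mem huS₂) (Finset.mem_insert_of_mem hyS₂) (Finset.mem_insert_self _ _)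
    (adj_insert a₁) a₂ nyz (by omega) (by omega) (by omega)

end Building

/-! ### The lower bound for triangles -/

section LowerBound

variable {n : ℕ} {C B : Finset (Sym2 (Fin n))} {k q τ : ℕ} {Ls : Finset (Fin n × Fin n)}
  {Ts Ds F R S : Finset (Fin n)}

/-- Greedy choice of `r` pairwise unrelated elements, when every element is related to at most `d`
others. -/
theorem exists_independent {V : Type*} [DecidableEq V] {bad : V → V → Prop} [DecidableRel bad]
    (hsymm : ∀ a b, bad a b → bad b a) (d r : ℕ) (F : Finset V)
    (hd : ∀ v ∈ F, (F.filter (bad v)).card ≤ d) (hr : r * (d + 1) ≤ F.card) :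
    ∃ R ⊆ F, R.card = r ∧ ∀ a ∈ R, ∀ b ∈ R, a ≠ b → ¬ bad a b := by
  induction r generalizing F with
  | zero => exact ⟨∅, Finset.empty_subset _, rfl, by simp⟩
  | succ r ih =>
    rw [Nat.succ_mul] at hr
    obtain ⟨v, hv⟩ := Finset.card_pos.1 (show 0 < F.card by omega)
    have hsub : F \ insert v (F.filter (bad v)) ⊆ F := Finset.sdiff_subset
    obtain ⟨R, hR, hcard, hind⟩ := ih (F \ insert v (F.filter (bad v)))
      (fun w hw => (Finset.card_le_card (Finset.filter_subset_filter _ hsub)).trans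
        (hd w (hsub hw))) (by
        have h1 := Finset.le_card_sdiff (insert v (F.filter (bad v))) F
        have h2 := Finset.card_insert_le v (F.filter (bad v))
        have h3 := hd v hv
        omega)
    have hRv : ∀ a ∈ R, a ≠ v ∧ ¬ bad v a := by
      intro a ha
      have := hR ha
      simp only [Finset.mem_sdiff, Finset.mem_insert, Finset.mem_filter, not_or, not_and] at this
      exact ⟨this.2.1, this.2.2 this.1⟩
    refine ⟨insert v R, Finset.insert_subset hv (hR.trans hsub), ?_, ?_⟩
    · rw [Finset.card_insert_of_notMem fun h => (hRv v h).1 rfl, hcard]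
    · intro a ha b hb hab
      rcases Finset.mem_insert.1 ha with rfl | ha' <;> rcases Finset.mem_insert.1 hb with rfl | hb'
      · exact absurd rfl hab
      · exact (hRv b hb').2
      · exact fun h => (hRv a ha').2 (hsymm _ _ h)
      · exact hind a ha' b hb' hab

/-- As long as `56 * q` fresh vertices are left, some `26` of them have no Blocker edge between
them. -/
theorem Position.exists_clean (hq : n < q * q) (hp : Position C B) (hF : 56 * q ≤ F.card) :
    ∃ R, Clean B F R ∅ ∧ 26 ≤ R.card := by
  set D : Fin n → ℕ := fun v => (Finset.univ.filter fun w => s(v, w) ∈ B).card with hD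
  -- fewer than `4 * q` vertices have more than `q` Blocker edges; among the others the greedy
  -- choice needs `26 * (q + 1)` vertices, and `4 * q + 26 * (q + 1) ≤ 56 * q`
  set H : Finset (Fin n) := Finset.univ.filter fun v => q < D v with hH
  have h1 : H.card * (q + 1) ≤ 4 * n := by
    have h2 : ∑ v, D v ≤ 2 * B.card := by
      refine le_trans (le_of_eq ?_) (card_ordered_le B)
      rw [Finset.card_filter, ← Finset.univ_product_univ, Finset.sum_product]
      refine Finset.sum_congr rfl fun v _ => ?_
      simp only [hD, Finset.card_filter]
    have h3 : H.card * (q + 1) ≤ ∑ v ∈ H, D v := by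
      rw [← smul_eq_mul]
      exact Finset.card_nsmul_le_sum _ _ _ fun v hv => (Finset.mem_filter.1 hv).2
    have h4 : ∑ v ∈ H, D v ≤ ∑ v, D v := Finset.sum_le_univ_sum_of_nonneg fun _ => Nat.zero_le _
    have h5 := hp.card
    have h6 := hp.card_le
    omega
  have h2 : H.card < 4 * q := by
    by_contra! hc
    have : 4 * q * (q + 1) ≤ H.card * (q + 1) := Nat.mul_le_mul_right _ hc
    nlinarith
  have hsub : F \ H ⊆ F := Finset.sdiff_subset
  obtain ⟨R, hR, hcard, hind⟩ := exists_independent (bad := fun a b => s(a, b) ∈ B)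
    (fun a b h => by rwa [Sym2.eq_swap]) q 26 (F \ H) (fun v hv => by
      have h3 := (Finset.mem_sdiff.1 hv).2
      simp only [hH, Finset.mem_filter, Finset.mem_univ, true_and, not_lt] at h3
      exact (Finset.card_le_card (Finset.filter_subset_filter _ (Finset.subset_univ _))).trans h3)
    (by
      have h3 := Finset.le_card_sdiff H F
      omega)
  refine ⟨R, ⟨hR.trans hsub, fun r _ => Finset.notMem_empty r, fun r hr w hw hrw => ?_⟩, hcard.ge⟩
  exact hind r hr w (hw.resolve_right (Finset.notMem_empty w)) hrw

/-- The value of a position between two units: every fresh vertex is worth `2/3` of a triangle,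
every live edge and every pair from `Ts` and `Ds` is worth half a triangle, up to an error of order
`q`, where `q` exceeds `√n`. -/
theorem Site.le_value (hq : n < q * q) (h : Site C F ∅ Ts Ds Ls) (hp : Position C B)
    (hcard : Ts.card = Ds.card)
    (hk : 12 * k + 484 * q ≤ 12 * triangles C + 6 * Ls.card + 6 * Ts.card + 8 * F.card) :
    k ≤ value C B := by
  induction hm : F.card using Nat.strong_induction_on generalizing F Ts Ds Ls C B with
  | _ m ih =>
  subst hm
  by_cases hlt : F.card < 56 * q
  · exact h.pools.le_value hq hp hcard (by omega)
  rw [not_lt] at hlt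
  obtain ⟨R, hc, hR⟩ := hp.exists_clean hq hlt
  -- the unit uses at most six of the fresh vertices, worth `4` triangles, and yields `3` triangles,
  -- a live edge and a pair of pool vertices
  refine h.of_empty (τ := triangles C + 3) ?_ hp hc hR le_rfl
  intro C' B' S' t d s x hp' h' hS ht tS dS sS xS td ts tx ds dx hsx gt gd gs gx
  have ot := h'.off t (h'.subset tS)
  have od := h'.off d (h'.subset dS)
  have os := h'.off s (h'.subset sS)
  have ox := h'.off x (h'.subset xS)
  have hlive := h'.pools.live.insert_pair hsx gs gx os.2.2 ox.2.2
  have hpools : Pools C' (insert t Ts) (insert d Ds) (insert (s, x) Ls) := by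
    refine ⟨hlive, ?_, ?_, ?_, ?_⟩
    · intro a ha
      rcases Finset.mem_insert.1 ha with rfl | ha
      · exact gt
      · exact h'.pools.one a ha
    · intro a ha
      rcases Finset.mem_insert.1 ha with rfl | ha
      · exact gd
      · exact h'.pools.two a ha
    · intro a ha ha'
      rcases Finset.mem_insert.1 ha with rfl | ha <;> rcases Finset.mem_insert.1 ha' with h1 | ha'
      · exact td h1
      · exact ot.2.1 ha'
      · exact od.1 (h1 ▸ ha)
      · exact h'.pools.disj a ha ha'
    · intro a ha p hp
      rw [Finset.mem_insert, Finset.mem_insert] at ha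
      rcases Finset.mem_insert.1 hp with rfl | hp
      · rcases ha with (rfl | ha) | (rfl | ha)
        · exact ⟨ts.symm, tx.symm⟩
        · exact ⟨(ne_of_mem_of_not_mem ha os.1).symm, (ne_of_mem_of_not_mem ha ox.1).symm⟩
        · exact ⟨ds.symm, dx.symm⟩
        · exact ⟨(ne_of_mem_of_not_mem ha os.2.1).symm, (ne_of_mem_of_not_mem ha ox.2.1).symm⟩
      · rcases ha with (rfl | ha) | (rfl | ha)
        · exact ot.2.2 p hp
        · exact h'.pools.disj_live a (Or.inl ha) p hp
        · exact od.2.2 p hp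
        · exact h'.pools.disj_live a (Or.inr ha) p hp
  have hsite : Site C' (F \ S') ∅ (insert t Ts) (insert d Ds) (insert (s, x) Ls) := by
    refine ⟨hpools, ?_, Finset.empty_subset _, ?_⟩
    · intro a ha
      obtain ⟨ha, haS⟩ := Finset.mem_sdiff.1 ha
      obtain ⟨o1, o2, o3⟩ := h'.off a ha
      refine ⟨?_, ?_, ?_⟩
      · rw [Finset.mem_insert, not_or]
        exact ⟨(ne_of_mem_of_not_mem tS haS).symm, o1⟩
      · rw [Finset.mem_insert, not_or]
        exact ⟨(ne_of_mem_of_not_mem dS haS).symm, o2⟩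
      · intro p hp
        rcases Finset.mem_insert.1 hp with rfl | hp
        · exact ⟨ne_of_mem_of_not_mem sS haS, ne_of_mem_of_not_mem xS haS⟩
        · exact o3 p hp
    · intro a ha _
      obtain ⟨ha, haS⟩ := Finset.mem_sdiff.1 ha
      exact h'.fresh a ha haS
  have c1 : (insert t Ts).card = Ts.card + 1 := Finset.card_insert_of_notMem ot.1
  have c2 : (insert d Ds).card = Ds.card + 1 := Finset.card_insert_of_notMem od.2.1
  have c3 : (insert (s, x) Ls).card = Ls.card + 1 :=
    Finset.card_insert_of_notMem fun hm => (os.2.2 _ hm).1 rfl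
  have c4 : (F \ S').card + S'.card = F.card := Finset.card_sdiff_add_card_eq_card h'.subset
  have c5 : 0 < S'.card := Finset.card_pos.2 ⟨t, tS⟩
  exact ih _ (by omega) hsite hp' (by omega) (by omega) rfl

/-- The lower bound `2 * n / 3 - O(√n)` in integral form. -/
theorem le_g_completeGraph_three (n : ℕ) :
    8 * n ≤ 12 * g n (SimpleGraph.completeGraph (Fin 3)) (starWithLeaves 5) +
      484 * (n.sqrt + 1) + 12 := by
  have hdeg : ∀ v : Fin n, degreeIn (∅ : Finset (Sym2 (Fin n))) v = 0 := fun v => by simp [degreeIn]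
  have hp : Position (∅ : Finset (Sym2 (Fin n))) ∅ :=
    ⟨fun v => by rw [hdeg]; omega, by simp, le_rfl⟩
  have hs : Site (∅ : Finset (Sym2 (Fin n))) Finset.univ ∅ ∅ ∅ ∅ :=
    ⟨⟨⟨by simp, by simp, by simp, by simp⟩, by simp, by simp, by simp, by simp⟩, by simp, by simp,
      fun v _ _ => hdeg v⟩
  have hv : g n (SimpleGraph.completeGraph (Fin 3)) (starWithLeaves 5) =
      value (∅ : Finset (Sym2 (Fin n))) ∅ := rfl
  rw [hv]
  have hle : ∀ k, 12 * k + 484 * (n.sqrt + 1) ≤ 8 * n →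
      k ≤ value (∅ : Finset (Sym2 (Fin n))) ∅ := by
    intro k hk
    refine hs.le_value (Nat.lt_succ_sqrt n) hp rfl ?_
    rw [Finset.card_univ, Fintype.card_fin]
    exact hk.trans (Nat.le_add_left _ _)
  generalize value (∅ : Finset (Sym2 (Fin n))) ∅ = m at hle
  generalize n.sqrt = s at hle
  have := hle ((8 * n - 484 * (s + 1)) / 12)
  omega

end LowerBound
end ConstructorBlocker

theorem theorem4 :
    (∃ ε : ℕ → ℝ, Tendsto ε atTop (𝓝 0) ∧
      ∀ n : ℕ, (1 + ε n) * (2 * (n : ℝ) / 3) ≤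
        (ConstructorBlocker.g n (SimpleGraph.completeGraph (Fin 3))
          (ConstructorBlocker.starWithLeaves 5) : ℝ)) ∧
    (∃ ε : ℕ → ℝ, Tendsto ε atTop (𝓝 0) ∧
      ∀ n : ℕ, (ConstructorBlocker.g n (SimpleGraph.completeGraph (Fin 3))
          (ConstructorBlocker.starWithLeaves 5) : ℝ) ≤ (1 + ε n) * (n : ℝ)) ∧
    (∀ n : ℕ, ConstructorBlocker.g n (SimpleGraph.completeGraph (Fin 4))
      (ConstructorBlocker.starWithLeaves 5) = 0) := by
  -- the error `484 * (√n + 1) / 12 + 1` is at most `124 / 3 * (√n + 1)`, and `124 / 3 = 2 / 3 * 62`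
  refine ⟨⟨fun n => -(62 * (1 / Real.sqrt n + 1 / n)), ?_, fun n => ?_⟩,
    ⟨fun _ => 0, tendsto_const_nhds, fun n => ?_⟩, ConstructorBlocker.g_completeGraph_four_eq_zero⟩
  · have h1 : Tendsto (fun n : ℕ => 1 / Real.sqrt n) atTop (𝓝 0) :=
      (tendsto_const_nhds.div_atTop (Real.tendsto_sqrt_atTop.comp tendsto_natCast_atTop_atTop))
    have h2 : Tendsto (fun n : ℕ => 1 / (n : ℝ)) atTop (𝓝 0) := tendsto_one_div_atTop_nhds_zero_nat
    simpa using ((h1.add h2).const_mul 62).neg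
  · rcases Nat.eq_zero_or_pos n with rfl | hn
    · simp
    · have h1 := ConstructorBlocker.le_g_completeGraph_three n
      have h2 : (8 : ℝ) * n ≤ 12 * (ConstructorBlocker.g n (SimpleGraph.completeGraph (Fin 3))
          (ConstructorBlocker.starWithLeaves 5) : ℝ) + 484 * ((n.sqrt : ℝ) + 1) + 12 := by
        exact_mod_cast h1
      have h3 : (n.sqrt : ℝ) ≤ Real.sqrt n := Real.nat_sqrt_le_real_sqrt
      have hn' : (0 : ℝ) < n := by exact_mod_cast hn
      have hs : 0 < Real.sqrt n := Real.sqrt_pos.2 hn'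
      have h4 : Real.sqrt n * Real.sqrt n = n := Real.mul_self_sqrt hn'.le
      have h5 : (1 + -(62 * (1 / Real.sqrt n + 1 / n))) * (2 * (n : ℝ) / 3) =
          2 * n / 3 - 124 / 3 * Real.sqrt n - 124 / 3 := by
        have h6 : (n : ℝ) / Real.sqrt n = Real.sqrt n := by
          rw [div_eq_iff hs.ne', h4]
        have h7 : (n : ℝ) / n = 1 := div_self hn'.ne'
        linear_combination (-124 / 3) * h6 - 124 / 3 * h7
      rw [h5]
      linarith
  · have h1 : (ConstructorBlocker.g n (SimpleGraph.completeGraph (Fin 3))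
        (ConstructorBlocker.starWithLeaves 5) : ℝ) ≤ n := by
      exact_mod_cast ConstructorBlocker.g_completeGraph_three_le n
    linarith
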